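/- Let $n\ge 1$, let $Q=2n+2$ and $2^*=\frac{2Q}{Q-2}$, and let $\mathbb H^n=\mathbb C^n\times\mathbb R$ be the Heisenberg group, with points $(z,t)$, $z=x+iy$, Lebesgue measure, horizontal left-invariant vector fields $X_i=\partial_{x_i}+2y_i\partial_t$, $Y_i=\partial_{y_i}-2x_i\partial_t$ ($1\le i\le n$), horizontal gradient $\nabla_{\mathbb H^n}u=(X_1u,\dots,X_nu,Y_1u,\dots,Y_nu)$, sublaplacian $\Delta_{\mathbb H^n}=\sum_i X_i^2+Y_i^2$, dilations $\delta_r(z,t)=(rz,r^2t)$ and homogeneous norm $|(z,t)|=(|z|^4+t^2)^{1/4}$. For $T>1$ let $\Omega_T=\{x\in\mathbb H^n : 1\le |x|\le T\}$, and let $X_T$ be the space of the functions (up to equality almost everywhere) $u\in L^2_{\rm loc}(\mathbb H^n\setminus\{0\})$ whose weak derivatives $X_iu,Y_iu$ on $\mathbb H^n\setminus\{0\}$ belong to $L^2_{\rm loc}(\mathbb H^n\setminus\{0\})$ and such that $u\circ\delta_T=T^{-\frac{Q-2}{2}}u$, with the inner product $\langle u,v\rangle=\int_{\Omega_T}\nabla_{\mathbb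 H^n}u\cdot\nabla_{\mathbb H^n}v$ and the norm $\|u\|=\langle u,u\rangle^{1/2}$. On $X_T$ consider the functional $$\mathcal J_T(u)=\int_{\Omega_T}\left(\frac12|\nabla_{\mathbb H^n}u|^2-\frac1{2^*}|u|^{2^*}\right),$$ and let $\nabla\mathcal J_T(u)\in X_T$ be its gradient at $u$, that is, the element representing the Fréchet differential of $\mathcal J_T$ at $u$ through the inner product of $X_T$. Let $$\omega(z,t)=\frac{c_0}{\left(t^2+(1+|z|^2)^2\right)^{(Q-2)/4}},\qquad \omega_\lambda=\lambda^{\frac{2-Q}{2}}\,\omega\circ\delta_{1/\lambda}\quad(\lambda>0),$$ where $c_0=(2n)^n$ is the positive constant for which $-\Delta_{\mathbb H^n}\omega=\omega^{\frac{Q+2}{Q-2}}$, and let $$\Psi_{\lambda,T}=\sum_{k\in\mathbb Z}\omega_{\lambda/T^k}.$$ Then for every $\varepsilon>0$ there is $T_0>1$, depending only on $n$ and $\varepsilon$, such that for every $T\ge T_0$ and every $\lambda>0$ the series defining $\Psi_{\lambda,T}$ converges at every point of $\mathbb H^n\setminus\{0\}$, its sum belongs to $X_T$, the functional $\mathcal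 J_T$ has a gradient at $\Psi_{\lambda,T}$, and $$\|\nabla\mathcal J_T(\Psi_{\lambda,T})\|<\varepsilon .$$ -/

import Mathlib

open MeasureTheory
open scoped ContDiff

namespace Heisenberg

noncomputable section

/-- The underlying space `ℂⁿ × ℝ` of the Heisenberg group `ℍⁿ`; a point is `(z, t)`, and
`volume` on it is the Lebesgue measure. -/
abbrev Heis (n : ℕ) : Type := (Fin n → ℂ) × ℝ

/-- The homogeneous dimension `Q = 2n + 2`. -/
def homDim (n : ℕ) : ℝ := 2 * (n : ℝ) + 2

/-- The critical exponent `2* = 2Q / (Q - 2)`. -/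
def critExp (n : ℕ) : ℝ := 2 * homDim n / (homDim n - 2)

/-- The Euclidean square norm `|z|²` of the horizontal component. -/
def zSq {n : ℕ} (p : Heis n) : ℝ := ∑ i, ‖p.1 i‖ ^ 2

/-- The homogeneous norm `|(z, t)| = (|z|⁴ + t²)^{1/4}`. -/
def homNorm {n : ℕ} (p : Heis n) : ℝ := (zSq p ^ 2 + p.2 ^ 2) ^ ((1 : ℝ) / 4)

/-- The dilations `δ_r (z, t) = (r z, r² t)`. -/
def dil {n : ℕ} (r : ℝ) (p : Heis n) : Heis n := (r • p.1, r ^ 2 * p.2)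

/-- The horizontal left invariant vector fields: `X_i = ∂/∂x_i + 2 y_i ∂/∂t` for the index
`Sum.inl i`, and `Y_i = ∂/∂y_i - 2 x_i ∂/∂t` for the index `Sum.inr i`, where `z = x + i y`. -/
def field {n : ℕ} : Fin n ⊕ Fin n → Heis n → Heis n
  | Sum.inl i, p => (Pi.single i 1, 2 * (p.1 i).im)
  | Sum.inr i, p => (Pi.single i Complex.I, -2 * (p.1 i).re)

/-- The derivative of a (smooth) function along a horizontal field. -/
def fieldDeriv {n : ℕ} (i : Fin n ⊕ Fin n) (φ : Heis n → ℝ) (p : Heis n) : ℝ :=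
  fderiv ℝ φ p (field i p)

/-- Test functions on `ℍⁿ \ {0}`. -/
structure IsTest {n : ℕ} (φ : Heis n → ℝ) : Prop where
  smooth : ContDiff ℝ ∞ φ
  compact : HasCompactSupport φ
  support : tsupport φ ⊆ {0}ᶜ

/-- `u ∈ L²_loc(ℍⁿ \ {0})`. -/
def L2Loc {n : ℕ} (u : Heis n → ℝ) : Prop :=
  ∀ K : Set (Heis n), IsCompact K → K ⊆ {0}ᶜ → MemLp u 2 (volume.restrict K)

/-- `v ∈ L²_loc(ℍⁿ \ {0})` is the weak derivative of `u` on `ℍⁿ \ {0}` along the `i`-th horizontal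
field (these fields are divergence free, hence formally skew-adjoint). -/
def IsWeakDeriv {n : ℕ} (i : Fin n ⊕ Fin n) (u v : Heis n → ℝ) : Prop :=
  L2Loc v ∧ ∀ φ : Heis n → ℝ, IsTest φ → ∫ p, u p * fieldDeriv i φ p = -∫ p, v p * φ p

/-- `u ∈ S¹_loc(ℍⁿ \ {0})`: `u` and its weak horizontal derivatives are in `L²_loc(ℍⁿ \ {0})`. -/
def S1Loc {n : ℕ} (u : Heis n → ℝ) : Prop :=
  L2Loc u ∧ ∀ i, ∃ v, IsWeakDeriv i u v

open Classical in
/-- The weak derivative of `u` along the `i`-th horizontal field (unique almost everywhere when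
it exists, and `0` by convention otherwise). -/
def weakDeriv {n : ℕ} (i : Fin n ⊕ Fin n) (u : Heis n → ℝ) : Heis n → ℝ :=
  if h : ∃ v, IsWeakDeriv i u v then h.choose else 0

/-- The closed annulus `Ω_T = {1 ≤ |x| ≤ T}`. -/
def annulus (n : ℕ) (T : ℝ) : Set (Heis n) := {p | 1 ≤ homNorm p ∧ homNorm p ≤ T}

/-! ### Auxiliary facts needed for the definition of the space `X_T` -/

lemma continuous_zSq {n : ℕ} : Continuous (zSq : Heis n → ℝ) := by
  unfold zSq; fun_prop

lemma zSq_nonneg {n : ℕ} (p : Heis n) : 0 ≤ zSq p :=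
  Finset.sum_nonneg fun _ _ => by positivity

lemma continuous_homNorm {n : ℕ} : Continuous (homNorm : Heis n → ℝ) := by
  unfold homNorm
  have := continuous_zSq (n := n)
  exact Continuous.rpow_const (by fun_prop) (fun _ => Or.inr (by norm_num))

lemma homNorm_zero {n : ℕ} : homNorm (0 : Heis n) = 0 := by
  simp [homNorm, zSq]

lemma homNorm_pow {n : ℕ} (p : Heis n) : homNorm p ^ 4 = zSq p ^ 2 + p.2 ^ 2 := by
  unfold homNorm
  rw [← Real.rpow_natCast, ← Real.rpow_mul (by positivity)]
  norm_num

lemma homNorm_nonneg {n : ℕ} (p : Heis n) : 0 ≤ homNorm p := by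
  unfold homNorm; positivity

lemma isCompact_annulus (n : ℕ) (T : ℝ) : IsCompact (annulus n T) := by
  apply Metric.isCompact_of_isClosed_isBounded
  · exact (isClosed_le continuous_const continuous_homNorm).inter
      (isClosed_le continuous_homNorm continuous_const)
  · rw [isBounded_iff_forall_norm_le]
    refine ⟨T ^ 2, fun p hp => ?_⟩
    have h1 : 1 ≤ T := hp.1.trans hp.2
    have h4 : zSq p ^ 2 + p.2 ^ 2 ≤ (T ^ 2) ^ 2 := by
      rw [← homNorm_pow, ← pow_mul]
      exact pow_le_pow_left₀ (homNorm_nonneg p) hp.2 4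
    have hz : zSq p ≤ T ^ 2 := abs_le_of_sq_le_sq' (by nlinarith [sq_nonneg p.2]) (by positivity) |>.2
    have ht : |p.2| ≤ T ^ 2 :=
      abs_le_of_sq_le_sq (by nlinarith [sq_nonneg (zSq p)]) (by positivity)
    refine (norm_prod_le_iff).2 ⟨(pi_norm_le_iff_of_nonneg (by positivity)).2 fun i => ?_, by
      simpa using ht⟩
    have hi : ‖p.1 i‖ ^ 2 ≤ zSq p :=
      Finset.single_le_sum (f := fun j => ‖p.1 j‖ ^ 2) (fun _ _ => by positivity)
        (Finset.mem_univ i)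
    have : ‖p.1 i‖ ≤ T := abs_le_of_sq_le_sq' (by linarith) (by linarith) |>.2
    nlinarith

lemma annulus_subset (n : ℕ) (T : ℝ) : annulus n T ⊆ {0}ᶜ := by
  rintro p hp rfl
  have := hp.1
  rw [homNorm_zero] at this
  norm_num at this

lemma L2Loc.add {n : ℕ} {u v : Heis n → ℝ} (hu : L2Loc u) (hv : L2Loc v) :
    L2Loc (fun p => u p + v p) :=
  fun K hK h0 => (hu K hK h0).add (hv K hK h0)

lemma L2Loc.const_mul {n : ℕ} {u : Heis n → ℝ} (c : ℝ) (hu : L2Loc u) :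
    L2Loc (fun p => c * u p) :=
  fun K hK h0 => (hu K hK h0).const_mul c

lemma L2Loc.congr {n : ℕ} {u v : Heis n → ℝ} (hu : L2Loc u) (h : u =ᵐ[volume] v) : L2Loc v :=
  fun K hK h0 => (memLp_congr_ae (ae_restrict_of_ae h)).1 (hu K hK h0)

lemma L2Loc.locallyIntegrableOn {n : ℕ} {u : Heis n → ℝ} (hu : L2Loc u) :
    LocallyIntegrableOn u ({0}ᶜ : Set (Heis n)) volume := by
  rw [locallyIntegrableOn_iff (isOpen_compl_singleton.isLocallyClosed)]
  intro K hK0 hK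
  have : IsFiniteMeasure (volume.restrict K) := ⟨by
    rw [Measure.restrict_apply_univ]; exact hK.measure_lt_top⟩
  exact (hu K hK hK0).integrable (by norm_num)

lemma L2Loc.integrable_mul {n : ℕ} {u g : Heis n → ℝ} (hu : L2Loc u) (hg : Continuous g)
    (hc : HasCompactSupport g) (h0 : tsupport g ⊆ {0}ᶜ) :
    Integrable (fun p => u p * g p) := by
  have h1 : IntegrableOn (fun p => u p * g p) (tsupport g) := by
    have : IsFiniteMeasure (volume.restrict (tsupport g)) := ⟨by
      rw [Measure.restrict_apply_univ]; exact hc.isCompact.measure_lt_top⟩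
    exact IntegrableOn.mul_continuousOn ((hu _ hc.isCompact h0).integrable (by norm_num))
      hg.continuousOn hc.isCompact
  refine (integrableOn_iff_integrable_of_support_subset ?_).1 h1
  intro p hp
  apply subset_tsupport
  rw [Function.mem_support] at hp ⊢
  exact right_ne_zero_of_mul hp

lemma continuous_field {n : ℕ} (i : Fin n ⊕ Fin n) : Continuous (field i : Heis n → Heis n) := by
  rcases i with i | i
  · change Continuous fun p : Heis n => ((Pi.single i 1, 2 * (p.1 i).im) : Heis n)
    have : Continuous fun p : Heis n => (p.1 i).im := Complex.continuous_im.comp (by fun_prop)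
    fun_prop
  · change Continuous fun p : Heis n => ((Pi.single i Complex.I, -2 * (p.1 i).re) : Heis n)
    have : Continuous fun p : Heis n => (p.1 i).re := Complex.continuous_re.comp (by fun_prop)
    fun_prop

lemma IsTest.integrable_left {n : ℕ} {φ u : Heis n → ℝ} (hφ : IsTest φ) (hu : L2Loc u)
    (i : Fin n ⊕ Fin n) : Integrable (fun p => u p * fieldDeriv i φ p) := by
  have hsub : tsupport (fieldDeriv i φ) ⊆ tsupport φ := by
    refine closure_minimal ?_ (isClosed_tsupport φ)
    intro p hp
    apply support_fderiv_subset ℝ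
    rw [Function.mem_support] at hp ⊢
    intro h
    exact hp (by simp [fieldDeriv, h])
  refine hu.integrable_mul ?_ ?_ (hsub.trans hφ.support)
  · exact (hφ.smooth.continuous_fderiv (by simp)).clm_apply (continuous_field i)
  · exact hφ.compact.isCompact.of_isClosed_subset (isClosed_tsupport _) hsub

lemma IsTest.integrable_right {n : ℕ} {φ u : Heis n → ℝ} (hφ : IsTest φ) (hu : L2Loc u) :
    Integrable (fun p => u p * φ p) :=
  hu.integrable_mul hφ.smooth.continuous hφ.compact hφ.support

lemma IsWeakDeriv.congr {n : ℕ} {i : Fin n ⊕ Fin n} {u u' v : Heis n → ℝ}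
    (h : IsWeakDeriv i u v) (hu : u =ᵐ[volume] u') : IsWeakDeriv i u' v := by
  refine ⟨h.1, fun φ hφ => ?_⟩
  rw [← h.2 φ hφ]
  refine integral_congr_ae ?_
  filter_upwards [hu] with p hp
  rw [hp]

lemma IsWeakDeriv.add {n : ℕ} {i : Fin n ⊕ Fin n} {u u' v v' : Heis n → ℝ}
    (hu : L2Loc u) (hu' : L2Loc u') (h : IsWeakDeriv i u v) (h' : IsWeakDeriv i u' v') :
    IsWeakDeriv i (fun p => u p + u' p) (fun p => v p + v' p) := by
  refine ⟨h.1.add h'.1, fun φ hφ => ?_⟩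
  simp only [add_mul]
  rw [integral_add (hφ.integrable_left hu i) (hφ.integrable_left hu' i),
    integral_add (hφ.integrable_right h.1) (hφ.integrable_right h'.1), h.2 φ hφ, h'.2 φ hφ]
  ring

lemma IsWeakDeriv.const_mul {n : ℕ} {i : Fin n ⊕ Fin n} {u v : Heis n → ℝ} (c : ℝ)
    (h : IsWeakDeriv i u v) : IsWeakDeriv i (fun p => c * u p) (fun p => c * v p) := by
  refine ⟨h.1.const_mul c, fun φ hφ => ?_⟩
  simp only [mul_assoc]
  rw [integral_const_mul, integral_const_mul, h.2 φ hφ]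
  ring

/-- Weak derivatives are unique almost everywhere. -/
lemma IsWeakDeriv.unique {n : ℕ} {i : Fin n ⊕ Fin n} {u v v' : Heis n → ℝ}
    (h : IsWeakDeriv i u v) (h' : IsWeakDeriv i u v') : v =ᵐ[volume] v' := by
  have hd : L2Loc (fun p => v p + (-1) * v' p) := h.1.add (h'.1.const_mul (-1))
  have key := isOpen_compl_singleton.ae_eq_zero_of_integral_contDiff_smul_eq_zero
    hd.locallyIntegrableOn (fun φ h1 h2 h3 => by
      have hφ : IsTest φ := ⟨h1, h2, h3⟩
      have e : ∀ p, φ p • (v p + (-1) * v' p) = v p * φ p - v' p * φ p := fun p => by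
        rw [smul_eq_mul]; ring
      simp only [e]
      rw [integral_sub (hφ.integrable_right h.1) (hφ.integrable_right h'.1)]
      have := h.2 φ hφ
      have := h'.2 φ hφ
      linarith)
  have h0 : ∀ᵐ p : Heis n, p ∈ ({0}ᶜ : Set (Heis n)) :=
    compl_mem_ae_iff.2 (by
      rw [show ({0} : Set (Heis n)) = {0} ×ˢ {0} by simp [Prod.zero_eq_mk],
        Measure.volume_eq_prod, Measure.prod_prod, measure_singleton (0 : ℝ), mul_zero])
  filter_upwards [key, h0] with p hp hp0
  have := hp hp0
  linarith

lemma weakDeriv_spec {n : ℕ} {i : Fin n ⊕ Fin n} {u : Heis n → ℝ} (h : ∃ v, IsWeakDeriv i u v) :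
    IsWeakDeriv i u (weakDeriv i u) := by
  unfold weakDeriv
  rw [dif_pos h]
  exact h.choose_spec

lemma S1Loc.congr {n : ℕ} {u u' : Heis n → ℝ} (h : S1Loc u) (hu : u =ᵐ[volume] u') : S1Loc u' :=
  ⟨h.1.congr hu, fun i => (h.2 i).imp fun _ hv => hv.congr hu⟩

lemma S1Loc.add {n : ℕ} {u v : Heis n → ℝ} (hu : S1Loc u) (hv : S1Loc v) :
    S1Loc (fun p => u p + v p) :=
  ⟨hu.1.add hv.1, fun i => by
    obtain ⟨a, ha⟩ := hu.2 i
    obtain ⟨b, hb⟩ := hv.2 i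
    exact ⟨_, ha.add hu.1 hv.1 hb⟩⟩

lemma S1Loc.const_mul {n : ℕ} {u : Heis n → ℝ} (c : ℝ) (hu : S1Loc u) :
    S1Loc (fun p => c * u p) :=
  ⟨hu.1.const_mul c, fun i => by
    obtain ⟨a, ha⟩ := hu.2 i
    exact ⟨_, ha.const_mul c⟩⟩

/-- Dilations preserve null sets. -/
lemma quasiMeasurePreserving_dil {n : ℕ} {r : ℝ} (hr : r ≠ 0) :
    Measure.QuasiMeasurePreserving (dil r : Heis n → Heis n) volume volume := by
  let e : Heis n ≃ₗ[ℝ] Heis n :=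
    LinearEquiv.prodCongr (LinearEquiv.smulOfNeZero ℝ (Fin n → ℂ) r hr)
      (LinearEquiv.smulOfNeZero ℝ ℝ (r ^ 2) (pow_ne_zero 2 hr))
  have h1 : (volume : Measure (Fin n → ℂ)).IsAddHaarMeasure :=
    inferInstanceAs (Measure.pi fun _ : Fin n => (volume : Measure ℂ)).IsAddHaarMeasure
  have h2 : (volume : Measure (Heis n)).IsAddHaarMeasure :=
    inferInstanceAs
      ((volume : Measure (Fin n → ℂ)).prod (volume : Measure ℝ)).IsAddHaarMeasure
  exact Measure.LinearMap.quasiMeasurePreserving volume (e : Heis n →ₗ[ℝ] Heis n)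
    (LinearEquiv.isUnit_det' e).ne_zero

/-! ### The space `X_T` -/

/-- The set of (classes of almost everywhere equal) functions `u ∈ S¹_loc(ℍⁿ \ {0})` such that
`u ∘ δ_T = T^{-(Q-2)/2} u`, as a vector space. -/
def XSub (n : ℕ) (T : ℝ) (hT : 1 < T) : Submodule ℝ (Heis n →ₘ[volume] ℝ) where
  carrier := {u | S1Loc (u : Heis n → ℝ) ∧
    ∀ᵐ p : Heis n, u (dil T p) = T ^ (-((homDim n - 2) / 2)) * u p}
  zero_mem' := by
    have h0 := AEEqFun.coeFn_zero (α := Heis n) (β := ℝ) (μ := volume)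
    have hd := (quasiMeasurePreserving_dil (n := n) (by linarith : T ≠ 0)).ae h0
    refine ⟨?_, ?_⟩
    · refine S1Loc.congr (u := fun _ => 0) ?_ h0.symm
      have hz : L2Loc (fun _ : Heis n => (0 : ℝ)) := fun K _ _ => MemLp.zero'
      exact ⟨hz, fun i => ⟨fun _ => 0, hz, by simp⟩⟩
    · filter_upwards [h0, hd] with p h1 h2
      rw [h1, h2]; simp
  add_mem' := by
    rintro u v ⟨hu, hu'⟩ ⟨hv, hv'⟩
    have h0 := AEEqFun.coeFn_add u v
    have hd := (quasiMeasurePreserving_dil (n := n) (by linarith : T ≠ 0)).ae h0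
    refine ⟨(hu.add hv).congr h0.symm, ?_⟩
    filter_upwards [h0, hd, hu', hv'] with p h1 h2 h3 h4
    rw [h1, h2, Pi.add_apply, Pi.add_apply, h3, h4]; ring
  smul_mem' := by
    rintro c u ⟨hu, hu'⟩
    have h0 := AEEqFun.coeFn_smul c u
    have hd := (quasiMeasurePreserving_dil (n := n) (by linarith : T ≠ 0)).ae h0
    refine ⟨(hu.const_mul c).congr h0.symm, ?_⟩
    filter_upwards [h0, hd, hu'] with p h1 h2 h3
    rw [h1, h2, Pi.smul_apply, Pi.smul_apply, h3, smul_eq_mul, smul_eq_mul]; ring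

/-- The space `X_T`. -/
def X (n : ℕ) (T : ℝ) (hT : 1 < T) : Type := XSub n T hT

variable {n : ℕ} {T : ℝ} {hT : 1 < T}

instance : AddCommGroup (X n T hT) := inferInstanceAs (AddCommGroup (XSub n T hT))

instance : Module ℝ (X n T hT) := inferInstanceAs (Module ℝ (XSub n T hT))

/-- A representative of an element of `X_T`. -/
def X.toFun (u : X n T hT) : Heis n → ℝ := (u.1 : Heis n →ₘ[volume] ℝ)

/-- The components `X_i u`, `Y_i u` of the (weak) horizontal gradient of `u ∈ X_T`. -/
def X.grad (u : X n T hT) (i : Fin n ⊕ Fin n) : Heis n → ℝ := weakDeriv i u.toFun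

lemma X.grad_spec (u : X n T hT) (i : Fin n ⊕ Fin n) : IsWeakDeriv i u.toFun (u.grad i) :=
  weakDeriv_spec (u.2.1.2 i)

lemma X.grad_add (u v : X n T hT) (i : Fin n ⊕ Fin n) :
    (u + v).grad i =ᵐ[volume] fun p => u.grad i p + v.grad i p :=
  ((u + v).grad_spec i).unique
    (((u.grad_spec i).add u.2.1.1 v.2.1.1 (v.grad_spec i)).congr (AEEqFun.coeFn_add u.1 v.1).symm)

lemma X.grad_smul (c : ℝ) (u : X n T hT) (i : Fin n ⊕ Fin n) :
    (c • u).grad i =ᵐ[volume] fun p => c * u.grad i p :=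
  ((c • u).grad_spec i).unique
    (((u.grad_spec i).const_mul c).congr (AEEqFun.coeFn_smul c u.1).symm)

lemma X.integrable_grad_mul (u v : X n T hT) (i : Fin n ⊕ Fin n) :
    IntegrableOn (fun p => u.grad i p * v.grad i p) (annulus n T) :=
  ((u.grad_spec i).1 _ (isCompact_annulus n T) (annulus_subset n T)).integrable_mul
    ((v.grad_spec i).1 _ (isCompact_annulus n T) (annulus_subset n T))

/-- The product `⟨u, v⟩ = ∫_{Ω_T} ∇u · ∇v` of `X_T`. -/
def X.prod (u v : X n T hT) : ℝ := ∫ p in annulus n T, ∑ i, u.grad i p * v.grad i p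

/-- The product of `X_T` is bilinear, symmetric and nonnegative. -/
@[reducible]
def X.core (n : ℕ) (T : ℝ) (hT : 1 < T) : PreInnerProductSpace.Core ℝ (X n T hT) where
  inner := X.prod
  conj_inner_symm u v := by
    simp only [X.prod, conj_trivial]
    congr 1; ext p
    exact Finset.sum_congr rfl fun i _ => mul_comm _ _
  re_inner_nonneg u := by
    simp only [X.prod]
    exact integral_nonneg fun p => Finset.sum_nonneg fun i _ => mul_self_nonneg _
  add_left u v w := by
    simp only [X.prod]
    rw [← integral_add (integrable_finsetSum _ fun i _ => u.integrable_grad_mul w i)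
      (integrable_finsetSum _ fun i _ => v.integrable_grad_mul w i)]
    have h : ∀ᵐ p : Heis n, ∀ i, (u + v).grad i p = u.grad i p + v.grad i p :=
      ae_all_iff.2 fun i => X.grad_add u v i
    refine integral_congr_ae ?_
    filter_upwards [ae_restrict_of_ae h] with p hp
    rw [← Finset.sum_add_distrib]
    exact Finset.sum_congr rfl fun i _ => by rw [hp i]; ring
  smul_left u v c := by
    simp only [X.prod, conj_trivial]
    rw [← integral_const_mul]
    have h : ∀ᵐ p : Heis n, ∀ i, (c • u).grad i p = c * u.grad i p :=
      ae_all_iff.2 fun i => X.grad_smul c u i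
    refine integral_congr_ae ?_
    filter_upwards [ae_restrict_of_ae h] with p hp
    rw [Finset.mul_sum]
    exact Finset.sum_congr rfl fun i _ => by rw [hp i]; ring

/-- `X_T` with the norm `‖u‖ = ⟨u, u⟩^{1/2}`. -/
instance : SeminormedAddCommGroup (X n T hT) :=
  @InnerProductSpace.Core.toSeminormedAddCommGroup ℝ (X n T hT) _ _ _ (X.core n T hT)

/-- `X_T` with its inner product `⟨u, v⟩ = ∫_{Ω_T} ∇u · ∇v`. -/
instance : InnerProductSpace ℝ (X n T hT) := InnerProductSpace.ofCore (X.core n T hT)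

/-- The functional `J_T(u) = ∫_{Ω_T} (½ |∇u|² - (1/2*) |u|^{2*})` on `X_T`. -/
def functional (n : ℕ) (T : ℝ) (hT : 1 < T) (u : X n T hT) : ℝ :=
  ∫ p in annulus n T,
    ((1 / 2) * ∑ i, u.grad i p ^ 2 - (1 / critExp n) * |u.toFun p| ^ critExp n)

/-- `g` is the gradient of `J` at `u` in the inner product space `X_T`: `J` is Fréchet
differentiable at `u` with differential `φ ↦ ⟨g, φ⟩`. -/
def IsGradientAt (J : X n T hT → ℝ) (g u : X n T hT) : Prop :=
  HasFDerivAt J (innerSL ℝ g) u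

/-! ### The bubbles and their periodization -/

/-- `ω(z, t) = c₀ (t² + (1 + |z|²)²)^{-(Q-2)/4}`, where `c₀ = (2n)ⁿ` is the positive constant for
which `-Δω = ω^{(Q+2)/(Q-2)}`. -/
def bubble (n : ℕ) (p : Heis n) : ℝ :=
  (2 * (n : ℝ)) ^ n * (1 / (p.2 ^ 2 + (1 + zSq p) ^ 2) ^ ((homDim n - 2) / 4))

/-- `ω_r = r^{(2-Q)/2} ω ∘ δ_{1/r}`. -/
def bubbleScaled (n : ℕ) (r : ℝ) (p : Heis n) : ℝ :=
  r ^ ((2 - homDim n) / 2) * bubble n (dil r⁻¹ p)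

/-- `Ψ_{r,T} = ∑_{k ∈ ℤ} ω_{r / T^k}`. -/
def periodizedBubble (n : ℕ) (r T : ℝ) (p : Heis n) : ℝ :=
  ∑' k : ℤ, bubbleScaled n (r / T ^ k) p

/-- `u` is the element of `X_T` given by the function `Ψ_{r,T}`. -/
def IsPeriodizedBubble (r : ℝ) (u : X n T hT) : Prop :=
  u.toFun =ᵐ[volume] periodizedBubble n r T

end

end Heisenberg

open Heisenberg

/-! Write `Q = 2n + 2`, `e = 1 + 2/n = (Q+2)/(Q-2)`, so that `2* = e + 1`, and let `ω_k` be the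
bubble at the scale `r / T^k`. Each bubble solves `-Δω_k = ω_k^e` on the whole group. Since `δ_T`
permutes the annuli, the pairing of `Ψ = ∑ ω_k` with `ψ` over one annulus unfolds into an integral
of a single bubble over `ℍⁿ`; there the equation applies, and folding back gives `⟨Ψ, ψ⟩ = ∫_{Ω_T}
(∑ ω_k^e) ψ` (`inner_periodizedBubble`). Hence the differential of the functional at `Ψ` is the
integral of `ψ` against `∑ ω_k^e - (∑ ω_k)^e`.

At a point `p` one has `ω_k(p) ≤ c |p|^{-n} min(x_k, 1/x_k)` with `x_k = r / (T^k |p|)`. Consecutive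
`x_k` differ by a factor `T`, so all but one of these minima add up to `O(T^{-1/2})`
(`exists_tsum_scaleMin_le`). With a single dominant term the power is almost additive, and the error
is `O(T^{-1/2}) |p|^{-(n+2)}` (`exists_abs_periodizedBubble_rpow_sub_le`). Integrating it against
`ψ` costs only a factor `log T`, by Cauchy–Schwarz, the logarithmic growth of `∫_{Ω_T} |p|^{-Q}` and
Hardy's inequality (`exists_lintegral_inv_mul_abs_le`). The gradient therefore has norm `O(T^{-1/2}
log T)`, uniformly in `r`.

Hardy's inequality follows by Hölder from a Sobolev inequality in `X_T` whose constant does not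
depend on `T` (`exists_sobolev_X`). To get it, `u` is multiplied by a logarithmic cutoff equal to
`1` on `Ω_T` with gradient `O(1 / (|p| log T))`. The Sobolev inequality of `ℍⁿ` then produces an
extra term `(log T)^{-2} ∫ u²/|p|²`, which by Hölder is `O(1 / log T)` times the square of the
`L^{2*}` norm of `u`, and is absorbed when `T` is large.

The Sobolev inequality on the group (`exists_sobolev_cutoff`) uses the bubbles once more. The
functions `G_s` are regularized fundamental solutions: `-ΔG_s` is an approximate identity up to a
constant factor, and `|∇G_s|` is bounded by a multiple of `|p|^{1-Q}`. Convolution with `-ΔG_s` is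
thus dominated by a fractional integral of the gradient, which maps `L²` to `L^{2*}`
(`exists_lintegral_rpow_le_of_le_lintegral`), and Fatou's lemma lets `s` tend to `0`.

Finally, a second order Taylor estimate with the Sobolev and Poincaré inequalities gives Fréchet
differentiability at `Ψ` (`hasFDerivAt_functional`), and completeness of `X_T`
(`exists_completeSpace_X`) turns the small differential into a small gradient through the Riesz
representation. -/

namespace Heisenberg

noncomputable section

open Filter Topology
open scoped ENNReal NNReal

/-! ### Horizontal coordinates and the calculus of the horizontal fields -/

section Calculus

variable {n : ℕ}

/-- The horizontal coordinates: `x_i` for `Sum.inl i` and `y_i` for `Sum.inr i`. -/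
def hcoord : Fin n ⊕ Fin n → Heis n → ℝ
  | Sum.inl i, p => (p.1 i).re
  | Sum.inr i, p => (p.1 i).im

/-- The rotated horizontal coordinates: `y_i` for `Sum.inl i` and `-x_i` for `Sum.inr i`. -/
def hcoordJ : Fin n ⊕ Fin n → Heis n → ℝ
  | Sum.inl i, p => (p.1 i).im
  | Sum.inr i, p => -(p.1 i).re

/-- The horizontal coordinate vectors. -/
def hvec (n : ℕ) : Fin n ⊕ Fin n → Fin n → ℂ
  | Sum.inl i => Pi.single i 1
  | Sum.inr i => Pi.single i Complex.I

lemma field_eq (i : Fin n ⊕ Fin n) (p : Heis n) : field i p = (hvec n i, 2 * hcoordJ i p) := by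
  rcases i with i | i <;> simp [field, hvec, hcoordJ]

/-- The horizontal coordinates as continuous linear maps. -/
def hcoordL : Fin n ⊕ Fin n → Heis n →L[ℝ] ℝ
  | Sum.inl i => Complex.reCLM ∘L ContinuousLinearMap.proj i ∘L ContinuousLinearMap.fst ℝ _ _
  | Sum.inr i => Complex.imCLM ∘L ContinuousLinearMap.proj i ∘L ContinuousLinearMap.fst ℝ _ _

/-- The rotated horizontal coordinates as continuous linear maps. -/
def hcoordJL : Fin n ⊕ Fin n → Heis n →L[ℝ] ℝ
  | Sum.inl i => Complex.imCLM ∘L ContinuousLinearMap.proj i ∘L ContinuousLinearMap.fst ℝ _ _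
  | Sum.inr i =>
    -(Complex.reCLM ∘L ContinuousLinearMap.proj i ∘L ContinuousLinearMap.fst ℝ _ _)

lemma coe_hcoordL (i : Fin n ⊕ Fin n) : ⇑(hcoordL i) = hcoord i := by
  rcases i with i | i <;> rfl

lemma coe_hcoordJL (i : Fin n ⊕ Fin n) : ⇑(hcoordJL i) = hcoordJ i := by
  rcases i with i | i <;> rfl

lemma contDiff_hcoord (i : Fin n ⊕ Fin n) {m : WithTop ℕ∞} : ContDiff ℝ m (hcoord i) := by
  rw [← coe_hcoordL]; exact (hcoordL i).contDiff

lemma contDiff_hcoordJ (i : Fin n ⊕ Fin n) {m : WithTop ℕ∞} : ContDiff ℝ m (hcoordJ i) := by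
  rw [← coe_hcoordJL]; exact (hcoordJL i).contDiff

lemma zSq_eq_sum_hcoord (p : Heis n) : zSq p = ∑ i, hcoord i p ^ 2 := by
  rw [Fintype.sum_sum_type, ← Finset.sum_add_distrib]
  refine Finset.sum_congr rfl fun i _ => ?_
  rw [← Complex.normSq_eq_norm_sq, Complex.normSq_apply]
  simp only [hcoord]; ring

lemma zSq_eq_sum_hcoordJ (p : Heis n) : zSq p = ∑ i, hcoordJ i p ^ 2 := by
  rw [Fintype.sum_sum_type, ← Finset.sum_add_distrib]
  refine Finset.sum_congr rfl fun i _ => ?_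
  rw [← Complex.normSq_eq_norm_sq, Complex.normSq_apply]
  simp only [hcoordJ]; ring

/-- The orthogonality of `z` and its rotation kills the cross term in `sum_fieldDeriv_quart_sq`. -/
lemma sum_hcoord_mul_hcoordJ (p : Heis n) : ∑ i, hcoord i p * hcoordJ i p = 0 := by
  rw [Fintype.sum_sum_type, ← Finset.sum_add_distrib]
  refine Finset.sum_eq_zero fun i _ => ?_
  simp only [hcoord, hcoordJ]; ring

lemma contDiff_zSq {m : WithTop ℕ∞} : ContDiff ℝ m (zSq : Heis n → ℝ) := by
  have : (zSq : Heis n → ℝ) = fun p => ∑ i, hcoord i p ^ 2 := funext zSq_eq_sum_hcoord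
  rw [this]
  exact ContDiff.sum fun i _ => (contDiff_hcoord i).pow 2

lemma fieldDeriv_hcoord (i j : Fin n ⊕ Fin n) (p : Heis n) :
    fieldDeriv i (hcoord j) p = if i = j then 1 else 0 := by
  rw [fieldDeriv, ← coe_hcoordL, ContinuousLinearMap.fderiv, coe_hcoordL, field_eq]
  rcases i with i | i <;> rcases j with j | j <;>
    by_cases h : i = j <;> simp [hcoord, hvec, h, eq_comm (a := j)]

lemma fieldDeriv_hcoordJ (i : Fin n ⊕ Fin n) (p : Heis n) : fieldDeriv i (hcoordJ i) p = 0 := by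
  rw [fieldDeriv, ← coe_hcoordJL, ContinuousLinearMap.fderiv, coe_hcoordJL, field_eq]
  rcases i with i | i <;> simp [hcoordJ, hvec]

lemma fieldDeriv_snd (i : Fin n ⊕ Fin n) (p : Heis n) :
    fieldDeriv i (fun p : Heis n => p.2) p = 2 * hcoordJ i p := by
  rw [fieldDeriv, show (fun p : Heis n => p.2) = Prod.snd from rfl, fderiv_snd, field_eq]; rfl

lemma fieldDeriv_const (i : Fin n ⊕ Fin n) (c : ℝ) (p : Heis n) :
    fieldDeriv i (fun _ : Heis n => c) p = 0 := by
  simp [fieldDeriv]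

lemma fieldDeriv_add (i : Fin n ⊕ Fin n) {f g : Heis n → ℝ} {p : Heis n}
    (hf : DifferentiableAt ℝ f p) (hg : DifferentiableAt ℝ g p) :
    fieldDeriv i (fun p => f p + g p) p = fieldDeriv i f p + fieldDeriv i g p := by
  simp only [fieldDeriv]; rw [fderiv_fun_add hf hg]; rfl

lemma fieldDeriv_mul (i : Fin n ⊕ Fin n) {f g : Heis n → ℝ} {p : Heis n}
    (hf : DifferentiableAt ℝ f p) (hg : DifferentiableAt ℝ g p) :
    fieldDeriv i (fun p => f p * g p) p = fieldDeriv i f p * g p + f p * fieldDeriv i g p := by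
  simp only [fieldDeriv]; rw [fderiv_fun_mul hf hg]
  simp; ring

lemma fieldDeriv_const_mul (i : Fin n ⊕ Fin n) (c : ℝ) {g : Heis n → ℝ} {p : Heis n}
    (hg : DifferentiableAt ℝ g p) :
    fieldDeriv i (fun p => c * g p) p = c * fieldDeriv i g p := by
  rw [fieldDeriv_mul i (differentiableAt_const c) hg, fieldDeriv_const]; ring

/-- The chain rule for a horizontal derivative. -/
lemma fieldDeriv_comp (i : Fin n ⊕ Fin n) {h : ℝ → ℝ} {h' : ℝ} {f : Heis n → ℝ} {p : Heis n}
    (hh : HasDerivAt h h' (f p)) (hf : DifferentiableAt ℝ f p) :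
    fieldDeriv i (fun p => h (f p)) p = h' * fieldDeriv i f p := by
  simp only [fieldDeriv]
  have := (hh.comp_hasFDerivAt p hf.hasFDerivAt).fderiv
  rw [show (fun p => h (f p)) = h ∘ f from rfl, this]; simp

lemma fieldDeriv_sq (i : Fin n ⊕ Fin n) {f : Heis n → ℝ} {p : Heis n}
    (hf : DifferentiableAt ℝ f p) :
    fieldDeriv i (fun p => f p ^ 2) p = 2 * f p * fieldDeriv i f p :=
  fieldDeriv_comp i (h := fun x => x ^ 2) (by simpa using hasDerivAt_pow 2 (f p)) hf

lemma fieldDeriv_zSq (i : Fin n ⊕ Fin n) (p : Heis n) :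
    fieldDeriv i zSq p = 2 * hcoord i p := by
  have : (zSq : Heis n → ℝ) = fun p => ∑ i, hcoord i p ^ 2 := funext zSq_eq_sum_hcoord
  have hd : ∀ j, DifferentiableAt ℝ (fun p : Heis n => hcoord j p ^ 2) p := fun j =>
    ((contDiff_hcoord j (m := 1)).differentiable one_ne_zero p).pow 2
  rw [this, fieldDeriv, fderiv_fun_sum fun j _ => hd j, sum_apply]
  have e : ∀ j, fderiv ℝ (fun p : Heis n => hcoord j p ^ 2) p (field i p)
      = if i = j then 2 * hcoord j p else 0 := fun j => by
    have := fieldDeriv_sq i ((contDiff_hcoord j (m := 1)).differentiable one_ne_zero p)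
    rw [fieldDeriv_hcoord] at this
    rw [fieldDeriv] at this
    rw [this]; split_ifs <;> simp
  simp only [e, Finset.sum_ite_eq, Finset.mem_univ, if_true]

lemma contDiff_fieldDeriv (i : Fin n ⊕ Fin n) {f : Heis n → ℝ} (hf : ContDiff ℝ ∞ f) :
    ContDiff ℝ ∞ (fieldDeriv i f) := by
  have h1 : ContDiff ℝ ∞ (fderiv ℝ f) := hf.fderiv_right (by simp)
  refine h1.clm_apply ?_
  have : (field i : Heis n → Heis n) = fun p => (hvec n i, 2 * hcoordJ i p) :=
    funext (field_eq i)
  rw [this]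
  exact contDiff_const.prodMk (contDiff_const.mul (contDiff_hcoordJ i))

/-! ### Left translations and dilations -/

/-- The group law of the Heisenberg group: `(z,t)(z',t') = (z + z', t + t' + 2 Im ⟨z, z'⟩)`. -/
def hmul (x w : Heis n) : Heis n :=
  (x.1 + w.1, x.2 + w.2 + 2 * ∑ i, ((x.1 i).im * (w.1 i).re - (x.1 i).re * (w.1 i).im))

lemma hmul_neg_cancel_left (x w : Heis n) : hmul (-x) (hmul x w) = w := by
  refine Prod.ext ?_ ?_
  · simp [hmul]
  · simp only [hmul, Prod.fst_neg, Prod.snd_neg, Pi.neg_apply, Pi.add_apply, Complex.neg_im,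
      Complex.neg_re, Complex.add_re, Complex.add_im]
    have : ∑ i, (-(x.1 i).im * ((x.1 i).re + (w.1 i).re) - -(x.1 i).re * ((x.1 i).im + (w.1 i).im))
        = -∑ i, ((x.1 i).im * (w.1 i).re - (x.1 i).re * (w.1 i).im) := by
      rw [← Finset.sum_neg_distrib]
      exact Finset.sum_congr rfl fun i _ => by ring
    rw [this]; ring

lemma continuous_hmul : Continuous fun q : Heis n × Heis n => hmul q.1 q.2 := by
  unfold hmul
  have h1 : ∀ i, Continuous fun q : Heis n × Heis n => (q.1.1 i).im := fun i =>
    Complex.continuous_im.comp (by fun_prop)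
  have h2 : ∀ i, Continuous fun q : Heis n × Heis n => (q.1.1 i).re := fun i =>
    Complex.continuous_re.comp (by fun_prop)
  have h3 : ∀ i, Continuous fun q : Heis n × Heis n => (q.2.1 i).im := fun i =>
    Complex.continuous_im.comp (by fun_prop)
  have h4 : ∀ i, Continuous fun q : Heis n × Heis n => (q.2.1 i).re := fun i =>
    Complex.continuous_re.comp (by fun_prop)
  fun_prop

/-- The linear part of the left translation by `x`. -/
def lmulL (x : Heis n) : Heis n →L[ℝ] Heis n :=
  (ContinuousLinearMap.fst ℝ _ _).prod (ContinuousLinearMap.snd ℝ _ _ + (2 : ℝ) •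
    ∑ i : Fin n, ((x.1 i).im • hcoordL (Sum.inl i) - (x.1 i).re • hcoordL (Sum.inr i)))

lemma hmul_eq (x w : Heis n) : hmul x w = lmulL x w + x := by
  refine Prod.ext ?_ ?_
  · simp [hmul, lmulL, add_comm]
  · simp [hmul, lmulL, coe_hcoordL, hcoord]; ring

lemma hasFDerivAt_hmul (x w : Heis n) : HasFDerivAt (hmul x) (lmulL x) w := by
  have : hmul x = fun w => lmulL x w + x := funext (hmul_eq x)
  rw [this]
  exact (lmulL x).hasFDerivAt.add_const x

lemma contDiff_hmul (x : Heis n) {m : WithTop ℕ∞} : ContDiff ℝ m (hmul x) := by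
  have : hmul x = fun w => lmulL x w + x := funext (hmul_eq x)
  rw [this]
  exact (lmulL x).contDiff.add contDiff_const

lemma lmulL_field (i : Fin n ⊕ Fin n) (x w : Heis n) :
    lmulL x (field i w) = field i (hmul x w) := by
  rw [field_eq, field_eq]
  refine Prod.ext ?_ ?_
  · simp [lmulL]
  · rcases i with i | i <;>
      simp [lmulL, coe_hcoordL, hcoord, hvec, hcoordJ, hmul, Pi.single_apply, apply_ite,
        Finset.sum_sub_distrib] <;> ring

/-- The horizontal fields are left invariant. -/
lemma fieldDeriv_comp_hmul (i : Fin n ⊕ Fin n) {F : Heis n → ℝ} (hF : Differentiable ℝ F)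
    (x w : Heis n) :
    fieldDeriv i (fun w => F (hmul x w)) w = fieldDeriv i F (hmul x w) := by
  simp only [fieldDeriv]
  have := ((hF (hmul x w)).hasFDerivAt.comp w (hasFDerivAt_hmul x w)).fderiv
  rw [show (fun w => F (hmul x w)) = F ∘ hmul x from rfl, this, ← lmulL_field]; rfl

/-- The dilations as continuous linear maps. -/
def dilL (n : ℕ) (r : ℝ) : Heis n →L[ℝ] Heis n :=
  (r • ContinuousLinearMap.fst ℝ _ _).prod (r ^ 2 • ContinuousLinearMap.snd ℝ _ _)

lemma coe_dilL (r : ℝ) : ⇑(dilL n r) = dil r := by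
  ext p <;> simp [dilL, dil]

lemma continuous_dil (r : ℝ) : Continuous (dil r : Heis n → Heis n) := by
  rw [← coe_dilL]; exact (dilL n r).continuous

lemma hcoordJ_dil (i : Fin n ⊕ Fin n) (r : ℝ) (p : Heis n) :
    hcoordJ i (dil r p) = r * hcoordJ i p := by
  rcases i with i | i <;> simp [hcoordJ, dil]

lemma zSq_dil (r : ℝ) (p : Heis n) : zSq (dil r p) = r ^ 2 * zSq p := by
  simp [zSq, dil, mul_pow, Finset.mul_sum]

lemma dil_dil (r s : ℝ) (p : Heis n) : dil r (dil s p) = dil (r * s) p := by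
  ext <;> simp [dil, mul_assoc, mul_pow]

lemma dil_one (p : Heis n) : dil 1 p = p := by
  ext <;> simp [dil]

lemma homNorm_dil {r : ℝ} (hr : 0 ≤ r) (p : Heis n) : homNorm (dil r p) = r * homNorm p := by
  refine (pow_left_inj₀ (homNorm_nonneg _) (mul_nonneg hr (homNorm_nonneg _)) four_ne_zero).1 ?_
  rw [mul_pow, homNorm_pow, homNorm_pow, zSq_dil]
  simp only [dil]; ring

lemma fieldDeriv_comp_dil (i : Fin n ⊕ Fin n) {F : Heis n → ℝ} {r : ℝ} {p : Heis n}
    (hF : DifferentiableAt ℝ F (dil r p)) :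
    fieldDeriv i (fun p => F (dil r p)) p = r * fieldDeriv i F (dil r p) := by
  simp only [fieldDeriv]
  have hd : HasFDerivAt (dil r : Heis n → Heis n) (dilL n r) p := by
    rw [← coe_dilL]; exact (dilL n r).hasFDerivAt
  have := (hF.hasFDerivAt.comp p hd).fderiv
  rw [show (fun p => F (dil r p)) = F ∘ dil r from rfl, this]
  have e : dilL n r (field i p) = r • field i (dil r p) := by
    rw [coe_dilL, field_eq, field_eq, hcoordJ_dil]
    ext <;> simp [dil]; ring
  rw [ContinuousLinearMap.comp_apply, e, map_smul, smul_eq_mul]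

lemma homNorm_pos {p : Heis n} (hp : p ≠ 0) : 0 < homNorm p := by
  refine lt_of_le_of_ne (homNorm_nonneg p) fun h => hp ?_
  have h4 := homNorm_pow p
  rw [← h] at h4
  have h1 : p.2 = 0 := by nlinarith [sq_nonneg p.2, sq_nonneg (zSq p)]
  have h2 : zSq p = 0 := by nlinarith [sq_nonneg p.2, sq_nonneg (zSq p)]
  refine Prod.ext (funext fun i => ?_) h1
  have := (Finset.sum_eq_zero_iff_of_nonneg (fun i _ => by positivity)).1 h2 i (Finset.mem_univ i)
  simpa using this

lemma homNorm_pos_iff {p : Heis n} : 0 < homNorm p ↔ p ≠ 0 :=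
  ⟨fun h h0 => by rw [h0, homNorm_zero] at h; exact lt_irrefl _ h, homNorm_pos⟩

lemma zSq_le_homNorm_sq (p : Heis n) : zSq p ≤ homNorm p ^ 2 := by
  refine abs_le_of_sq_le_sq' ?_ (by positivity) |>.2
  rw [← pow_mul, homNorm_pow]; nlinarith [sq_nonneg p.2]

/-! ### The regularized fundamental solutions -/

/-- `D_s = t² + (s² + |z|²)²`; in particular `D_0 = |(z,t)|⁴`. -/
def quart (s : ℝ) (p : Heis n) : ℝ := p.2 ^ 2 + (s ^ 2 + zSq p) ^ 2

lemma quart_zero (p : Heis n) : quart 0 p = homNorm p ^ 4 := by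
  rw [homNorm_pow, quart]; ring

lemma homNorm_pow_le_quart (s : ℝ) (p : Heis n) : homNorm p ^ 4 ≤ quart s p := by
  rw [homNorm_pow, quart]; nlinarith [zSq_nonneg p, sq_nonneg s]

lemma pow_le_quart (s : ℝ) (p : Heis n) : s ^ 4 ≤ quart s p := by
  rw [quart]; nlinarith [zSq_nonneg p, sq_nonneg s, sq_nonneg p.2]

lemma quart_pos {s : ℝ} (hs : 0 < s) (p : Heis n) : 0 < quart s p :=
  lt_of_lt_of_le (by positivity) (pow_le_quart s p)

lemma quart_dil (r s : ℝ) (p : Heis n) : quart (r * s) (dil r p) = r ^ 4 * quart s p := by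
  simp only [quart, zSq_dil]; simp only [dil]; ring

lemma contDiff_quart (s : ℝ) {m : WithTop ℕ∞} : ContDiff ℝ m (quart s : Heis n → ℝ) := by
  unfold quart
  exact (contDiff_snd.pow 2).add ((contDiff_const.add contDiff_zSq).pow 2)

lemma differentiable_quart (s : ℝ) : Differentiable ℝ (quart s : Heis n → ℝ) :=
  (contDiff_quart s (m := 1)).differentiable one_ne_zero

lemma fieldDeriv_quart (i : Fin n ⊕ Fin n) (s : ℝ) (p : Heis n) :
    fieldDeriv i (quart s) p = 4 * ((s ^ 2 + zSq p) * hcoord i p + p.2 * hcoordJ i p) := by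
  have hz : DifferentiableAt ℝ (zSq : Heis n → ℝ) p :=
    (contDiff_zSq (m := 1)).differentiable one_ne_zero p
  have hs : DifferentiableAt ℝ (fun p : Heis n => p.2) p := differentiableAt_snd
  have hA : DifferentiableAt ℝ (fun p : Heis n => s ^ 2 + zSq p) p := hz.const_add _
  have := fieldDeriv_add i (hs.fun_pow 2) (hA.fun_pow 2)
  unfold quart
  rw [this, fieldDeriv_sq i hs, fieldDeriv_sq i hA, fieldDeriv_snd,
    fieldDeriv_add i (differentiableAt_const _) hz, fieldDeriv_const, fieldDeriv_zSq]
  ring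

lemma fieldDeriv_fieldDeriv_quart (i : Fin n ⊕ Fin n) (s : ℝ) (p : Heis n) :
    fieldDeriv i (fieldDeriv i (quart s)) p
      = 4 * (s ^ 2 + zSq p) + 8 * (hcoord i p ^ 2 + hcoordJ i p ^ 2) := by
  have hz : DifferentiableAt ℝ (zSq : Heis n → ℝ) p :=
    (contDiff_zSq (m := 1)).differentiable one_ne_zero p
  have hs : DifferentiableAt ℝ (fun p : Heis n => p.2) p := differentiableAt_snd
  have hA : DifferentiableAt ℝ (fun p : Heis n => s ^ 2 + zSq p) p := hz.const_add _
  have hc : DifferentiableAt ℝ (hcoord i) p :=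
    (contDiff_hcoord i (m := 1)).differentiable one_ne_zero p
  have hJ : DifferentiableAt ℝ (hcoordJ i) p :=
    (contDiff_hcoordJ i (m := 1)).differentiable one_ne_zero p
  rw [show fieldDeriv i (quart s) = _ from funext fun p => fieldDeriv_quart i s p,
    fieldDeriv_const_mul i 4 ((hA.fun_mul hc).fun_add (hs.fun_mul hJ)),
    fieldDeriv_add i (hA.fun_mul hc) (hs.fun_mul hJ), fieldDeriv_mul i hA hc, fieldDeriv_mul i hs hJ,
    fieldDeriv_add i (differentiableAt_const _) hz, fieldDeriv_const, fieldDeriv_zSq,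
    fieldDeriv_snd, fieldDeriv_hcoord, fieldDeriv_hcoordJ, if_pos rfl]
  ring

lemma sum_fieldDeriv_fieldDeriv_quart (s : ℝ) (p : Heis n) :
    ∑ i, fieldDeriv i (fieldDeriv i (quart s)) p = 8 * n * (s ^ 2 + zSq p) + 16 * zSq p := by
  simp only [fieldDeriv_fieldDeriv_quart]
  rw [Finset.sum_add_distrib, ← Finset.mul_sum _ _ (8 : ℝ), Finset.sum_add_distrib (f := fun i => hcoord i p ^ 2),
    ← zSq_eq_sum_hcoord, ← zSq_eq_sum_hcoordJ]
  simp; ring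

lemma sum_fieldDeriv_quart_sq (s : ℝ) (p : Heis n) :
    ∑ i, fieldDeriv i (quart s) p ^ 2 = 16 * quart s p * zSq p := by
  simp only [fieldDeriv_quart]
  have : ∀ i, (4 * ((s ^ 2 + zSq p) * hcoord i p + p.2 * hcoordJ i p)) ^ 2
      = 16 * (s ^ 2 + zSq p) ^ 2 * hcoord i p ^ 2 + 16 * p.2 ^ 2 * hcoordJ i p ^ 2
        + 32 * (s ^ 2 + zSq p) * p.2 * (hcoord i p * hcoordJ i p) := fun i => by ring
  simp only [this]
  rw [Finset.sum_add_distrib, Finset.sum_add_distrib, ← Finset.mul_sum, ← Finset.mul_sum,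
    ← Finset.mul_sum, ← zSq_eq_sum_hcoord, ← zSq_eq_sum_hcoordJ, sum_hcoord_mul_hcoordJ, quart]
  ring

lemma abs_fieldDeriv_quart_le (i : Fin n ⊕ Fin n) (s : ℝ) (p : Heis n) :
    |fieldDeriv i (quart s) p| ≤ 4 * Real.sqrt (quart s p) * homNorm p := by
  have h1 : fieldDeriv i (quart s) p ^ 2 ≤ 16 * quart s p * zSq p := by
    rw [← sum_fieldDeriv_quart_sq]
    exact Finset.single_le_sum (f := fun i => fieldDeriv i (quart s) p ^ 2)
      (fun _ _ => by positivity) (Finset.mem_univ i)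
  have h0 : 0 ≤ quart s p := by unfold quart; positivity
  refine abs_le_of_sq_le_sq ?_ (by have := homNorm_nonneg p; positivity)
  rw [mul_pow, mul_pow, Real.sq_sqrt h0]
  have := zSq_le_homNorm_sq p
  nlinarith

/-- `G_s = D_s^{-n/2}`, a multiple of the bubble of size `s`. -/
def greenReg (s : ℝ) (p : Heis n) : ℝ := quart s p ^ (-(n : ℝ) / 2)

/-- `-Δ G_s = 4n² s² D_s^{-n/2-1}`. -/
def massReg (s : ℝ) (p : Heis n) : ℝ := 4 * (n : ℝ) ^ 2 * s ^ 2 * quart s p ^ (-(n : ℝ) / 2 - 1)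

lemma contDiff_greenReg {s : ℝ} (hs : 0 < s) {m : WithTop ℕ∞} :
    ContDiff ℝ m (greenReg s : Heis n → ℝ) :=
  (contDiff_quart s).rpow_const_of_ne fun p => (quart_pos hs p).ne'

lemma fieldDeriv_rpow_quart (i : Fin n ⊕ Fin n) {s : ℝ} (hs : 0 < s) (a : ℝ) (p : Heis n) :
    fieldDeriv i (fun p => quart s p ^ a) p
      = a * quart s p ^ (a - 1) * fieldDeriv i (quart s) p :=
  fieldDeriv_comp i (h := fun x => x ^ a)
    (Real.hasDerivAt_rpow_const (Or.inl (quart_pos hs p).ne')) (differentiable_quart s p)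

lemma fieldDeriv_greenReg (i : Fin n ⊕ Fin n) {s : ℝ} (hs : 0 < s) (p : Heis n) :
    fieldDeriv i (greenReg s) p
      = -(n : ℝ) / 2 * quart s p ^ (-(n : ℝ) / 2 - 1) * fieldDeriv i (quart s) p :=
  fieldDeriv_rpow_quart i hs _ p

/-- The regularized fundamental solution is a solution of `-Δ G_s = 4n² s² D_s^{-n/2-1}`. -/
lemma sum_fieldDeriv_fieldDeriv_greenReg {s : ℝ} (hs : 0 < s) (p : Heis n) :
    ∑ i, fieldDeriv i (fieldDeriv i (greenReg s)) p = -massReg s p := by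
  have hD := quart_pos hs p
  set a : ℝ := -(n : ℝ) / 2 with ha
  have e : ∀ i, fieldDeriv i (fieldDeriv i (greenReg s)) p
      = a * (a - 1) * quart s p ^ (a - 2) * fieldDeriv i (quart s) p ^ 2
        + a * quart s p ^ (a - 1) * fieldDeriv i (fieldDeriv i (quart s)) p := fun i => by
    have hd : DifferentiableAt ℝ (fun p : Heis n => quart s p ^ (a - 1)) p :=
      (((contDiff_quart s (m := 1)).rpow_const_of_ne
        fun p => (quart_pos hs p).ne').differentiable one_ne_zero) p
    have hq : DifferentiableAt ℝ (fieldDeriv i (quart s)) p :=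
      (contDiff_fieldDeriv i (contDiff_quart s)).differentiable (by simp) p
    rw [show fieldDeriv i (greenReg s) = fun p => a * quart s p ^ (a - 1) *
        fieldDeriv i (quart s) p from funext fun p => fieldDeriv_greenReg i hs p,
      fieldDeriv_mul i (hd.const_mul a) hq, fieldDeriv_const_mul i a hd,
      fieldDeriv_rpow_quart i hs, sub_sub, one_add_one_eq_two]
    ring
  simp only [e]
  rw [Finset.sum_add_distrib, ← Finset.mul_sum, ← Finset.mul_sum, sum_fieldDeriv_quart_sq,
    sum_fieldDeriv_fieldDeriv_quart, massReg, ← ha]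
  have h2 : quart s p ^ (a - 1) = quart s p ^ (a - 2) * quart s p := by
    rw [← Real.rpow_add_one hD.ne']; congr 1; ring
  -- Up to a common factor, the coefficient of `|z|²` is `16 a + 8 n`. The exponent `a = -n/2` is
  -- the one that makes it vanish, and only the term in `s²` survives.
  rw [h2, ha]; ring

/-- This bound is effective for `|p|` large compared with `s`, and `quart_rpow_le'` in the opposite
range; together they give the decay of a bubble on both sides of its scale. -/
lemma quart_rpow_le (s : ℝ) {p : Heis n} (hp : p ≠ 0) {a : ℝ} (ha : 0 ≤ a) :
    quart s p ^ (-a) ≤ homNorm p ^ (-(4 * a)) := by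
  have h := homNorm_pos hp
  calc quart s p ^ (-a) ≤ (homNorm p ^ 4) ^ (-a) :=
        Real.rpow_le_rpow_of_nonpos (by positivity) (homNorm_pow_le_quart s p) (by linarith)
    _ = homNorm p ^ (-(4 * a)) := by
        rw [← Real.rpow_natCast, ← Real.rpow_mul h.le]; congr 1; push_cast; ring

lemma quart_rpow_le' {s : ℝ} (hs : 0 < s) (p : Heis n) {a : ℝ} (ha : 0 ≤ a) :
    quart s p ^ (-a) ≤ s ^ (-(4 * a)) := by
  calc quart s p ^ (-a) ≤ (s ^ 4) ^ (-a) :=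
        Real.rpow_le_rpow_of_nonpos (by positivity) (pow_le_quart s p) (by linarith)
    _ = s ^ (-(4 * a)) := by
        rw [← Real.rpow_natCast, ← Real.rpow_mul hs.le]; congr 1; push_cast; ring

/-- The power of `D_s` is kept, rather than replaced by a power of `|p|`, so that the same bound
serves for the kernel `|p|^{1-Q}` and for the decay of the gradients of the bubbles. -/
lemma abs_fieldDeriv_greenReg_le (i : Fin n ⊕ Fin n) {s : ℝ} (hs : 0 < s) (p : Heis n) :
    |fieldDeriv i (greenReg s) p| ≤ 2 * n * quart s p ^ (-((n : ℝ) + 1) / 2) * homNorm p := by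
  have hD := quart_pos hs p
  rw [fieldDeriv_greenReg i hs, abs_mul, abs_mul, abs_of_nonneg (Real.rpow_nonneg hD.le _),
    show |(-(n : ℝ) / 2)| = n / 2 by rw [abs_div, abs_neg]; simp]
  have h1 : quart s p ^ (-((n : ℝ) + 1) / 2)
      = quart s p ^ (-(n : ℝ) / 2 - 1) * Real.sqrt (quart s p) := by
    rw [Real.sqrt_eq_rpow, ← Real.rpow_add hD]; congr 1; ring
  calc (n : ℝ) / 2 * quart s p ^ (-(n : ℝ) / 2 - 1) * |fieldDeriv i (quart s) p|
      ≤ (n : ℝ) / 2 * quart s p ^ (-(n : ℝ) / 2 - 1) * (4 * Real.sqrt (quart s p) * homNorm p) := by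
        gcongr; exact abs_fieldDeriv_quart_le i s p
    _ = _ := by rw [h1]; ring

/-- The gradients of the regularized fundamental solutions are bounded by `2n |p|^{1-Q}`. -/
lemma abs_fieldDeriv_greenReg_le_homNorm (i : Fin n ⊕ Fin n) {s : ℝ} (hs : 0 < s) {p : Heis n}
    (hp : p ≠ 0) : |fieldDeriv i (greenReg s) p| ≤ 2 * n * (homNorm p ^ (2 * n + 1))⁻¹ := by
  have h := homNorm_pos hp
  refine (abs_fieldDeriv_greenReg_le i hs p).trans ?_
  have h1 := quart_rpow_le s hp (a := ((n : ℝ) + 1) / 2) (by positivity)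
  have h2 : homNorm p ^ (-(4 * (((n : ℝ) + 1) / 2))) * homNorm p = (homNorm p ^ (2 * n + 1))⁻¹ := by
    rw [← Real.rpow_add_one h.ne', ← Real.rpow_natCast, ← Real.rpow_neg h.le]
    congr 1; push_cast; ring
  rw [← h2, ← mul_assoc]
  rw [show -((n : ℝ) + 1) / 2 = -(((n : ℝ) + 1) / 2) by ring]
  gcongr

end Calculus

/-! ### Lebesgue measure, dilations and translations -/

section Measure

variable {n : ℕ}

instance isAddHaarMeasure_volume : (volume : Measure (Heis n)).IsAddHaarMeasure :=
  have : (volume : Measure (Fin n → ℂ)).IsAddHaarMeasure :=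
    inferInstanceAs (Measure.pi fun _ : Fin n => (volume : Measure ℂ)).IsAddHaarMeasure
  inferInstanceAs ((volume : Measure (Fin n → ℂ)).prod (volume : Measure ℝ)).IsAddHaarMeasure

lemma measurable_homNorm : Measurable (homNorm : Heis n → ℝ) := continuous_homNorm.measurable

lemma ae_ne_zero : ∀ᵐ p : Heis n, p ≠ 0 := by
  change ({0}ᶜ : Set (Heis n)) ∈ ae volume
  exact compl_mem_ae_iff.2 (by
    rw [show ({0} : Set (Heis n)) = {0} ×ˢ {0} by simp [Prod.zero_eq_mk],
      Measure.volume_eq_prod, Measure.prod_prod, measure_singleton (0 : ℝ), mul_zero])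

/-- The dilations as homeomorphisms. -/
def dilHomeo (n : ℕ) {r : ℝ} (hr : r ≠ 0) : Heis n ≃ₜ Heis n where
  toFun := dil r
  invFun := dil r⁻¹
  left_inv p := by rw [dil_dil, inv_mul_cancel₀ hr, dil_one]
  right_inv p := by rw [dil_dil, mul_inv_cancel₀ hr, dil_one]
  continuous_toFun := continuous_dil r
  continuous_invFun := continuous_dil _

lemma measurableEmbedding_dil {r : ℝ} (hr : r ≠ 0) :
    MeasurableEmbedding (dil r : Heis n → Heis n) :=
  (dilHomeo n hr).measurableEmbedding

/-- The Jacobian is `r^{2n}` from the `2n` real horizontal coordinates times `r²` from the vertical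
one, that is `r^Q`. -/
lemma map_dil {r : ℝ} (hr : 0 < r) :
    Measure.map (dil r) (volume : Measure (Heis n))
      = ENNReal.ofReal ((r ^ (2 * n + 2))⁻¹) • volume := by
  have h1 : (volume : Measure (Fin n → ℂ)).IsAddHaarMeasure :=
    inferInstanceAs (Measure.pi fun _ : Fin n => (volume : Measure ℂ)).IsAddHaarMeasure
  have e : (dil r : Heis n → Heis n) = Prod.map (r • ·) (r ^ 2 • ·) := rfl
  rw [e, Measure.volume_eq_prod, ← Measure.map_prod_map _ _ (measurable_const_smul r)
    (measurable_const_smul (r ^ 2)), Measure.map_addHaar_smul _ hr.ne',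
    Measure.map_addHaar_smul _ (pow_pos hr 2).ne', Measure.prod_smul_left,
    Measure.prod_smul_right, smul_smul, ← ENNReal.ofReal_mul (abs_nonneg _), ← abs_mul]
  congr 2
  have : Module.finrank ℝ (Fin n → ℂ) = 2 * n := by
    rw [Module.finrank_pi_fintype]; simp [Complex.finrank_real_complex, mul_comm]
  rw [this, Module.finrank_self, abs_of_pos (by positivity)]
  rw [← mul_inv, ← pow_mul, ← pow_add]

lemma setLIntegral_comp_dil {r : ℝ} (hr : 0 < r) (S : Set (Heis n)) (F : Heis n → ℝ≥0∞) :
    ∫⁻ p in dil r ⁻¹' S, F (dil r p) = ENNReal.ofReal ((r ^ (2 * n + 2))⁻¹) * ∫⁻ p in S, F p := by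
  have hm := measurableEmbedding_dil (n := n) hr.ne'
  rw [← hm.lintegral_map, ← hm.restrict_map, map_dil hr, Measure.restrict_smul,
    lintegral_smul_measure, smul_eq_mul]

lemma setLIntegral_eq_dil {r : ℝ} (hr : 0 < r) (S : Set (Heis n)) (F : Heis n → ℝ≥0∞) :
    ∫⁻ p in S, F p = ENNReal.ofReal (r ^ (2 * n + 2)) * ∫⁻ p in dil r ⁻¹' S, F (dil r p) := by
  rw [setLIntegral_comp_dil hr, ← mul_assoc, ← ENNReal.ofReal_mul (by positivity),
    mul_inv_cancel₀ (by positivity), ENNReal.ofReal_one, one_mul]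

lemma setIntegral_eq_dil {r : ℝ} (hr : 0 < r) (S : Set (Heis n)) (F : Heis n → ℝ) :
    ∫ p in S, F p = r ^ (2 * n + 2) * ∫ p in dil r ⁻¹' S, F (dil r p) := by
  have hm := measurableEmbedding_dil (n := n) hr.ne'
  rw [← hm.integral_map, ← hm.restrict_map, map_dil hr, Measure.restrict_smul,
    integral_smul_measure, ENNReal.toReal_ofReal (by positivity), smul_eq_mul, ← mul_assoc,
    mul_inv_cancel₀ (by positivity), one_mul]

lemma integral_eq_dil {r : ℝ} (hr : 0 < r) (F : Heis n → ℝ) :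
    ∫ p, F p = r ^ (2 * n + 2) * ∫ p, F (dil r p) := by
  simpa using setIntegral_eq_dil hr Set.univ F

/-- Over a fixed `z` the map is a translation of `t`, and on the base it is a translation of `z`;
Lebesgue measure is therefore a Haar measure on both sides. -/
lemma measurePreserving_hmul_left (x : Heis n) :
    MeasurePreserving (hmul x : Heis n → Heis n) volume volume := by
  have h1 : (volume : Measure (Fin n → ℂ)).IsAddHaarMeasure :=
    inferInstanceAs (Measure.pi fun _ : Fin n => (volume : Measure ℂ)).IsAddHaarMeasure
  have hf : MeasurePreserving (fun z : Fin n → ℂ => x.1 + z) volume volume :=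
    measurePreserving_add_left _ _
  refine MeasurePreserving.skew_product (f := fun z : Fin n → ℂ => x.1 + z)
    (g := fun z t => x.2 + t + 2 * ∑ i, ((x.1 i).im * (z i).re - (x.1 i).re * (z i).im)) hf ?_ ?_
  · exact (continuous_snd.comp
      (continuous_hmul.comp (Continuous.prodMk_right x))).measurable
  · refine ae_of_all _ fun z => ?_
    set c := 2 * ∑ i, ((x.1 i).im * (z i).re - (x.1 i).re * (z i).im)
    have : (fun t => x.2 + t + c) = fun t => (x.2 + c) + t := by ext t; ring
    rw [this]
    exact (measurePreserving_add_left volume (x.2 + c)).map_eq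

lemma measurePreserving_hmul_right (w : Heis n) :
    MeasurePreserving (fun x : Heis n => hmul x w) volume volume := by
  have h1 : (volume : Measure (Fin n → ℂ)).IsAddHaarMeasure :=
    inferInstanceAs (Measure.pi fun _ : Fin n => (volume : Measure ℂ)).IsAddHaarMeasure
  have hf : MeasurePreserving (fun z : Fin n → ℂ => z + w.1) volume volume :=
    measurePreserving_add_right _ _
  refine MeasurePreserving.skew_product (f := fun z : Fin n → ℂ => z + w.1)
    (g := fun z t => t + w.2 + 2 * ∑ i, ((z i).im * (w.1 i).re - (z i).re * (w.1 i).im)) hf ?_ ?_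
  · exact (continuous_snd.comp
      (continuous_hmul.comp (Continuous.prodMk_left w))).measurable
  · refine ae_of_all _ fun z => ?_
    set c := 2 * ∑ i, ((z i).im * (w.1 i).re - (z i).re * (w.1 i).im)
    have : (fun t => t + w.2 + c) = fun t => (w.2 + c) + t := by ext t; ring
    rw [this]
    exact (measurePreserving_add_left volume (w.2 + c)).map_eq

/-! ### Integration by parts -/

lemma fieldDeriv_eq_add (i : Fin n ⊕ Fin n) (F : Heis n → ℝ) (p : Heis n) :
    fieldDeriv i F p = fderiv ℝ F p (hvec n i, 0) + (2 * hcoordJ i p) * fderiv ℝ F p (0, 1) := by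
  rw [fieldDeriv, field_eq, ← smul_eq_mul (2 * hcoordJ i p), ← map_smul, ← map_add]
  simp

/-- A horizontal field is a constant field plus a multiple of `∂_t` whose coefficient does not
depend on `t`; hence it is divergence free and each of the two parts integrates to zero. -/
lemma integral_fieldDeriv_eq_zero (i : Fin n ⊕ Fin n) {F : Heis n → ℝ} (hF : ContDiff ℝ ∞ F)
    (hc : HasCompactSupport F) : ∫ p, fieldDeriv i F p = 0 := by
  have hd : Differentiable ℝ F := hF.differentiable (by simp)
  have hcont : ∀ v, Continuous fun p => fderiv ℝ F p v := fun v =>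
    (hF.continuous_fderiv (by simp)).clm_apply continuous_const
  have hcs : ∀ v, HasCompactSupport fun p => fderiv ℝ F p v := fun v =>
    (hc.fderiv (𝕜 := ℝ)).comp_left (g := fun L : Heis n →L[ℝ] ℝ => L v) (by simp)
  have hJc : Continuous (hcoordJ i : Heis n → ℝ) := (contDiff_hcoordJ i (m := 0)).continuous
  have hJd : Differentiable ℝ (fun p : Heis n => 2 * hcoordJ i p) :=
    ((contDiff_hcoordJ i (m := 1)).differentiable one_ne_zero).const_mul 2
  have i1 : Integrable fun p => fderiv ℝ F p (hvec n i, 0) :=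
    (hcont _).integrable_of_hasCompactSupport (hcs _)
  have i2 : Integrable fun p => (2 * hcoordJ i p) * fderiv ℝ F p (0, 1) :=
    ((continuous_const.mul hJc).mul (hcont _)).integrable_of_hasCompactSupport (hcs _).mul_left
  have hz : ∀ p, fderiv ℝ (fun p : Heis n => 2 * hcoordJ i p) p ((0, 1) : Heis n) = 0 := fun p => by
    rw [← coe_hcoordJL, fderiv_const_mul (hcoordJL i).differentiableAt,
      ContinuousLinearMap.fderiv, smul_apply, coe_hcoordJL]
    rcases i with i | i <;> simp [hcoordJ]
  have e1 : ∫ p, fderiv ℝ F p (hvec n i, 0) = 0 := by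
    have := integral_mul_fderiv_eq_neg_fderiv_mul_of_integrable (μ := (volume : Measure (Heis n)))
      (f := fun _ => (1 : ℝ)) (g := F) (v := (hvec n i, 0)) (by simp) (by simpa using i1)
      (by simpa using hF.continuous.integrable_of_hasCompactSupport hc)
      (fun p _ => differentiableAt_const _) (fun p _ => hd p)
    simpa using this
  have e2 : ∫ p, (2 * hcoordJ i p) * fderiv ℝ F p (0, 1) = 0 := by
    have := integral_mul_fderiv_eq_neg_fderiv_mul_of_integrable (μ := (volume : Measure (Heis n)))
      (f := fun p => 2 * hcoordJ i p) (g := F) (v := ((0, 1) : Heis n)) (by simp [hz]) i2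
      (((continuous_const.mul hJc).mul hF.continuous).integrable_of_hasCompactSupport hc.mul_left)
      (fun p _ => hJd p) (fun p _ => hd p)
    simpa [hz] using this
  simp only [fieldDeriv_eq_add]
  rw [integral_add i1 i2, e1, e2, add_zero]

lemma tsupport_fieldDeriv_subset (i : Fin n ⊕ Fin n) (φ : Heis n → ℝ) :
    tsupport (fieldDeriv i φ) ⊆ tsupport φ := by
  refine closure_minimal ?_ (isClosed_tsupport φ)
  intro p hp
  apply support_fderiv_subset ℝ
  rw [Function.mem_support] at hp ⊢
  intro h
  exact hp (by simp [fieldDeriv, h])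

lemma hasCompactSupport_fieldDeriv (i : Fin n ⊕ Fin n) {φ : Heis n → ℝ}
    (h : HasCompactSupport φ) : HasCompactSupport (fieldDeriv i φ) :=
  h.isCompact.of_isClosed_subset (isClosed_tsupport _) (tsupport_fieldDeriv_subset i φ)

lemma integral_mul_fieldDeriv (i : Fin n ⊕ Fin n) {F φ : Heis n → ℝ} (hF : ContDiff ℝ ∞ F)
    (hφ : ContDiff ℝ ∞ φ) (hc : HasCompactSupport φ) :
    ∫ p, F p * fieldDeriv i φ p = -∫ p, fieldDeriv i F p * φ p := by
  have h := integral_fieldDeriv_eq_zero i (hF.mul hφ) (hc.mul_left (f := F))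
  have e : ∀ p, fieldDeriv i (fun x => F x * φ x) p = fieldDeriv i F p * φ p + F p * fieldDeriv i φ p :=
    fun p => fieldDeriv_mul i (hF.differentiable (by simp) p) (hφ.differentiable (by simp) p)
  rw [integral_congr_ae (ae_of_all _ e), integral_add] at h
  · linarith
  · exact ((contDiff_fieldDeriv i hF).continuous.mul
      hφ.continuous).integrable_of_hasCompactSupport hc.mul_left
  · exact (hF.continuous.mul (contDiff_fieldDeriv i hφ).continuous).integrable_of_hasCompactSupport
      (hasCompactSupport_fieldDeriv i hc).mul_left

/-! ### Shells -/

/-- The half-open shells `{T^k ≤ |p| < T^{k+1}}`. -/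
def shell (n : ℕ) (T : ℝ) (k : ℤ) : Set (Heis n) := {p | T ^ k ≤ homNorm p ∧ homNorm p < T ^ (k + 1)}

lemma measurableSet_shell (T : ℝ) (k : ℤ) : MeasurableSet (shell n T k) :=
  (measurableSet_le measurable_const measurable_homNorm).inter
    (measurableSet_lt measurable_homNorm measurable_const)

lemma pairwise_disjoint_shell {T : ℝ} (hT : 1 < T) :
    Pairwise (Function.onFun Disjoint (shell n T)) := by
  intro j k hjk
  rw [Function.onFun, Set.disjoint_left]
  rintro p ⟨h1, h2⟩ ⟨h3, h4⟩
  have a := (zpow_lt_zpow_iff_right₀ hT).1 (h1.trans_lt h4)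
  have b := (zpow_lt_zpow_iff_right₀ hT).1 (h3.trans_lt h2)
  omega

lemma iUnion_shell {T : ℝ} (hT : 1 < T) : ⋃ k, shell n T k = {0}ᶜ := by
  ext p
  simp only [Set.mem_iUnion, Set.mem_compl_iff, Set.mem_singleton_iff]
  constructor
  · rintro ⟨k, hk, -⟩ rfl
    rw [homNorm_zero] at hk
    exact absurd hk (not_le.2 (zpow_pos (by linarith) k))
  · intro hp
    obtain ⟨k, h1, h2⟩ := exists_mem_Ico_zpow (homNorm_pos hp) hT
    exact ⟨k, h1, h2⟩

lemma preimage_dil_shell {T : ℝ} (hT : 1 < T) (k : ℤ) :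
    dil T ⁻¹' shell n T (k + 1) = shell n T k := by
  have h0 : 0 < T := by linarith
  ext p
  simp only [shell, Set.mem_preimage, Set.mem_ofPred_eq, homNorm_dil h0.le, zpow_add_one₀ h0.ne']
  rw [mul_comm T, mul_le_mul_iff_left₀ h0, mul_lt_mul_iff_left₀ h0]

/-- A vertical line meets a sphere of the homogeneous norm in at most two points, so Fubini's
theorem applies. -/
lemma volume_homNorm_eq (c : ℝ) : volume {p : Heis n | homNorm p = c} = 0 := by
  have hm : MeasurableSet {p : Heis n | homNorm p = c} :=
    measurableSet_eq_fun measurable_homNorm measurable_const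
  rw [Measure.volume_eq_prod, Measure.measure_prod_null hm]
  refine ae_of_all _ fun z => ?_
  refine Set.Finite.measure_zero (Set.Finite.subset
    (Set.toFinite {Real.sqrt (c ^ 4 - zSq ((z, 0) : Heis n) ^ 2),
      -Real.sqrt (c ^ 4 - zSq ((z, 0) : Heis n) ^ 2)}) ?_) _
  intro t ht
  have h : homNorm ((z, t) : Heis n) = c := ht
  have h4 := homNorm_pow ((z, t) : Heis n)
  rw [h] at h4
  have h5 : c ^ 4 - zSq ((z, 0) : Heis n) ^ 2 = t ^ 2 := by
    have : zSq ((z, 0) : Heis n) = zSq ((z, t) : Heis n) := rfl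
    rw [this]; simp only at h4; linarith
  rw [h5, Real.sqrt_sq_eq_abs]
  rcases abs_choice t with h | h <;> simp [h]

lemma annulus_ae_eq_shell (n : ℕ) (T : ℝ) :
    annulus n T =ᵐ[volume] shell n T 0 := by
  have h : ∀ᵐ p : Heis n, homNorm p ≠ T := by
    rw [ae_iff]; simpa using volume_homNorm_eq T
  filter_upwards [h] with p hp
  refine propext ?_
  change (1 ≤ homNorm p ∧ homNorm p ≤ T) ↔ (T ^ (0 : ℤ) ≤ homNorm p ∧ homNorm p < T ^ ((0 : ℤ) + 1))
  simp only [zpow_zero, zero_add, zpow_one]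
  exact ⟨fun h => ⟨h.1, lt_of_le_of_ne h.2 hp⟩, fun h => ⟨h.1, h.2.le⟩⟩

lemma lintegral_eq_tsum_shell {T : ℝ} (hT : 1 < T) (F : Heis n → ℝ≥0∞) :
    ∫⁻ p, F p = ∑' k, ∫⁻ p in shell n T k, F p := by
  rw [← lintegral_iUnion (measurableSet_shell T) (pairwise_disjoint_shell hT), iUnion_shell hT]
  exact (setLIntegral_univ F).symm.trans
    (setLIntegral_congr (Filter.eventuallyEq_set.2 (by filter_upwards [ae_ne_zero] with p hp; simp [hp])))

lemma setLIntegral_shell_succ {T : ℝ} (hT : 1 < T) (k : ℤ) (F : Heis n → ℝ≥0∞) :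
    ∫⁻ p in shell n T (k + 1), F p
      = ENNReal.ofReal (T ^ (2 * n + 2)) * ∫⁻ p in shell n T k, F (dil T p) := by
  rw [setLIntegral_eq_dil (by linarith : 0 < T), preimage_dil_shell hT]

/-- Integrals over shells of a function with `F ∘ δ_T = c F`. -/
lemma setLIntegral_shell_le {T : ℝ} (hT : 1 < T) {c : ℝ≥0∞} (hc0 : c ≠ 0) (hc : c ≠ ⊤) (k : ℤ) :
    ∃ C : ℝ≥0∞, C ≠ ⊤ ∧ ∀ F : Heis n → ℝ≥0∞, (∀ᵐ p, F (dil T p) = c * F p) →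
      ∫⁻ p in shell n T k, F p ≤ C * ∫⁻ p in shell n T 0, F p := by
  have h0 : 0 < T := by linarith
  set a : ℝ≥0∞ := ENNReal.ofReal (T ^ (2 * n + 2)) * c with ha
  have ha0 : a ≠ 0 := mul_ne_zero (by simpa using pow_pos h0 _) hc0
  have hat : a ≠ ⊤ := ENNReal.mul_ne_top ENNReal.ofReal_ne_top hc
  have step : ∀ F : Heis n → ℝ≥0∞, (∀ᵐ p, F (dil T p) = c * F p) → ∀ k : ℤ,
      ∫⁻ p in shell n T (k + 1), F p = a * ∫⁻ p in shell n T k, F p := by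
    intro F hF k
    rw [setLIntegral_shell_succ hT, lintegral_congr_ae (ae_restrict_of_ae hF),
      lintegral_const_mul' _ _ hc, ha, mul_assoc]
  induction k using Int.induction_on with
  | zero => exact ⟨1, by simp, fun F _ => by simp⟩
  | succ k ih =>
    obtain ⟨C, hC, h⟩ := ih
    refine ⟨a * C, ENNReal.mul_ne_top hat hC, fun F hF => ?_⟩
    rw [step F hF, mul_assoc a C]
    exact mul_le_mul' le_rfl (h F hF)
  | pred k ih =>
    obtain ⟨C, hC, h⟩ := ih
    refine ⟨a⁻¹ * C, ENNReal.mul_ne_top (ENNReal.inv_ne_top.2 ha0) hC, fun F hF => ?_⟩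
    have e := step F hF (-(k : ℤ) - 1)
    rw [sub_add_cancel] at e
    have e' : ∫⁻ p in shell n T (-(k : ℤ) - 1), F p = a⁻¹ * ∫⁻ p in shell n T (-(k : ℤ)), F p := by
      rw [e, ← mul_assoc, ENNReal.inv_mul_cancel ha0 hat, one_mul]
    rw [e', mul_assoc a⁻¹ C]
    exact mul_le_mul' le_rfl (h F hF)

/-- Integrals over shells of a function with `F ∘ δ_T = T^{-Q} F`. -/
lemma setLIntegral_shell_eq {T : ℝ} (hT : 1 < T) {F : Heis n → ℝ≥0∞}
    (hF : ∀ᵐ p, F (dil T p) = ENNReal.ofReal ((T ^ (2 * n + 2))⁻¹) * F p) (k : ℤ) :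
    ∫⁻ p in shell n T k, F p = ∫⁻ p in annulus n T, F p := by
  have h0 : 0 < T := by linarith
  rw [setLIntegral_congr (annulus_ae_eq_shell n T)]
  have step : ∀ k : ℤ, ∫⁻ p in shell n T (k + 1), F p = ∫⁻ p in shell n T k, F p := by
    intro k
    rw [setLIntegral_shell_succ hT, lintegral_congr_ae (ae_restrict_of_ae hF),
      lintegral_const_mul' _ _ ENNReal.ofReal_ne_top, ← mul_assoc,
      ← ENNReal.ofReal_mul (by positivity), mul_inv_cancel₀ (by positivity), ENNReal.ofReal_one,
      one_mul]
  induction k using Int.induction_on with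
  | zero => rfl
  | succ k ih => rw [step, ih]
  | pred k ih =>
    have := step (-(k : ℤ) - 1)
    rw [sub_add_cancel] at this
    rw [← this, ih]

lemma exists_shell_cover {T : ℝ} (hT : 1 < T) {K : Set (Heis n)} (hK : IsCompact K)
    (h0 : K ⊆ {0}ᶜ) : ∃ s : Finset ℤ, K ⊆ ⋃ k ∈ s, shell n T k := by
  rcases K.eq_empty_or_nonempty with rfl | hne
  · exact ⟨∅, by simp⟩
  obtain ⟨a, haK, ha⟩ := hK.exists_isMinOn hne continuous_homNorm.continuousOn
  obtain ⟨b, hbK, hb⟩ := hK.exists_isMaxOn hne continuous_homNorm.continuousOn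
  obtain ⟨j, hj, -⟩ := exists_mem_Ico_zpow (homNorm_pos (h0 haK)) hT
  obtain ⟨m, -, hm⟩ := exists_mem_Ico_zpow (homNorm_pos (h0 hbK)) hT
  refine ⟨Finset.Icc j m, fun p hp => ?_⟩
  obtain ⟨k, hk1, hk2⟩ := exists_mem_Ico_zpow (homNorm_pos (h0 hp)) hT
  have h1 : T ^ j < T ^ (k + 1) := (hj.trans (ha hp)).trans_lt hk2
  have h2 : T ^ k < T ^ (m + 1) := (hk1.trans (hb hp)).trans_lt hm
  have h1' := (zpow_lt_zpow_iff_right₀ hT).1 h1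
  have h2' := (zpow_lt_zpow_iff_right₀ hT).1 h2
  simp only [Set.mem_iUnion]
  exact ⟨k, Finset.mem_Icc.2 ⟨by omega, by omega⟩, hk1, hk2⟩

/-- Integrals over compact sets of a function with `F ∘ δ_T = c F` are controlled by the integral
over one annulus. -/
lemma setLIntegral_compact_le {T : ℝ} (hT : 1 < T) {c : ℝ≥0∞} (hc0 : c ≠ 0) (hc : c ≠ ⊤)
    {K : Set (Heis n)} (hK : IsCompact K) (h0 : K ⊆ {0}ᶜ) :
    ∃ C : ℝ≥0∞, C ≠ ⊤ ∧ ∀ F : Heis n → ℝ≥0∞, (∀ᵐ p, F (dil T p) = c * F p) →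
      ∫⁻ p in K, F p ≤ C * ∫⁻ p in annulus n T, F p := by
  obtain ⟨s, hs⟩ := exists_shell_cover hT hK h0
  choose C hC hF using fun k => setLIntegral_shell_le (n := n) hT hc0 hc k
  refine ⟨∑ k ∈ s, C k, by simpa using fun k _ => hC k, fun F h => ?_⟩
  rw [setLIntegral_congr (annulus_ae_eq_shell n T)]
  calc ∫⁻ p in K, F p ≤ ∫⁻ p in ⋃ k ∈ s, shell n T k, F p := lintegral_mono_set hs
    _ ≤ ∑ k ∈ s, ∫⁻ p in shell n T k, F p := by
        rw [lintegral_biUnion_finset (fun i _ j _ hij => pairwise_disjoint_shell hT hij)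
          (fun k _ => measurableSet_shell T k)]
    _ ≤ ∑ k ∈ s, C k * ∫⁻ p in shell n T 0, F p := Finset.sum_le_sum fun k _ => hF k F h
    _ = _ := by rw [Finset.sum_mul]

/-- Unfolding of an integral over the whole space into an integral over one annulus. -/
lemma integral_unfold {T : ℝ} (hT : 1 < T) {H : ℤ → Heis n → ℝ}
    (hm : ∀ k, AEStronglyMeasurable (H k) volume) (hint : Integrable (H 0))
    (hH : ∀ k, ∀ᵐ p, H k (dil T p) = (T ^ (2 * n + 2))⁻¹ * H (k + 1) p) :
    ∫ p, H 0 p = ∫ p in annulus n T, ∑' k, H k p := by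
  have h0 : 0 < T := by linarith
  have e1 : ∀ j k, ∫ p in shell n T (j + 1), H k p = ∫ p in shell n T j, H (k + 1) p := by
    intro j k
    rw [setIntegral_eq_dil h0, preimage_dil_shell hT, integral_congr_ae (ae_restrict_of_ae (hH k)),
      integral_const_mul, ← mul_assoc, mul_inv_cancel₀ (by positivity), one_mul]
  have e2 : ∀ j k, ∫⁻ p in shell n T (j + 1), ‖H k p‖ₑ = ∫⁻ p in shell n T j, ‖H (k + 1) p‖ₑ := by
    intro j k
    have : ∀ᵐ p, ‖H k (dil T p)‖ₑ = ENNReal.ofReal ((T ^ (2 * n + 2))⁻¹) * ‖H (k + 1) p‖ₑ := by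
      filter_upwards [hH k] with p hp
      rw [hp, enorm_mul, Real.enorm_of_nonneg (by positivity)]
    rw [setLIntegral_shell_succ hT, lintegral_congr_ae (ae_restrict_of_ae this),
      lintegral_const_mul' _ _ ENNReal.ofReal_ne_top, ← mul_assoc,
      ← ENNReal.ofReal_mul (by positivity), mul_inv_cancel₀ (by positivity), ENNReal.ofReal_one,
      one_mul]
  -- The Jacobian `T^Q` cancels the factor `T^{-Q}` of the homogeneity, so moving the shell by `k`
  -- amounts to shifting the index of `H` by `k`. The sum over shells of `H 0` becomes the sum over
  -- indices on one shell.
  have s1 : ∀ k : ℤ, ∀ j l, ∫ p in shell n T (j + k), H l p = ∫ p in shell n T j, H (l + k) p := by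
    intro k
    induction k using Int.induction_on with
    | zero => simp
    | succ k ih => intro j l; rw [← add_assoc, e1, ih, add_assoc, add_comm 1 (k : ℤ)]
    | pred k ih =>
      intro j l
      have := e1 (j + (-(k : ℤ) - 1)) (l - 1)
      rw [sub_add_cancel] at this
      rw [← this, show j + (-(k : ℤ) - 1) + 1 = j + -k by ring, ih]
      rw [show l - 1 + -(k : ℤ) = l + (-(k : ℤ) - 1) by ring]
  have s2 : ∀ k : ℤ, ∀ j l,
      ∫⁻ p in shell n T (j + k), ‖H l p‖ₑ = ∫⁻ p in shell n T j, ‖H (l + k) p‖ₑ := by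
    intro k
    induction k using Int.induction_on with
    | zero => simp
    | succ k ih => intro j l; rw [← add_assoc, e2, ih, add_assoc, add_comm 1 (k : ℤ)]
    | pred k ih =>
      intro j l
      have := e2 (j + (-(k : ℤ) - 1)) (l - 1)
      rw [sub_add_cancel] at this
      rw [← this, show j + (-(k : ℤ) - 1) + 1 = j + -k by ring, ih]
      rw [show l - 1 + -(k : ℤ) = l + (-(k : ℤ) - 1) by ring]
  rw [setIntegral_congr_set (annulus_ae_eq_shell n T), integral_tsum (fun k => (hm k).restrict)]
  · have hu : ∫ p, H 0 p = ∫ p in ⋃ k, shell n T k, H 0 p := by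
      rw [iUnion_shell hT]
      exact setIntegral_univ.symm.trans (setIntegral_congr_set
        (Filter.eventuallyEq_set.2 (by filter_upwards [ae_ne_zero] with p hp; simp [hp])))
    rw [hu, integral_iUnion (measurableSet_shell T) (pairwise_disjoint_shell hT)
      hint.integrableOn]
    refine tsum_congr fun k => ?_
    have := s1 k 0 0
    rwa [zero_add] at this
  · have : ∀ k, ∫⁻ p in shell n T 0, ‖H k p‖ₑ = ∫⁻ p in shell n T k, ‖H 0 p‖ₑ := fun k => by
      have := s2 k 0 0
      rw [zero_add] at this
      exact this.symm
    simp only [this]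
    rw [← lintegral_eq_tsum_shell hT]
    exact hint.2.ne

end Measure

/-! ### Integrals of powers of the homogeneous norm -/

section Powers

variable {n : ℕ}

lemma measurable_ofReal_homNorm_pow_inv (a : ℕ) :
    Measurable fun p : Heis n => ENNReal.ofReal ((homNorm p ^ a)⁻¹) :=
  ((measurable_homNorm.pow_const a).inv).ennreal_ofReal

lemma preimage_dil_zpow_shell {T : ℝ} (hT : 1 < T) (k : ℤ) :
    dil (T ^ k) ⁻¹' shell n T k = shell n T 0 := by
  have h0 : 0 < T := by linarith
  have hk : 0 < T ^ k := zpow_pos h0 k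
  ext p
  simp only [shell, Set.mem_preimage, Set.mem_ofPred_eq, homNorm_dil hk.le, zpow_add_one₀ h0.ne',
    zpow_zero, one_mul]
  rw [mul_lt_mul_iff_right₀ hk, le_mul_iff_one_le_right hk]

/-- Scaling turns the integrals of `|p|^{-a}` over dyadic shells into a geometric sequence of ratio
`2^{Q-a}`: it is summable towards `0` if `a < Q`, towards infinity if `a > Q`, and constant if `a =
Q`. -/
lemma setLIntegral_shell_homNorm_pow (a : ℕ) (k : ℤ) :
    ∫⁻ p in shell n 2 k, ENNReal.ofReal ((homNorm p ^ a)⁻¹)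
      = ENNReal.ofReal (((2 : ℝ) ^ k) ^ (2 * n + 2) * (((2 : ℝ) ^ k) ^ a)⁻¹) *
        ∫⁻ p in shell n 2 0, ENNReal.ofReal ((homNorm p ^ a)⁻¹) := by
  have hk : (0 : ℝ) < 2 ^ k := by positivity
  rw [setLIntegral_eq_dil hk, preimage_dil_zpow_shell one_lt_two,
    ENNReal.ofReal_mul (by positivity), mul_assoc]
  congr 1
  rw [← lintegral_const_mul' (ENNReal.ofReal (((2 : ℝ) ^ k) ^ a)⁻¹) _ ENNReal.ofReal_ne_top]
  refine lintegral_congr fun p => ?_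
  rw [homNorm_dil hk.le, mul_pow, mul_inv, ENNReal.ofReal_mul (by positivity)]

lemma setLIntegral_shell_zero_homNorm_pow_ne_top (a : ℕ) :
    ∫⁻ p in shell n 2 0, ENNReal.ofReal ((homNorm p ^ a)⁻¹) ≠ ⊤ := by
  refine ne_top_of_le_ne_top ?_ (setLIntegral_mono (g := fun _ => 1) measurable_const ?_)
  · rw [setLIntegral_one, ← measure_congr (annulus_ae_eq_shell n 2)]
    exact (isCompact_annulus n 2).measure_lt_top.ne
  · intro p hp
    rw [← ENNReal.ofReal_one]
    refine ENNReal.ofReal_le_ofReal (inv_le_one_of_one_le₀ (one_le_pow₀ ?_))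
    simpa [shell] using hp.1

lemma setLIntegral_homNorm_lt_one_ne_top {a : ℕ} (ha : a < 2 * n + 2) :
    ∫⁻ p in {p : Heis n | homNorm p < 1}, ENNReal.ofReal ((homNorm p ^ a)⁻¹) ≠ ⊤ := by
  set I := ∫⁻ p in shell n 2 0, ENNReal.ofReal ((homNorm p ^ a)⁻¹) with hI
  have hsub : {p : Heis n | homNorm p < 1} ≤ᵐ[volume] ⋃ j : ℕ, shell n 2 (-((j : ℤ) + 1)) := by
    filter_upwards [ae_ne_zero] with p hp h1
    obtain ⟨k, hk1, hk2⟩ := exists_mem_Ico_zpow (homNorm_pos hp) (one_lt_two (α := ℝ))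
    have h1 : homNorm p < 1 := h1
    have : k < 0 := by
      have : (2 : ℝ) ^ k < 2 ^ (0 : ℤ) := by simpa using hk1.trans_lt h1
      exact (zpow_lt_zpow_iff_right₀ one_lt_two).1 this
    refine Set.mem_iUnion.2 ⟨(-k - 1).toNat, ?_⟩
    have e : -((((-k - 1).toNat : ℕ) : ℤ) + 1) = k := by omega
    rw [e]
    exact ⟨hk1, hk2⟩
  refine ne_top_of_le_ne_top ?_ ((lintegral_mono_set' hsub).trans (lintegral_iUnion_le _ _))
  simp only [setLIntegral_shell_homNorm_pow, ← hI]
  rw [ENNReal.tsum_mul_right]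
  refine ENNReal.mul_ne_top ?_ (setLIntegral_shell_zero_homNorm_pow_ne_top a)
  refine ne_top_of_le_ne_top (Summable.tsum_ofReal_ne_top summable_geometric_two)
    (ENNReal.tsum_le_tsum fun j => ENNReal.ofReal_le_ofReal ?_)
  have e : (2 : ℝ) ^ (-((j : ℤ) + 1)) = (1 / 2) ^ (j + 1) := by
    rw [zpow_neg, one_div, inv_pow]; norm_cast
  rw [e, ← pow_sub₀ _ (by positivity) ha.le]
  obtain ⟨b, hb⟩ := Nat.exists_eq_add_of_lt ha
  have e2 : 2 * n + 2 - a = b + 1 := by omega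
  rw [e2]
  have h1 : ((1 / 2 : ℝ) ^ (j + 1)) ≤ (1 / 2) ^ j :=
    pow_le_pow_of_le_one (by norm_num) (by norm_num) (by omega)
  calc ((1 / 2 : ℝ) ^ (j + 1)) ^ (b + 1) ≤ (1 / 2 : ℝ) ^ (j + 1) := by
        refine pow_le_of_le_one (by positivity) (pow_le_one₀ (by norm_num) (by norm_num)) (by omega)
    _ ≤ _ := h1

lemma setLIntegral_one_le_homNorm_ne_top {a : ℕ} (ha : 2 * n + 2 < a) :
    ∫⁻ p in {p : Heis n | 1 ≤ homNorm p}, ENNReal.ofReal ((homNorm p ^ a)⁻¹) ≠ ⊤ := by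
  set I := ∫⁻ p in shell n 2 0, ENNReal.ofReal ((homNorm p ^ a)⁻¹) with hI
  have hsub : {p : Heis n | 1 ≤ homNorm p} ⊆ ⋃ j : ℕ, shell n 2 (j : ℤ) := by
    intro p h1
    have h1 : 1 ≤ homNorm p := h1
    obtain ⟨k, hk1, hk2⟩ := exists_mem_Ico_zpow (zero_lt_one.trans_le h1) (one_lt_two (α := ℝ))
    have : 0 < k + 1 := by
      have : (2 : ℝ) ^ (0 : ℤ) < 2 ^ (k + 1) := by simpa using h1.trans_lt hk2
      exact (zpow_lt_zpow_iff_right₀ one_lt_two).1 this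
    refine Set.mem_iUnion.2 ⟨k.toNat, ?_⟩
    rw [Int.toNat_of_nonneg (by omega)]
    exact ⟨hk1, hk2⟩
  refine ne_top_of_le_ne_top ?_ ((lintegral_mono_set hsub).trans (lintegral_iUnion_le _ _))
  simp only [setLIntegral_shell_homNorm_pow, ← hI]
  rw [ENNReal.tsum_mul_right]
  refine ENNReal.mul_ne_top ?_ (setLIntegral_shell_zero_homNorm_pow_ne_top a)
  refine ne_top_of_le_ne_top (Summable.tsum_ofReal_ne_top summable_geometric_two)
    (ENNReal.tsum_le_tsum fun j => ENNReal.ofReal_le_ofReal ?_)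
  obtain ⟨b, rfl⟩ := Nat.exists_eq_add_of_lt ha
  rw [zpow_natCast, add_assoc, pow_add _ (2 * n + 2), mul_inv, ← mul_assoc,
    mul_inv_cancel₀ (by positivity), one_mul, one_div, inv_pow]
  refine inv_anti₀ (by positivity) (le_self_pow₀ (one_le_pow₀ one_le_two) (by omega))

/-- The mass of `|p|^{1-Q}` in balls. -/
lemma exists_setLIntegral_homNorm_lt_le (n : ℕ) : ∃ c : ℝ, 0 < c ∧ ∀ R : ℝ, 0 < R →
    ∫⁻ p in {p : Heis n | homNorm p < R}, ENNReal.ofReal ((homNorm p ^ (2 * n + 1))⁻¹)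
      ≤ ENNReal.ofReal (c * R) := by
  set I := ∫⁻ p in {p : Heis n | homNorm p < 1}, ENNReal.ofReal ((homNorm p ^ (2 * n + 1))⁻¹)
    with hI
  have hIt : I ≠ ⊤ := setLIntegral_homNorm_lt_one_ne_top (by omega)
  refine ⟨I.toReal + 1, by positivity, fun R hR => ?_⟩
  have hpre : dil R ⁻¹' {p : Heis n | homNorm p < R} = {p | homNorm p < 1} := by
    ext p
    simp only [Set.mem_preimage, Set.mem_ofPred_eq, homNorm_dil hR.le]
    exact mul_lt_iff_lt_one_right hR
  rw [setLIntegral_eq_dil hR, hpre]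
  have : ∀ p : Heis n, ENNReal.ofReal ((homNorm (dil R p) ^ (2 * n + 1))⁻¹)
      = ENNReal.ofReal ((R ^ (2 * n + 1))⁻¹) * ENNReal.ofReal ((homNorm p ^ (2 * n + 1))⁻¹) :=
    fun p => by rw [homNorm_dil hR.le, mul_pow, mul_inv, ENNReal.ofReal_mul (by positivity)]
  simp only [this]
  rw [lintegral_const_mul' _ _ ENNReal.ofReal_ne_top, ← hI, ← mul_assoc,
    ← ENNReal.ofReal_mul (by positivity), ← ENNReal.ofReal_toReal hIt,
    ← ENNReal.ofReal_mul (by positivity)]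
  refine ENNReal.ofReal_le_ofReal ?_
  have : R ^ (2 * n + 2) * (R ^ (2 * n + 1))⁻¹ = R := by
    rw [pow_succ R (2 * n + 1)]; field_simp
  rw [this, ENNReal.toReal_ofReal ENNReal.toReal_nonneg]; nlinarith

/-- The `L²` mass of `|p|^{1-Q}` outside balls. -/
lemma exists_setLIntegral_le_homNorm_le {n : ℕ} (hn : 1 ≤ n) : ∃ c : ℝ, 0 < c ∧ ∀ R : ℝ, 0 < R →
    ∫⁻ p in {p : Heis n | R ≤ homNorm p}, ENNReal.ofReal ((homNorm p ^ (2 * n + 1))⁻¹) ^ (2 : ℝ)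
      ≤ ENNReal.ofReal (c * (R ^ (2 * n))⁻¹) := by
  have hsq : ∀ p : Heis n, ENNReal.ofReal ((homNorm p ^ (2 * n + 1))⁻¹) ^ (2 : ℝ)
      = ENNReal.ofReal ((homNorm p ^ (4 * n + 2))⁻¹) := fun p => by
    have := homNorm_nonneg p
    rw [ENNReal.ofReal_rpow_of_nonneg (by positivity) (by norm_num)]
    congr 1
    rw [Real.rpow_two, inv_pow, ← pow_mul]; congr 2; ring
  simp only [hsq]
  set I := ∫⁻ p in {p : Heis n | 1 ≤ homNorm p}, ENNReal.ofReal ((homNorm p ^ (4 * n + 2))⁻¹)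
    with hI
  have hIt : I ≠ ⊤ := setLIntegral_one_le_homNorm_ne_top (by omega)
  refine ⟨I.toReal + 1, by positivity, fun R hR => ?_⟩
  have hpre : dil R ⁻¹' {p : Heis n | R ≤ homNorm p} = {p | 1 ≤ homNorm p} := by
    ext p
    simp only [Set.mem_preimage, Set.mem_ofPred_eq, homNorm_dil hR.le]
    exact le_mul_iff_one_le_right hR
  rw [setLIntegral_eq_dil hR, hpre]
  have : ∀ p : Heis n, ENNReal.ofReal ((homNorm (dil R p) ^ (4 * n + 2))⁻¹)
      = ENNReal.ofReal ((R ^ (4 * n + 2))⁻¹) * ENNReal.ofReal ((homNorm p ^ (4 * n + 2))⁻¹) :=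
    fun p => by rw [homNorm_dil hR.le, mul_pow, mul_inv, ENNReal.ofReal_mul (by positivity)]
  simp only [this]
  rw [lintegral_const_mul' _ _ ENNReal.ofReal_ne_top, ← hI, ← mul_assoc,
    ← ENNReal.ofReal_mul (by positivity), ← ENNReal.ofReal_toReal hIt,
    ← ENNReal.ofReal_mul (by positivity)]
  refine ENNReal.ofReal_le_ofReal ?_
  have : R ^ (2 * n + 2) * (R ^ (4 * n + 2))⁻¹ = (R ^ (2 * n))⁻¹ := by
    rw [show 4 * n + 2 = (2 * n + 2) + 2 * n by ring, pow_add _ (2 * n + 2), mul_inv, ← mul_assoc,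
      mul_inv_cancel₀ (by positivity), one_mul]
  rw [this, ENNReal.toReal_ofReal ENNReal.toReal_nonneg, mul_comm]
  gcongr; linarith

/-- The integral of `|p|^{-Q}` over `Ω_T` grows logarithmically. -/
lemma exists_setLIntegral_annulus_le (n : ℕ) : ∃ c : ℝ, 0 < c ∧ ∀ T : ℝ, 1 ≤ Real.log T → 0 < T →
    ∫⁻ p in annulus n T, ENNReal.ofReal ((homNorm p ^ (2 * n + 2))⁻¹)
      ≤ ENNReal.ofReal (c * Real.log T) := by
  set I := ∫⁻ p in shell n 2 0, ENNReal.ofReal ((homNorm p ^ (2 * n + 2))⁻¹) with hI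
  have hIt : I ≠ ⊤ := setLIntegral_shell_zero_homNorm_pow_ne_top _
  -- The annulus is covered by `m ≤ log T / log 2 + 1 ≤ 3 log T` dyadic shells of equal mass `I`;
  -- adding `1` only keeps the constant positive.
  refine ⟨3 * (I.toReal + 1), by positivity, fun T hlog hT => ?_⟩
  set m : ℕ := ⌊Real.log T / Real.log 2⌋₊ + 1 with hm
  have hl2 : (0.6931471803 : ℝ) < Real.log 2 := Real.log_two_gt_d9
  have hl2' : 0 < Real.log 2 := by linarith
  have hTm : T < 2 ^ m := by
    have h1 : Real.log T / Real.log 2 < m := by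
      rw [hm]; push_cast; exact Nat.lt_floor_add_one _
    have h2 : Real.log T < Real.log (2 ^ m) := by
      rw [Real.log_pow]; exact (div_lt_iff₀ hl2').1 h1
    exact (Real.log_lt_log_iff hT (by positivity)).1 h2
  have hsub : annulus n T ⊆ ⋃ j ∈ Finset.range m, shell n 2 (j : ℤ) := by
    rintro p ⟨h1, h2⟩
    obtain ⟨k, hk1, hk2⟩ := exists_mem_Ico_zpow (zero_lt_one.trans_le h1) (one_lt_two (α := ℝ))
    have a1 : 0 < k + 1 := by
      have : (2 : ℝ) ^ (0 : ℤ) < 2 ^ (k + 1) := by simpa using h1.trans_lt hk2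
      exact (zpow_lt_zpow_iff_right₀ one_lt_two).1 this
    have a2 : k < m := by
      have : (2 : ℝ) ^ k < 2 ^ (m : ℤ) := by
        rw [zpow_natCast]; exact (hk1.trans h2).trans_lt hTm
      exact (zpow_lt_zpow_iff_right₀ one_lt_two).1 this
    simp only [Set.mem_iUnion]
    refine ⟨k.toNat, Finset.mem_range.2 (by omega), ?_⟩
    rw [Int.toNat_of_nonneg (by omega)]
    exact ⟨hk1, hk2⟩
  have hshell : ∀ j : ℕ, ∫⁻ p in shell n 2 (j : ℤ), ENNReal.ofReal ((homNorm p ^ (2 * n + 2))⁻¹) = I := by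
    intro j
    rw [setLIntegral_shell_homNorm_pow, mul_inv_cancel₀ (by positivity), ENNReal.ofReal_one, one_mul]
  have hinj : Pairwise (Function.onFun Disjoint fun j : ℕ => shell n 2 (j : ℤ)) :=
    fun i j hij => pairwise_disjoint_shell one_lt_two (by exact_mod_cast hij)
  calc _ ≤ ∑ j ∈ Finset.range m, ∫⁻ p in shell n 2 (j : ℤ),
          ENNReal.ofReal ((homNorm p ^ (2 * n + 2))⁻¹) := by
        rw [← lintegral_biUnion_finset (fun i _ j _ hij => hinj hij)
          (fun k _ => measurableSet_shell 2 k)]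
        exact lintegral_mono_set hsub
    _ = m * I := by simp [hshell]
    _ = ENNReal.ofReal (m * I.toReal) := by
        rw [ENNReal.ofReal_mul (by positivity), ENNReal.ofReal_toReal hIt, ENNReal.ofReal_natCast]
    _ ≤ _ := by
        refine ENNReal.ofReal_le_ofReal ?_
        have h3 : (m : ℝ) ≤ 3 * Real.log T := by
          have : (⌊Real.log T / Real.log 2⌋₊ : ℝ) ≤ Real.log T / Real.log 2 :=
            Nat.floor_le (by positivity)
          have h4 : Real.log T / Real.log 2 ≤ 2 * Real.log T := by
            rw [div_le_iff₀ hl2']; nlinarith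
          rw [hm]; push_cast; linarith
        have := ENNReal.toReal_nonneg (a := I)
        nlinarith

end Powers

/-! ### The fractional integral of order one from `L²` to `L^{2*}` -/

section FractionalIntegral

variable {n : ℕ}

/-- The kernel `|w|^{1-Q}`. -/
def rieszKernel (w : Heis n) : ℝ≥0∞ := ENNReal.ofReal ((homNorm w ^ (2 * n + 1))⁻¹)

lemma measurable_rieszKernel : Measurable (rieszKernel : Heis n → ℝ≥0∞) :=
  measurable_ofReal_homNorm_pow_inv _

lemma measurable_hmul : Measurable fun q : Heis n × Heis n => hmul q.1 q.2 :=
  continuous_hmul.measurable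

/-- The `L¹` bound for a right convolution. -/
lemma lintegral_lintegral_hmul {g k : Heis n → ℝ≥0∞} (hg : Measurable g) (hk : Measurable k) :
    ∫⁻ x, ∫⁻ w, g (hmul x w) * k w = (∫⁻ x, g x) * ∫⁻ w, k w := by
  rw [lintegral_lintegral_swap]
  · have : ∀ w, ∫⁻ x, g (hmul x w) * k w = (∫⁻ x, g x) * k w := fun w => by
      rw [lintegral_mul_const (f := fun x => g (hmul x w)) _
          (hg.comp (measurePreserving_hmul_right w).measurable),
        (measurePreserving_hmul_right w).lintegral_comp hg]
    simp only [this]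
    rw [lintegral_const_mul _ hk]
  · exact ((hg.comp measurable_hmul).mul (hk.comp measurable_snd)).aemeasurable

lemma lintegral_hmul_mul_le {f k : Heis n → ℝ≥0∞} (hf : Measurable f) (hk : Measurable k)
    (x : Heis n) : ∫⁻ w, f (hmul x w) * k w
      ≤ (∫⁻ w, f w ^ (2 : ℝ)) ^ (1 / 2 : ℝ) * (∫⁻ w, k w ^ (2 : ℝ)) ^ (1 / 2 : ℝ) := by
  have h := ENNReal.lintegral_mul_le_Lp_mul_Lq volume Real.HolderConjugate.two_two
    (hf.comp (measurePreserving_hmul_left x).measurable).aemeasurable hk.aemeasurable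
  refine h.trans (le_of_eq ?_)
  congr 2
  exact (measurePreserving_hmul_left x).lintegral_comp (hf.pow_const 2)

/-- The level sets of a function bounded by a fractional integral. -/
lemma volume_lt_le_of_le_lintegral {c₁ c₂ : ℝ} (hc₁ : 0 < c₁) (hc₂ : 0 < c₂)
    (h₁ : ∀ R : ℝ, 0 < R → ∫⁻ p in {p : Heis n | R ≤ homNorm p}, rieszKernel p ^ (2 : ℝ)
      ≤ ENNReal.ofReal (c₁ * (R ^ (2 * n))⁻¹))
    (h₂ : ∀ R : ℝ, 0 < R → ∫⁻ p in {p : Heis n | homNorm p < R}, rieszKernel p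
      ≤ ENNReal.ofReal (c₂ * R))
    {f h : Heis n → ℝ} (hf : Measurable f) (hf0 : ∀ x, 0 ≤ f x)
    (hle : ∀ x, ENNReal.ofReal (h x) ≤ ∫⁻ w, ENNReal.ofReal (f (hmul x w)) * rieszKernel w)
    {B : ℝ} (hB : 0 < B) (hfB : ∫⁻ x, ENNReal.ofReal (f x ^ 2) ≤ ENNReal.ofReal B)
    {t R : ℝ} (ht : 0 < t) (hR : 0 < R) (htR : R ^ n * t = 4 * Real.sqrt (B * c₁)) :
    volume {x | t < h x} ≤ ENNReal.ofReal (2 * c₂ * R / t) *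
      ∫⁻ x, Set.indicator {x | t / (4 * c₂ * R) < f x} (fun x => ENNReal.ofReal (f x)) x := by
  -- The kernel is split at radius `R` and `f` at height `s`. The value of `R` makes the
  -- Cauchy–Schwarz bound of the far part equal to `t/4`; the value of `s` makes the near part
  -- acting on `{f ≤ s}` at most `t/4`. The remaining `t/2` must come from the near part acting on
  -- `{f > s}`, which Chebyshev's inequality controls in `L¹`.
  set s := t / (4 * c₂ * R) with hs
  set F : Heis n → ℝ≥0∞ := fun x => ENNReal.ofReal (f x) with hF
  have hFm : Measurable F := hf.ennreal_ofReal
  set g : Heis n → ℝ≥0∞ := Set.indicator {x | s < f x} F with hg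
  have hgm : Measurable g := hFm.indicator (measurableSet_lt measurable_const hf)
  set N : Set (Heis n) := {p | homNorm p < R} with hN
  have hNm : MeasurableSet N := measurableSet_lt measurable_homNorm measurable_const
  have hNc : Nᶜ = {p | R ≤ homNorm p} := by ext p; simp [hN]
  set kn : Heis n → ℝ≥0∞ := N.indicator rieszKernel with hkn
  set kf : Heis n → ℝ≥0∞ := Nᶜ.indicator rieszKernel with hkf
  have hknm : Measurable kn := measurable_rieszKernel.indicator hNm
  have hkfm : Measurable kf := measurable_rieszKernel.indicator hNm.compl
  have hkn1 : ∫⁻ w, kn w ≤ ENNReal.ofReal (c₂ * R) := by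
    rw [hkn, lintegral_indicator hNm]; exact h₂ R hR
  have hfar : ∀ x, ∫⁻ w, F (hmul x w) * kf w ≤ ENNReal.ofReal (t / 4) := by
    intro x
    refine (lintegral_hmul_mul_le hFm hkfm x).trans ?_
    have e1 : ∫⁻ w, F w ^ (2 : ℝ) ≤ ENNReal.ofReal B := by
      refine le_trans (le_of_eq (lintegral_congr fun w => ?_)) hfB
      rw [hF, ENNReal.ofReal_rpow_of_nonneg (hf0 w) (by norm_num), Real.rpow_two]
    have e2 : ∫⁻ w, kf w ^ (2 : ℝ) ≤ ENNReal.ofReal (c₁ * (R ^ (2 * n))⁻¹) := by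
      refine le_trans (le_of_eq ?_) (h₁ R hR)
      rw [← hNc, ← lintegral_indicator hNm.compl]
      refine lintegral_congr fun w => ?_
      by_cases hw : w ∈ Nᶜ <;> simp [hkf, hw]
    calc _ ≤ ENNReal.ofReal B ^ (1 / 2 : ℝ) * ENNReal.ofReal (c₁ * (R ^ (2 * n))⁻¹) ^ (1 / 2 : ℝ) := by
          gcongr
      _ = ENNReal.ofReal (t / 4) := by
          rw [← ENNReal.mul_rpow_of_nonneg _ _ (by norm_num), ← ENNReal.ofReal_mul hB.le,
            ENNReal.ofReal_rpow_of_nonneg (by positivity) (by norm_num), ← Real.sqrt_eq_rpow]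
          congr 1
          rw [← mul_assoc, Real.sqrt_mul (by positivity), Real.sqrt_inv, mul_comm 2 n, pow_mul,
            Real.sqrt_sq (by positivity)]
          field_simp
          linarith
  have hnear : ∀ x, ∫⁻ w, F (hmul x w) * kn w
      ≤ ENNReal.ofReal (t / 4) + ∫⁻ w, g (hmul x w) * kn w := by
    intro x
    have hpt : ∀ y, F y ≤ ENNReal.ofReal s + g y := fun y => by
      by_cases hy : s < f y
      · simp only [hg, Set.indicator_apply, Set.mem_ofPred_eq, hy, if_true]; exact le_add_self
      · exact (ENNReal.ofReal_le_ofReal (not_lt.1 hy)).trans le_self_add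
    calc ∫⁻ w, F (hmul x w) * kn w
        ≤ ∫⁻ w, (ENNReal.ofReal s * kn w + g (hmul x w) * kn w) := by
          refine lintegral_mono fun w => ?_
          rw [← add_mul]
          exact mul_le_mul_left (hpt _) _
      _ = (ENNReal.ofReal s * ∫⁻ w, kn w) + ∫⁻ w, g (hmul x w) * kn w := by
          rw [lintegral_add_left (hknm.const_mul _), lintegral_const_mul _ hknm]
      _ ≤ _ := by
          gcongr
          refine (mul_le_mul' le_rfl hkn1).trans (le_of_eq ?_)
          rw [← ENNReal.ofReal_mul (by positivity)]
          congr 1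
          rw [hs]; field_simp
  have hsub : {x | t < h x} ⊆ {x | ENNReal.ofReal (t / 2) ≤ ∫⁻ w, g (hmul x w) * kn w} := by
    intro x hx
    have hx : t < h x := hx
    have e : ∫⁻ w, F (hmul x w) * rieszKernel w
        = (∫⁻ w, F (hmul x w) * kn w) + ∫⁻ w, F (hmul x w) * kf w := by
      rw [← lintegral_add_left (f := fun w => F (hmul x w) * kn w)
        ((hFm.comp (measurePreserving_hmul_left x).measurable).mul hknm)]
      refine lintegral_congr fun w => ?_
      rw [← mul_add, hkn, hkf, ← Pi.add_apply (N.indicator _), Set.indicator_self_add_compl]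
    have h1 : ENNReal.ofReal t ≤ ENNReal.ofReal (t / 2) + ∫⁻ w, g (hmul x w) * kn w := by
      calc ENNReal.ofReal t ≤ ENNReal.ofReal (h x) := ENNReal.ofReal_le_ofReal hx.le
        _ ≤ _ := hle x
        _ = _ := e
        _ ≤ (ENNReal.ofReal (t / 4) + ∫⁻ w, g (hmul x w) * kn w) + ENNReal.ofReal (t / 4) :=
            add_le_add (hnear x) (hfar x)
        _ = _ := by
            rw [add_right_comm, ← ENNReal.ofReal_add (by positivity) (by positivity)]
            congr 2; ring
    rw [show t = t / 2 + t / 2 by ring, ENNReal.ofReal_add (by positivity) (by positivity)] at h1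
    rw [show (t / 2 + t / 2) / 2 = t / 2 by ring] at h1
    exact (ENNReal.add_le_add_iff_left ENNReal.ofReal_ne_top).1 h1
  have hmark : ENNReal.ofReal (t / 2) * volume {x | t < h x}
      ≤ ENNReal.ofReal (c₂ * R) * ∫⁻ x, g x := by
    have hm : AEMeasurable (fun x => ∫⁻ w, g (hmul x w) * kn w) volume :=
      (((hgm.comp measurable_hmul).mul (hknm.comp measurable_snd)).lintegral_prod_right).aemeasurable
    calc _ ≤ ENNReal.ofReal (t / 2) *
          volume {x | ENNReal.ofReal (t / 2) ≤ ∫⁻ w, g (hmul x w) * kn w} := by gcongr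
      _ ≤ ∫⁻ x, ∫⁻ w, g (hmul x w) * kn w := mul_meas_ge_le_lintegral₀ hm _
      _ = (∫⁻ x, g x) * ∫⁻ w, kn w := lintegral_lintegral_hmul hgm hknm
      _ ≤ _ := by rw [mul_comm]; gcongr
  have e : ENNReal.ofReal (2 * c₂ * R / t) = ENNReal.ofReal (t / 2)⁻¹ * ENNReal.ofReal (c₂ * R) := by
    rw [← ENNReal.ofReal_mul (by positivity)]; congr 1; field_simp
  rw [e, mul_assoc]
  calc volume {x | t < h x}
      = ENNReal.ofReal (t / 2)⁻¹ * (ENNReal.ofReal (t / 2) * volume {x | t < h x}) := by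
        rw [← mul_assoc, ← ENNReal.ofReal_mul (by positivity), inv_mul_cancel₀ (by positivity),
          ENNReal.ofReal_one, one_mul]
    _ ≤ _ := mul_le_mul' le_rfl hmark

/-- The fractional integral of order one maps `L²` to `L^{2*}`, where `2* = 2 + 2/n`. -/
theorem exists_lintegral_rpow_le_of_le_lintegral (hn : 1 ≤ n) :
    ∃ C : ℝ, 0 < C ∧ ∀ f h : Heis n → ℝ, Measurable f → (∀ x, 0 ≤ f x) → Measurable h →
      (∀ x, 0 ≤ h x) →
      (∀ x, ENNReal.ofReal (h x) ≤ ∫⁻ w, ENNReal.ofReal (f (hmul x w)) * rieszKernel w) →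
      ∀ B : ℝ, 0 < B → ∫⁻ x, ENNReal.ofReal (f x ^ 2) ≤ ENNReal.ofReal B →
      ∫⁻ x, ENNReal.ofReal (h x ^ (2 + 2 / (n : ℝ))) ≤ ENNReal.ofReal (C * B ^ (1 + 1 / (n : ℝ))) := by
  obtain ⟨c₁, hc₁, h₁⟩ := exists_setLIntegral_le_homNorm_le hn
  obtain ⟨c₂, hc₂, h₂⟩ := exists_setLIntegral_homNorm_lt_le n
  have hn0 : (0 : ℝ) < n := by exact_mod_cast hn
  set q : ℝ := 2 + 2 / (n : ℝ) with hq
  have hq0 : 0 < q := by positivity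
  refine ⟨q * (8 * c₂ ^ 2 * (16 * c₁) ^ (1 / (n : ℝ))), by positivity, ?_⟩
  intro f h hf hf0 hh hh0 hle B hB hfB
  set K : ℝ := (4 * Real.sqrt (B * c₁)) ^ (1 / (n : ℝ)) with hK
  have hK0 : 0 < K := by positivity
  have hKn : K ^ n = 4 * Real.sqrt (B * c₁) := by
    rw [hK, ← Real.rpow_natCast, ← Real.rpow_mul (by positivity), one_div_mul_cancel hn0.ne',
      Real.rpow_one]
  have hK2 : K ^ 2 = (16 * c₁) ^ (1 / (n : ℝ)) * B ^ (1 / (n : ℝ)) := by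
    rw [hK, ← Real.rpow_natCast, ← Real.rpow_mul (by positivity), mul_comm (1 / (n : ℝ)),
      Real.rpow_mul (by positivity), Real.rpow_natCast, mul_pow, Real.sq_sqrt (by positivity),
      ← Real.mul_rpow (by positivity) (by positivity)]
    congr 1; ring
  set a : ℝ := 1 + 1 / (n : ℝ) with ha
  have ha0 : 0 < a := by positivity
  -- the level set estimate with `R = K t^{-1/n}`
  have hlevel : ∀ t ∈ Set.Ioi (0 : ℝ), volume {x | t < h x} * ENNReal.ofReal (t ^ (q - 1)) ≤
      ∫⁻ x, Set.indicator {z : ℝ × Heis n | z.1 ^ a < 4 * c₂ * K * f z.2}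
        (fun z => ENNReal.ofReal (2 * c₂ * K * z.1 ^ (1 / (n : ℝ))) * ENNReal.ofReal (f z.2)) (t, x) := by
    intro t ht
    have ht : 0 < t := ht
    set R : ℝ := K * t ^ (-(1 / (n : ℝ))) with hR
    have hR0 : 0 < R := by positivity
    have htR : R ^ n * t = 4 * Real.sqrt (B * c₁) := by
      rw [hR, mul_pow, hKn, ← Real.rpow_natCast (t ^ _), ← Real.rpow_mul ht.le, neg_mul,
        one_div_mul_cancel hn0.ne', Real.rpow_neg_one, mul_assoc, inv_mul_cancel₀ ht.ne', mul_one]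
    have hlev := volume_lt_le_of_le_lintegral hc₁ hc₂ h₁ h₂ hf hf0 hle hB hfB ht hR0 htR
    have e1 : 2 * c₂ * R / t * t ^ (q - 1) = 2 * c₂ * K * t ^ (1 / (n : ℝ)) := by
      have : t ^ (-(1 / (n : ℝ))) / t * t ^ (q - 1) = t ^ (1 / (n : ℝ)) := by
        rw [← Real.rpow_sub_one ht.ne', ← Real.rpow_add ht]; congr 1; rw [hq]; ring
      rw [← this, hR]; ring
    have e2 : ∀ x, t / (4 * c₂ * R) < f x ↔ t ^ a < 4 * c₂ * K * f x := fun x => by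
      have : t ^ a = t * (t ^ (-(1 / (n : ℝ))))⁻¹ := by
        rw [← Real.rpow_neg ht.le, neg_neg, mul_comm, ← Real.rpow_add_one ht.ne']
        congr 1; rw [ha]; ring
      have hp : 0 < t ^ (-(1 / (n : ℝ))) := by positivity
      rw [this, hR, div_lt_iff₀ (by positivity), ← div_eq_mul_inv, div_lt_iff₀ hp]
      constructor <;> intro h <;> linarith
    calc volume {x | t < h x} * ENNReal.ofReal (t ^ (q - 1))
        ≤ (ENNReal.ofReal (2 * c₂ * R / t) * ∫⁻ x, Set.indicator {x | t / (4 * c₂ * R) < f x}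
          (fun x => ENNReal.ofReal (f x)) x) * ENNReal.ofReal (t ^ (q - 1)) := by gcongr
      _ = ENNReal.ofReal (2 * c₂ * K * t ^ (1 / (n : ℝ))) *
          ∫⁻ x, Set.indicator {x | t / (4 * c₂ * R) < f x} (fun x => ENNReal.ofReal (f x)) x := by
          rw [mul_right_comm, ← ENNReal.ofReal_mul (by positivity), e1]
      _ = _ := by
          rw [← lintegral_const_mul' _ _ ENNReal.ofReal_ne_top]
          refine lintegral_congr fun x => ?_
          by_cases hx : t ^ a < 4 * c₂ * K * f x
          · simp only [Set.indicator_apply, Set.mem_ofPred_eq, (e2 x).2 hx, hx, if_true]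
          · simp only [Set.indicator_apply, Set.mem_ofPred_eq, e2 x, hx, if_false, mul_zero]
  have hmeas : Measurable (Set.indicator {z : ℝ × Heis n | z.1 ^ a < 4 * c₂ * K * f z.2}
      (fun z => ENNReal.ofReal (2 * c₂ * K * z.1 ^ (1 / (n : ℝ))) * ENNReal.ofReal (f z.2))) := by
    refine Measurable.indicator (by fun_prop) (measurableSet_lt (by fun_prop) (by fun_prop))
  -- Integrating the weak estimate at a fixed level would diverge; here the truncation of `f`
  -- depends on the level, so after exchanging the integrals each `x` only sees levels `t` with `t^a
  -- < 4 c₂ K f(x)`.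
  rw [lintegral_rpow_eq_lintegral_meas_lt_mul volume (ae_of_all _ hh0) hh.aemeasurable hq0]
  calc _ ≤ ENNReal.ofReal q * ∫⁻ t in Set.Ioi (0 : ℝ), ∫⁻ x,
        Set.indicator {z : ℝ × Heis n | z.1 ^ a < 4 * c₂ * K * f z.2}
        (fun z => ENNReal.ofReal (2 * c₂ * K * z.1 ^ (1 / (n : ℝ))) *
          ENNReal.ofReal (f z.2)) (t, x) := by
        exact mul_le_mul' le_rfl (setLIntegral_mono hmeas.lintegral_prod_right' hlevel)
    _ = ENNReal.ofReal q * ∫⁻ x, ∫⁻ t in Set.Ioi (0 : ℝ),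
        Set.indicator {z : ℝ × Heis n | z.1 ^ a < 4 * c₂ * K * f z.2}
        (fun z => ENNReal.ofReal (2 * c₂ * K * z.1 ^ (1 / (n : ℝ))) *
          ENNReal.ofReal (f z.2)) (t, x) := by
        rw [lintegral_lintegral_swap (f := fun t x => Set.indicator
          {z : ℝ × Heis n | z.1 ^ a < 4 * c₂ * K * f z.2}
          (fun z => ENNReal.ofReal (2 * c₂ * K * z.1 ^ (1 / (n : ℝ))) *
          ENNReal.ofReal (f z.2)) (t, x)) hmeas.aemeasurable]
    _ ≤ ENNReal.ofReal q * ∫⁻ x, ENNReal.ofReal (8 * c₂ ^ 2 * K ^ 2) * ENNReal.ofReal (f x ^ 2) := by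
        gcongr with x
        -- Bounding `t^{1/n}` by `t₀^{1/n}` on `(0, t₀]` gives the integral `t₀^{1/n} t₀ = t₀^a =
        -- M`, which is linear in `f x`; with the factor `f x` already present this yields `f x ^
        -- 2`.
        set M : ℝ := 4 * c₂ * K * f x with hM
        have hM0 : 0 ≤ M := mul_nonneg (by positivity) (hf0 x)
        set t₀ : ℝ := M ^ a⁻¹ with ht₀
        have ht00 : 0 ≤ t₀ := Real.rpow_nonneg hM0 _
        calc _ ≤ ∫⁻ t in Set.Ioi (0 : ℝ), Set.indicator (Set.Ioc 0 t₀)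
              (fun _ => ENNReal.ofReal (2 * c₂ * K * t₀ ^ (1 / (n : ℝ))) * ENNReal.ofReal (f x)) t := by
              refine setLIntegral_mono (measurable_const.indicator measurableSet_Ioc) fun t ht => ?_
              have ht : 0 < t := ht
              by_cases hx : t ^ a < M
              · have h1 : t ≤ t₀ := by
                  rw [ht₀, ← Real.rpow_rpow_inv ht.le ha0.ne']
                  exact Real.rpow_le_rpow (by positivity) hx.le (by positivity)
                rw [Set.indicator_of_mem (show t ∈ Set.Ioc 0 t₀ from ⟨ht, h1⟩)]
                simp only [Set.indicator_apply, Set.mem_ofPred_eq, ← hM, hx, if_true]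
                gcongr
              · simp only [Set.indicator_apply, Set.mem_ofPred_eq, ← hM, hx, if_false]
                exact zero_le
          _ ≤ ∫⁻ t, Set.indicator (Set.Ioc 0 t₀)
              (fun _ => ENNReal.ofReal (2 * c₂ * K * t₀ ^ (1 / (n : ℝ))) * ENNReal.ofReal (f x)) t :=
              setLIntegral_le_lintegral _ _
          _ = ENNReal.ofReal (8 * c₂ ^ 2 * K ^ 2) * ENNReal.ofReal (f x ^ 2) := by
              rw [lintegral_indicator measurableSet_Ioc, setLIntegral_const, Real.volume_Ioc, sub_zero,
                ← ENNReal.ofReal_mul (by positivity), ← ENNReal.ofReal_mul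
                  (mul_nonneg (by positivity) (hf0 x)), ← ENNReal.ofReal_mul (by positivity)]
              congr 1
              have h3 : t₀ ^ (1 / (n : ℝ)) * t₀ = M := by
                rw [← Real.rpow_add_one' ht00 (by positivity), ht₀, ← Real.rpow_mul hM0,
                  show a⁻¹ * (1 / (n : ℝ) + 1) = 1 by rw [add_comm, ← ha, inv_mul_cancel₀ ha0.ne'],
                  Real.rpow_one]
              calc _ = 2 * c₂ * K * (t₀ ^ (1 / (n : ℝ)) * t₀) * f x := by ring
                _ = _ := by rw [h3, hM]; ring
    _ = ENNReal.ofReal q * (ENNReal.ofReal (8 * c₂ ^ 2 * K ^ 2) * ∫⁻ x, ENNReal.ofReal (f x ^ 2)) := by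
        rw [lintegral_const_mul' _ _ ENNReal.ofReal_ne_top]
    _ ≤ ENNReal.ofReal q * (ENNReal.ofReal (8 * c₂ ^ 2 * K ^ 2) * ENNReal.ofReal B) := by gcongr
    _ = _ := by
        rw [← ENNReal.ofReal_mul (by positivity), ← ENNReal.ofReal_mul (by positivity), hK2]
        congr 1
        rw [ha, Real.rpow_add hB, Real.rpow_one]; ring

end FractionalIntegral

/-! ### Continuity of right translations in `L¹` -/

section Translation

variable {n : ℕ}

lemma hmul_zero (x : Heis n) : hmul x 0 = x := by
  ext <;> simp [hmul]

lemma hmul_neg_cancel_right (x w : Heis n) : hmul (hmul x w) (-w) = x := by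
  refine Prod.ext ?_ ?_
  · simp [hmul]
  · simp only [hmul, Prod.fst_neg, Prod.snd_neg, Pi.neg_apply, Pi.add_apply, Complex.neg_im,
      Complex.neg_re, Complex.add_re, Complex.add_im]
    have : ∑ i, (((x.1 i).im + (w.1 i).im) * -(w.1 i).re - ((x.1 i).re + (w.1 i).re) * -(w.1 i).im)
        = -∑ i, ((x.1 i).im * (w.1 i).re - (x.1 i).re * (w.1 i).im) := by
      rw [← Finset.sum_neg_distrib]
      exact Finset.sum_congr rfl fun i _ => by ring
    rw [this]; ring

/-- The `L¹` distance between a function and its right translate. -/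
def transDist (g : Heis n → ℝ) (w : Heis n) : ℝ≥0∞ := ∫⁻ x, ‖g (hmul x w) - g x‖ₑ

lemma measurable_transDist {g : Heis n → ℝ} (hg : Measurable g) : Measurable (transDist g) := by
  have : Measurable fun q : Heis n × Heis n => ‖g (hmul q.1 q.2) - g q.1‖ₑ :=
    ((hg.comp measurable_hmul).sub (hg.comp measurable_fst)).enorm
  exact this.lintegral_prod_left'

lemma transDist_le {g : Heis n → ℝ} (hg : Measurable g) (w : Heis n) :
    transDist g w ≤ 2 * ∫⁻ x, ‖g x‖ₑ := by
  calc transDist g w ≤ ∫⁻ x, (‖g (hmul x w)‖ₑ + ‖g x‖ₑ) := lintegral_mono fun x => enorm_sub_le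
    _ = (∫⁻ x, ‖g (hmul x w)‖ₑ) + ∫⁻ x, ‖g x‖ₑ := lintegral_add_right _ hg.enorm
    _ = _ := by
      rw [(measurePreserving_hmul_right w).lintegral_comp (f := fun x => ‖g x‖ₑ) hg.enorm, two_mul]

lemma tendsto_transDist_of_hasCompactSupport {g : Heis n → ℝ} (hg : Continuous g)
    (hc : HasCompactSupport g) : Tendsto (transDist g) (𝓝 0) (𝓝 0) := by
  obtain ⟨M, hM⟩ := hg.bounded_above_of_compact_support hc
  -- This compact set contains the supports of `g` and of all its right translates by elements of
  -- the closed unit ball, which gives a dominating function.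
  set K : Set (Heis n) := tsupport g ∪ (fun q : Heis n × Heis n => hmul q.1 (-q.2)) ''
    (tsupport g ×ˢ Metric.closedBall 0 1) with hK
  have hKc : IsCompact K := hc.isCompact.union ((hc.isCompact.prod
    (isCompact_closedBall 0 1)).image
      (continuous_hmul.comp (continuous_fst.prodMk continuous_snd.neg)))
  have hM0 : 0 ≤ M := (norm_nonneg _).trans (hM 0)
  have key : Tendsto (transDist g) (𝓝 0) (𝓝 (∫⁻ _x : Heis n, 0)) := by
    refine tendsto_lintegral_filter_of_dominated_convergence
      (K.indicator fun _ => ENNReal.ofReal (2 * M)) ?_ ?_ ?_ ?_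
    · exact Eventually.of_forall fun w =>
        ((hg.comp (continuous_hmul.comp (Continuous.prodMk_left w))).sub hg).measurable.enorm
    · filter_upwards [Metric.closedBall_mem_nhds (0 : Heis n) one_pos] with w hw
      refine ae_of_all _ fun x => ?_
      by_cases hx : x ∈ K
      · rw [Set.indicator_of_mem hx, ← ofReal_norm]
        refine ENNReal.ofReal_le_ofReal ((norm_sub_le _ _).trans ?_)
        linarith [hM (hmul x w), hM x]
      · have h1 : g x = 0 := image_eq_zero_of_notMem_tsupport fun h => hx (Or.inl h)
        have h2 : g (hmul x w) = 0 := image_eq_zero_of_notMem_tsupport fun h =>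
          hx (Or.inr ⟨(hmul x w, w), ⟨h, hw⟩, hmul_neg_cancel_right x w⟩)
        simp [h1, h2]
    · rw [lintegral_indicator hKc.measurableSet, setLIntegral_const]
      exact ENNReal.mul_ne_top ENNReal.ofReal_ne_top hKc.measure_lt_top.ne
    · refine ae_of_all _ fun x => ?_
      have : Continuous fun w : Heis n => ‖g (hmul x w) - g x‖ₑ :=
        ((hg.comp (continuous_hmul.comp (Continuous.prodMk_right x))).sub continuous_const).enorm
      have := this.tendsto 0
      simpa [hmul_zero] using this
  simpa using key

/-- Right translations are continuous in `L¹`. -/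
lemma tendsto_transDist {g : Heis n → ℝ} (hg : Measurable g) (hi : Integrable g) :
    Tendsto (transDist g) (𝓝 0) (𝓝 0) := by
  rw [ENNReal.tendsto_nhds_zero]
  intro ε hε
  have hε3 : ε / 3 ≠ 0 := (ENNReal.div_pos hε.ne' (by norm_num)).ne'
  obtain ⟨φ, hφc, hφ, hφcont, -⟩ := hi.exists_hasCompactSupport_lintegral_sub_le hε3
  have h1 := (ENNReal.tendsto_nhds_zero.1 (tendsto_transDist_of_hasCompactSupport hφcont hφc)) (ε / 3)
    (pos_iff_ne_zero.2 hε3)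
  filter_upwards [h1] with w hw
  have hm : Measurable fun x => ‖g x - φ x‖ₑ := (hg.sub hφcont.measurable).enorm
  have hmp := measurePreserving_hmul_right w
  have e1 : ∫⁻ x, ‖g (hmul x w) - φ (hmul x w)‖ₑ = ∫⁻ x, ‖g x - φ x‖ₑ := hmp.lintegral_comp hm
  calc transDist g w
      ≤ ∫⁻ x, (‖g (hmul x w) - φ (hmul x w)‖ₑ + (‖φ (hmul x w) - φ x‖ₑ + ‖g x - φ x‖ₑ)) := by
        refine lintegral_mono fun x => ?_
        have : g (hmul x w) - g x = (g (hmul x w) - φ (hmul x w)) +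
          ((φ (hmul x w) - φ x) + -(g x - φ x)) := by ring
        rw [this]
        refine (enorm_add_le _ _).trans (add_le_add le_rfl ((enorm_add_le _ _).trans ?_))
        rw [enorm_neg]
    _ = (∫⁻ x, ‖g x - φ x‖ₑ) + (transDist φ w + ∫⁻ x, ‖g x - φ x‖ₑ) := by
        rw [lintegral_add_left (f := fun x => ‖g (hmul x w) - φ (hmul x w)‖ₑ)
          (hm.comp hmp.measurable), lintegral_add_right _ hm, e1]; rfl
    _ ≤ ε / 3 + (ε / 3 + ε / 3) := by gcongr
    _ = ε := by rw [← add_assoc, ENNReal.add_thirds]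

end Translation

/-! ### The Sobolev inequality for functions with compact support away from the origin -/

section Sobolev

variable {n : ℕ}

lemma massReg_nonneg {s : ℝ} (hs : 0 < s) (p : Heis n) : 0 ≤ massReg s p := by
  have := quart_pos hs p
  unfold massReg; positivity

lemma continuous_massReg {s : ℝ} (hs : 0 < s) : Continuous (massReg s : Heis n → ℝ) := by
  unfold massReg
  exact continuous_const.mul (((contDiff_quart s (m := 0)).continuous).rpow_const
    fun p => Or.inl (quart_pos hs p).ne')

/-- The masses are the dilates of one function normalized in `L¹`, that is an approximate identity
up to their common integral. -/
lemma massReg_dil {s : ℝ} (hs : 0 < s) (p : Heis n) :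
    s ^ (2 * n + 2) * massReg s (dil s p) = massReg 1 p := by
  have hD := quart_pos one_pos p
  have h1 : quart s (dil s p) = s ^ 4 * quart 1 p := by
    have := quart_dil s 1 p
    rwa [mul_one] at this
  rw [massReg, massReg, h1, Real.mul_rpow (by positivity) hD.le]
  have h2 : (s ^ 4) ^ (-(n : ℝ) / 2 - 1) = (s ^ (2 * n + 4))⁻¹ := by
    rw [← Real.rpow_natCast, ← Real.rpow_mul hs.le, ← Real.rpow_natCast, ← Real.rpow_neg hs.le]
    congr 1; push_cast; ring
  rw [h2]
  have h3 : s ^ (2 * n + 2) * s ^ 2 * (s ^ (2 * n + 4))⁻¹ = 1 := by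
    rw [← pow_add, mul_inv_cancel₀ (by positivity)]
  calc _ = 4 * (n : ℝ) ^ 2 * quart 1 p ^ (-(n : ℝ) / 2 - 1) *
        (s ^ (2 * n + 2) * s ^ 2 * (s ^ (2 * n + 4))⁻¹) := by ring
    _ = _ := by rw [h3]; ring

/-- The function is bounded near the origin and decays like `|p|^{-(2n+4)}`, whose exponent exceeds
`Q`. -/
lemma integrable_massReg : Integrable (massReg 1 : Heis n → ℝ) := by
  refine ⟨(continuous_massReg one_pos).aestronglyMeasurable, ?_⟩
  rw [hasFiniteIntegral_iff_ofReal (ae_of_all _ (massReg_nonneg one_pos))]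
  set N : Set (Heis n) := {p | homNorm p < 1} with hN
  have hNm : MeasurableSet N := measurableSet_lt measurable_homNorm measurable_const
  have hNc : Nᶜ = {p | 1 ≤ homNorm p} := by ext p; simp [hN]
  rw [← lintegral_add_compl _ hNm, hNc]
  have e : -(n : ℝ) / 2 - 1 = -((n : ℝ) / 2 + 1) := by ring
  refine ENNReal.add_lt_top.2 ⟨?_, ?_⟩
  · refine lt_of_le_of_lt (setLIntegral_mono (g := fun p => ENNReal.ofReal (4 * (n : ℝ) ^ 2) *
      ENNReal.ofReal ((homNorm p ^ 0)⁻¹)) ((measurable_ofReal_homNorm_pow_inv 0).const_mul _)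
      fun p _ => ?_) ?_
    · rw [← ENNReal.ofReal_mul (by positivity)]
      refine ENNReal.ofReal_le_ofReal ?_
      have := quart_rpow_le' one_pos p (a := (n : ℝ) / 2 + 1) (by positivity)
      rw [Real.one_rpow] at this
      rw [massReg, e, one_pow, pow_zero, inv_one, mul_one]
      exact mul_le_of_le_one_right (by positivity) this
    · rw [lintegral_const_mul' _ _ ENNReal.ofReal_ne_top]
      exact ENNReal.mul_lt_top ENNReal.ofReal_lt_top
        (setLIntegral_homNorm_lt_one_ne_top (a := 0) (by omega)).lt_top
  · refine lt_of_le_of_lt (setLIntegral_mono (g := fun p => ENNReal.ofReal (4 * (n : ℝ) ^ 2) *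
      ENNReal.ofReal ((homNorm p ^ (2 * n + 4))⁻¹))
      ((measurable_ofReal_homNorm_pow_inv _).const_mul _) fun p hp => ?_) ?_
    · have hp1 : 1 ≤ homNorm p := hp
      have hp0 : 0 < homNorm p := by linarith
      rw [← ENNReal.ofReal_mul (by positivity)]
      refine ENNReal.ofReal_le_ofReal ?_
      have := quart_rpow_le 1 (homNorm_pos_iff.1 hp0) (a := (n : ℝ) / 2 + 1) (by positivity)
      rw [massReg, e, one_pow, mul_one]
      gcongr
      refine this.trans (le_of_eq ?_)
      rw [← Real.rpow_natCast, ← Real.rpow_neg hp0.le]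
      congr 1; push_cast; ring
    · rw [lintegral_const_mul' _ _ ENNReal.ofReal_ne_top]
      exact ENNReal.mul_lt_top ENNReal.ofReal_lt_top
        (setLIntegral_one_le_homNorm_ne_top (by omega)).lt_top

lemma integral_massReg_pos (hn : 1 ≤ n) : 0 < ∫ p : Heis n, massReg 1 p := by
  rw [integral_pos_iff_support_of_nonneg (massReg_nonneg one_pos) integrable_massReg]
  have : Function.support (massReg 1 : Heis n → ℝ) = Set.univ := by
    refine Set.eq_univ_of_forall fun p => ?_
    have := quart_pos one_pos p
    have hn0 : (0 : ℝ) < n := by exact_mod_cast hn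
    have : 0 < massReg 1 p := by unfold massReg; positivity
    exact this.ne'
  rw [this]
  exact Measure.measure_univ_pos.2 (NeZero.ne _)

lemma IsTest.mul_smooth {η G : Heis n → ℝ} (hη : IsTest η) (hG : ContDiff ℝ ∞ G) :
    IsTest fun p => η p * G p :=
  ⟨hη.smooth.mul hG, hη.compact.mul_right, (closure_mono fun p hp => by
    rw [Function.mem_support] at hp ⊢
    exact left_ne_zero_of_mul hp).trans hη.support⟩

/-- The weak derivative of the product with a cutoff function, tested against smooth functions. -/
lemma integral_cutoff_mul_fieldDeriv {i : Fin n ⊕ Fin n} {u v η G : Heis n → ℝ} (hu : L2Loc u)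
    (hv : IsWeakDeriv i u v) (hη : IsTest η) (hG : ContDiff ℝ ∞ G) :
    ∫ p, η p * u p * fieldDeriv i G p = -∫ p, (η p * v p + u p * fieldDeriv i η p) * G p := by
  have h := hv.2 _ (hη.mul_smooth hG)
  have e : ∀ p, u p * fieldDeriv i (fun p => η p * G p) p
      = u p * (fieldDeriv i η p * G p) + η p * u p * fieldDeriv i G p := fun p => by
    rw [fieldDeriv_mul i (hη.smooth.differentiable (by simp) p)
      (hG.differentiable (by simp) p)]
    ring
  have hη' : Continuous (fieldDeriv i η) := (contDiff_fieldDeriv i hη.smooth).continuous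
  have hG' : Continuous (fieldDeriv i G) := (contDiff_fieldDeriv i hG).continuous
  have hs : ∀ φ : Heis n → ℝ, tsupport (fun p => fieldDeriv i η p * φ p) ⊆ tsupport η := fun φ =>
    (closure_mono fun p hp => by
      rw [Function.mem_support] at hp ⊢
      exact left_ne_zero_of_mul hp).trans (tsupport_fieldDeriv_subset i η)
  have i1 : Integrable fun p => u p * (fieldDeriv i η p * G p) :=
    hu.integrable_mul (hη'.mul hG.continuous) (hasCompactSupport_fieldDeriv i hη.compact).mul_right
      ((hs G).trans hη.support)
  have i2 : Integrable fun p => η p * u p * fieldDeriv i G p := by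
    have := hu.integrable_mul (hη.smooth.continuous.mul hG') hη.compact.mul_right
      ((closure_mono fun p hp => by
        rw [Function.mem_support] at hp ⊢
        exact left_ne_zero_of_mul hp).trans hη.support)
    exact this.congr (ae_of_all _ fun p => by simp only [Pi.mul_apply]; ring)
  have i3 : Integrable fun p => v p * (η p * G p) := (hη.mul_smooth hG).integrable_right hv.1
  simp only [e] at h
  rw [integral_add i1 i2] at h
  have e2 : ∫ p, (η p * v p + u p * fieldDeriv i η p) * G p
      = (∫ p, v p * (η p * G p)) + ∫ p, u p * (fieldDeriv i η p * G p) := by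
    rw [← integral_add i3 i1]
    exact integral_congr_ae (ae_of_all _ fun p => by ring)
  rw [e2]; linarith

/-- The gradient of the product with a cutoff function. -/
def cutoffGrad (η u : Heis n → ℝ) (v : Fin n ⊕ Fin n → Heis n → ℝ) (i : Fin n ⊕ Fin n)
    (p : Heis n) : ℝ := η p * v i p + u p * fieldDeriv i η p

lemma integrable_cutoffGrad_mul {u η G : Heis n → ℝ} {v : Fin n ⊕ Fin n → Heis n → ℝ}
    (hu : L2Loc u) (i : Fin n ⊕ Fin n)
    (hv : IsWeakDeriv i u (v i)) (hη : IsTest η) (hG : Continuous G) :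
    Integrable fun p => cutoffGrad η u v i p * G p := by
  have hη' : Continuous (fieldDeriv i η) := (contDiff_fieldDeriv i hη.smooth).continuous
  have i1 : Integrable fun p => u p * (fieldDeriv i η p * G p) :=
    hu.integrable_mul (hη'.mul hG) (hasCompactSupport_fieldDeriv i hη.compact).mul_right
      ((closure_mono fun p hp => by
        rw [Function.mem_support] at hp ⊢
        exact left_ne_zero_of_mul hp).trans ((tsupport_fieldDeriv_subset i η).trans hη.support))
  have i3 : Integrable fun p => v i p * (η p * G p) :=
    hv.1.integrable_mul (hη.smooth.continuous.mul hG) hη.compact.mul_right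
      ((closure_mono fun p hp => by
        rw [Function.mem_support] at hp ⊢
        exact left_ne_zero_of_mul hp).trans hη.support)
  exact (i3.add i1).congr (ae_of_all _ fun p => by simp only [cutoffGrad, Pi.add_apply]; ring)

/-- The representation formula. -/
lemma integral_cutoff_mul_massReg {u η : Heis n → ℝ} {v : Fin n ⊕ Fin n → Heis n → ℝ}
    (hu : L2Loc u) (hv : ∀ i, IsWeakDeriv i u (v i)) (hη : IsTest η) {s : ℝ} (hs : 0 < s)
    (x : Heis n) :
    ∫ y, η y * u y * massReg s (hmul (-x) y)
      = ∫ y, ∑ i, cutoffGrad η u v i y * fieldDeriv i (greenReg s) (hmul (-x) y) := by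
  have hG : ContDiff ℝ ∞ (greenReg s : Heis n → ℝ) := contDiff_greenReg hs
  have hG1 : ∀ i, ContDiff ℝ ∞ fun y => fieldDeriv i (greenReg s) (hmul (-x) y) := fun i =>
    (contDiff_fieldDeriv i hG).comp (contDiff_hmul (-x))
  -- By left invariance the derivatives of the translate of `G_s` are the translates of its
  -- derivatives, so the sublaplacian of the translate is the translate of `-massReg s`.
  have e1 : ∀ i y, fieldDeriv i (fun y => fieldDeriv i (greenReg s) (hmul (-x) y)) y
      = fieldDeriv i (fieldDeriv i (greenReg s)) (hmul (-x) y) := fun i y =>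
    fieldDeriv_comp_hmul i ((contDiff_fieldDeriv i hG).differentiable (by simp)) (-x) y
  have e2 : ∀ y, η y * u y * massReg s (hmul (-x) y) = -∑ i, η y * u y *
      fieldDeriv i (fun y => fieldDeriv i (greenReg s) (hmul (-x) y)) y := fun y => by
    simp only [e1]
    rw [← Finset.mul_sum, sum_fieldDeriv_fieldDeriv_greenReg hs]; ring
  simp only [e2]
  rw [integral_neg, integral_finsetSum, integral_finsetSum]
  · rw [← Finset.sum_neg_distrib]
    refine Finset.sum_congr rfl fun i _ => ?_
    rw [integral_cutoff_mul_fieldDeriv hu (hv i) hη (hG1 i), neg_neg]; rfl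
  · exact fun i _ => integrable_cutoffGrad_mul hu i (hv i) hη (hG1 i).continuous
  · intro i _
    have hG' : Continuous (fieldDeriv i fun y => fieldDeriv i (greenReg s) (hmul (-x) y)) :=
      (contDiff_fieldDeriv i (hG1 i)).continuous
    have := hu.integrable_mul (hη.smooth.continuous.mul hG') hη.compact.mul_right
      ((closure_mono fun p hp => by
        rw [Function.mem_support] at hp ⊢
        exact left_ne_zero_of_mul hp).trans hη.support)
    exact this.congr (ae_of_all _ fun p => by simp only [Pi.mul_apply]; ring)

/-- The homeomorphism of a left translation. -/
def hmulHomeo (x : Heis n) : Heis n ≃ₜ Heis n where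
  toFun := hmul x
  invFun := hmul (-x)
  left_inv w := hmul_neg_cancel_left x w
  right_inv w := by simpa using hmul_neg_cancel_left (-x) w
  continuous_toFun := continuous_hmul.comp (Continuous.prodMk_right x)
  continuous_invFun := continuous_hmul.comp (Continuous.prodMk_right (-x))

lemma measurableEmbedding_hmul (x : Heis n) : MeasurableEmbedding (hmul x) :=
  (hmulHomeo x).measurableEmbedding

/-- The substitution `y = x · δ_s(w)` exhibits the convolution as an average of right translates of
`g` by small elements, with the fixed weight `massReg 1`. -/
lemma integral_mul_massReg_eq (g : Heis n → ℝ) {s : ℝ} (hs : 0 < s) (x : Heis n) :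
    ∫ y, g y * massReg s (hmul (-x) y) = ∫ w, g (hmul x (dil s w)) * massReg 1 w := by
  rw [← (measurePreserving_hmul_left x).integral_comp (measurableEmbedding_hmul x),
    integral_eq_dil hs, ← integral_const_mul]
  refine integral_congr_ae (ae_of_all _ fun w => ?_)
  dsimp only
  rw [hmul_neg_cancel_left, ← massReg_dil hs]; ring

/-- The convolutions with the regularized masses converge in `L¹`. -/
lemma tendsto_lintegral_convolution_sub {g : Heis n → ℝ} (hg : Measurable g) (hi : Integrable g)
    {s : ℕ → ℝ} (hs : ∀ j, 0 < s j) (hs0 : Tendsto s atTop (𝓝 0)) :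
    Tendsto (fun j => ∫⁻ x, ‖(∫ y, g y * massReg (s j) (hmul (-x) y))
      - (∫ p : Heis n, massReg 1 p) * g x‖ₑ) atTop (𝓝 0) := by
  have hm1 : Measurable fun w : Heis n => ENNReal.ofReal (massReg 1 w) :=
    (continuous_massReg one_pos).measurable.ennreal_ofReal
  -- By Tonelli the `L¹` distance is at most the average of the distances between `g` and its
  -- translates by `δ_s(w)`. These tend to zero for each `w` and are bounded by `2 ‖g‖₁`, so
  -- dominated convergence concludes.
  have hbound : ∀ j, ∫⁻ x, ‖(∫ y, g y * massReg (s j) (hmul (-x) y))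
      - (∫ p : Heis n, massReg 1 p) * g x‖ₑ
        ≤ ∫⁻ w, transDist g (dil (s j) w) * ENNReal.ofReal (massReg 1 w) := by
    intro j
    have hjm : Measurable fun q : Heis n × Heis n =>
        ‖g (hmul q.1 (dil (s j) q.2)) - g q.1‖ₑ * ENNReal.ofReal (massReg 1 q.2) := by
      refine Measurable.mul (Measurable.enorm (Measurable.sub (hg.comp ?_) (hg.comp measurable_fst)))
        (hm1.comp measurable_snd)
      exact (continuous_hmul.comp (continuous_fst.prodMk
        ((continuous_dil (s j)).comp continuous_snd))).measurable
    calc _ ≤ ∫⁻ x, ∫⁻ w, ‖g (hmul x (dil (s j) w)) - g x‖ₑ * ENNReal.ofReal (massReg 1 w) := by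
          refine lintegral_mono_ae ?_
          -- Writing the difference under one integral sign requires integrability in `w`, which
          -- Tonelli provides for almost every `x`.
          have hfin : ∀ᵐ x : Heis n, Integrable fun w => g (hmul x (dil (s j) w)) * massReg 1 w := by
            have hmm : Measurable fun q : Heis n × Heis n =>
                ‖g (hmul q.1 (dil (s j) q.2))‖ₑ * ENNReal.ofReal (massReg 1 q.2) := by
              refine Measurable.mul (Measurable.enorm (hg.comp ?_)) (hm1.comp measurable_snd)
              exact (continuous_hmul.comp (continuous_fst.prodMk
                ((continuous_dil (s j)).comp continuous_snd))).measurable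
            have h1 : ∫⁻ x, ∫⁻ w, ‖g (hmul x (dil (s j) w))‖ₑ * ENNReal.ofReal (massReg 1 w) ≠ ⊤ := by
              rw [lintegral_lintegral_swap hmm.aemeasurable]
              have : ∀ w, ∫⁻ x, ‖g (hmul x (dil (s j) w))‖ₑ * ENNReal.ofReal (massReg 1 w)
                  = (∫⁻ x, ‖g x‖ₑ) * ENNReal.ofReal (massReg 1 w) := fun w => by
                rw [lintegral_mul_const' _ _ ENNReal.ofReal_ne_top,
                  (measurePreserving_hmul_right (dil (s j) w)).lintegral_comp
                    (f := fun x => ‖g x‖ₑ) hg.enorm]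
              simp only [this]
              rw [lintegral_const_mul _ hm1]
              refine ENNReal.mul_ne_top hi.2.ne ?_
              rw [← ofReal_integral_eq_lintegral_ofReal integrable_massReg
                (ae_of_all _ (massReg_nonneg one_pos))]
              exact ENNReal.ofReal_ne_top
            filter_upwards [ae_lt_top hmm.lintegral_prod_right' h1] with x hx
            refine ⟨((hg.comp ((continuous_hmul.comp (Continuous.prodMk_right x)).comp
              (continuous_dil (s j))).measurable).mul
              (continuous_massReg one_pos).measurable).aestronglyMeasurable, ?_⟩
            refine lt_of_le_of_lt (le_of_eq (lintegral_congr fun w => ?_)) hx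
            rw [enorm_mul, Real.enorm_of_nonneg (massReg_nonneg one_pos w)]
          filter_upwards [hfin] with x hx
          rw [integral_mul_massReg_eq g (hs j), mul_comm (∫ p : Heis n, massReg 1 p),
            ← integral_const_mul, ← integral_sub hx (integrable_massReg.const_mul _)]
          refine (enorm_integral_le_lintegral_enorm _).trans (le_of_eq (lintegral_congr fun w => ?_))
          rw [← sub_mul, enorm_mul, Real.enorm_of_nonneg (massReg_nonneg one_pos w)]
      _ = ∫⁻ w, ∫⁻ x, ‖g (hmul x (dil (s j) w)) - g x‖ₑ * ENNReal.ofReal (massReg 1 w) :=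
          lintegral_lintegral_swap hjm.aemeasurable
      _ = _ := by
          refine lintegral_congr fun w => ?_
          rw [lintegral_mul_const' _ _ ENNReal.ofReal_ne_top]; rfl
  refine tendsto_of_tendsto_of_tendsto_of_le_of_le tendsto_const_nhds ?_ (fun _ => zero_le) hbound
  have key : Tendsto (fun j => ∫⁻ w, transDist g (dil (s j) w) * ENNReal.ofReal (massReg 1 w)) atTop
      (𝓝 (∫⁻ _w : Heis n, 0)) := by
    refine tendsto_lintegral_of_dominated_convergence
      (fun w => (2 * ∫⁻ x, ‖g x‖ₑ) * ENNReal.ofReal (massReg 1 w)) ?_ ?_ ?_ ?_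
    · exact fun j => ((measurable_transDist hg).comp (continuous_dil (s j)).measurable).mul hm1
    · exact fun j => ae_of_all _ fun w => mul_le_mul' (transDist_le hg _) le_rfl
    · rw [lintegral_const_mul _ hm1, ← ofReal_integral_eq_lintegral_ofReal integrable_massReg
        (ae_of_all _ (massReg_nonneg one_pos))]
      exact ENNReal.mul_ne_top (ENNReal.mul_ne_top (by norm_num) hi.2.ne) ENNReal.ofReal_ne_top
    · refine ae_of_all _ fun w => ?_
      have h1 : Tendsto (fun j => dil (s j) w) atTop (𝓝 0) := by
        have hc : Continuous fun r : ℝ => dil r w := by unfold dil; fun_prop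
        have := (hc.tendsto 0).comp hs0
        have h0 : dil 0 w = 0 := by ext <;> simp [dil]
        rwa [h0] at this
      have h2 := ENNReal.Tendsto.mul_const ((tendsto_transDist hg hi).comp h1)
        (Or.inr (ENNReal.ofReal_ne_top (r := massReg 1 w)))
      simpa using h2
  simpa using key

end Sobolev

/-! ### The Sobolev inequality obtained by letting the regularization tend to zero -/

section Sobolev

variable {n : ℕ}

/-- The pointwise bound of the regularizations by a fractional integral of the gradient. -/
lemma ofReal_abs_integral_cutoff_le {u η f : Heis n → ℝ} {v : Fin n ⊕ Fin n → Heis n → ℝ}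
    (hu : L2Loc u) (hv : ∀ i, IsWeakDeriv i u (v i)) (hη : IsTest η)
    (hf : f =ᵐ[volume] fun p => 2 * n * ∑ i, |cutoffGrad η u v i p|) {s : ℝ} (hs : 0 < s)
    (x : Heis n) :
    ENNReal.ofReal |∫ y, η y * u y * massReg s (hmul (-x) y)|
      ≤ ∫⁻ w, ENNReal.ofReal (f (hmul x w)) * rieszKernel w := by
  have h0 : ∀ᵐ y : Heis n, hmul (-x) y ≠ 0 :=
    (measurePreserving_hmul_left (-x)).quasiMeasurePreserving.ae ae_ne_zero
  have e := (measurePreserving_hmul_left x).lintegral_comp_emb (measurableEmbedding_hmul x)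
    (fun y => ENNReal.ofReal (f y) * rieszKernel (hmul (-x) y))
  simp only [hmul_neg_cancel_left] at e
  rw [e, integral_cutoff_mul_massReg hu hv hη hs x, ← Real.norm_eq_abs, ofReal_norm]
  refine (enorm_integral_le_lintegral_enorm _).trans (lintegral_mono_ae ?_)
  filter_upwards [h0, hf] with y hy hfy
  rw [hfy, rieszKernel, ← ENNReal.ofReal_mul (by positivity), ← ofReal_norm]
  refine ENNReal.ofReal_le_ofReal ?_
  calc ‖∑ i, cutoffGrad η u v i y * fieldDeriv i (greenReg s) (hmul (-x) y)‖
      ≤ ∑ i, ‖cutoffGrad η u v i y * fieldDeriv i (greenReg s) (hmul (-x) y)‖ := norm_sum_le _ _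
    _ ≤ ∑ i, |cutoffGrad η u v i y| * (2 * n * (homNorm (hmul (-x) y) ^ (2 * n + 1))⁻¹) := by
        refine Finset.sum_le_sum fun i _ => ?_
        rw [norm_mul]
        exact mul_le_mul_of_nonneg_left (abs_fieldDeriv_greenReg_le_homNorm i hs hy) (norm_nonneg _)
    _ = _ := by rw [← Finset.sum_mul]; ring

lemma integrable_cutoff_mul {u η : Heis n → ℝ} (hu : L2Loc u) (hη : IsTest η) :
    Integrable fun p => η p * u p :=
  (hη.integrable_right hu).congr (ae_of_all _ fun p => by ring)

/-- The Sobolev inequality for the product of a function with a cutoff function. -/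
theorem exists_sobolev_cutoff (hn : 1 ≤ n) : ∃ C : ℝ, 0 < C ∧
    ∀ (u η : Heis n → ℝ) (v : Fin n ⊕ Fin n → Heis n → ℝ), Measurable u → L2Loc u →
      (∀ i, IsWeakDeriv i u (v i)) → IsTest η → ∀ B : ℝ, 0 < B →
      ∫⁻ p, ENNReal.ofReal ((∑ i, |cutoffGrad η u v i p|) ^ 2) ≤ ENNReal.ofReal B →
      ∫⁻ p, ENNReal.ofReal (|η p * u p| ^ (2 + 2 / (n : ℝ)))
        ≤ ENNReal.ofReal (C * B ^ (1 + 1 / (n : ℝ))) := by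
  obtain ⟨C₁, hC₁, hls⟩ := exists_lintegral_rpow_le_of_le_lintegral hn
  set A : ℝ := ∫ p : Heis n, massReg 1 p with hA
  have hA0 : 0 < A := integral_massReg_pos hn
  have hn0 : (0 : ℝ) < n := by exact_mod_cast hn
  set q : ℝ := 2 + 2 / (n : ℝ) with hq
  set a : ℝ := 1 + 1 / (n : ℝ) with ha
  have hq0 : 0 < q := by positivity
  refine ⟨(A ^ q)⁻¹ * (C₁ * (4 * n ^ 2) ^ a), by positivity, ?_⟩
  intro u η v hum hu hv hη B hB hgrad
  set g : Heis n → ℝ := fun p => η p * u p with hg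
  have hgm : Measurable g := hη.smooth.continuous.measurable.mul hum
  have hgi : Integrable g := integrable_cutoff_mul hu hη
  set f₀ : Heis n → ℝ := fun p => 2 * n * ∑ i, |cutoffGrad η u v i p| with hf₀
  have hf₀m : AEMeasurable f₀ volume := by
    refine AEMeasurable.const_mul (Finset.aemeasurable_fun_sum _ fun i _ => ?_) _
    have h1 := integrable_cutoffGrad_mul hu i (hv i) hη (continuous_const (y := (1 : ℝ)))
    simp only [mul_one] at h1
    exact h1.abs.1.aemeasurable
  -- The fractional integral estimate wants a function that is measurable and nonnegative
  -- everywhere; the absolute value of a measurable representative is one, and it still agrees with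
  -- `f₀` almost everywhere.
  set f : Heis n → ℝ := fun p => |hf₀m.mk f₀ p| with hf
  have hfm : Measurable f := hf₀m.measurable_mk.abs
  have hff₀ : f =ᵐ[volume] f₀ := by
    filter_upwards [hf₀m.ae_eq_mk] with p hp
    change |hf₀m.mk f₀ p| = f₀ p
    rw [← hp, abs_of_nonneg]
    exact mul_nonneg (by positivity) (Finset.sum_nonneg fun _ _ => abs_nonneg _)
  set h : ℝ → Heis n → ℝ := fun s x => |∫ y, g y * massReg s (hmul (-x) y)| with hh
  have hconvm : ∀ s, 0 < s → Measurable fun x => ∫ y, g y * massReg s (hmul (-x) y) := by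
    intro s hs
    have : Measurable fun z : Heis n × Heis n => g z.2 * massReg s (hmul (-z.1) z.2) :=
      (hgm.comp measurable_snd).mul ((continuous_massReg hs).comp (continuous_hmul.comp
        (continuous_fst.neg.prodMk continuous_snd))).measurable
    exact this.stronglyMeasurable.integral_prod_right'.measurable
  have hfB : ∫⁻ p, ENNReal.ofReal (f p ^ 2) ≤ ENNReal.ofReal (4 * n ^ 2 * B) := by
    calc ∫⁻ p, ENNReal.ofReal (f p ^ 2)
        = ∫⁻ p, ENNReal.ofReal (4 * n ^ 2) *
            ENNReal.ofReal ((∑ i, |cutoffGrad η u v i p|) ^ 2) := by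
          refine lintegral_congr_ae ?_
          filter_upwards [hff₀] with p hp
          rw [hp, hf₀, ← ENNReal.ofReal_mul (by positivity)]
          congr 1; ring
      _ ≤ _ := by
          rw [lintegral_const_mul' _ _ ENNReal.ofReal_ne_top,
            ENNReal.ofReal_mul (p := 4 * (n : ℝ) ^ 2) (by positivity)]
          exact mul_le_mul' le_rfl hgrad
  have hhB : ∀ s, 0 < s → ∫⁻ x, ENNReal.ofReal (h s x ^ q)
      ≤ ENNReal.ofReal (C₁ * (4 * n ^ 2 * B) ^ a) := fun s hs =>
    hls f (h s) hfm (fun _ => abs_nonneg _) (hconvm s hs).abs (fun _ => abs_nonneg _)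
      (fun x => ofReal_abs_integral_cutoff_le hu hv hη hff₀ hs x) _ (by positivity) hfB
  have hsj : ∀ j : ℕ, (0 : ℝ) < 1 / ((j : ℝ) + 1) := fun j => Nat.one_div_pos_of_nat
  have hL1 := tendsto_lintegral_convolution_sub hgm hgi hsj tendsto_one_div_add_atTop_nhds_zero_nat
  -- Convergence in `L¹` is used only to extract a subsequence converging almost everywhere, along
  -- which Fatou's lemma transports the uniform `L^{2*}` bound.
  have hmeas : TendstoInMeasure volume
      (fun (j : ℕ) x => ∫ y, g y * massReg (1 / ((j : ℝ) + 1)) (hmul (-x) y)) atTop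
      (fun x => A * g x) := by
    refine tendstoInMeasure_of_tendsto_eLpNorm one_ne_zero
      (fun j => (hconvm _ (hsj j)).aestronglyMeasurable)
      (hgm.const_mul A).aestronglyMeasurable ?_
    simp only [eLpNorm_one_eq_lintegral_enorm]
    exact hL1
  obtain ⟨ns, -, hns⟩ := hmeas.exists_seq_tendsto_ae
  have hfatou : ∫⁻ x, ENNReal.ofReal ((A * |g x|) ^ q)
      ≤ ENNReal.ofReal (C₁ * (4 * n ^ 2 * B) ^ a) := by
    calc ∫⁻ x, ENNReal.ofReal ((A * |g x|) ^ q)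
        = ∫⁻ x, liminf (fun j => ENNReal.ofReal (h (1 / ((ns j : ℝ) + 1)) x ^ q)) atTop := by
          refine lintegral_congr_ae ?_
          filter_upwards [hns] with x hx
          have h1 : Tendsto (fun j => h (1 / ((ns j : ℝ) + 1)) x) atTop (𝓝 (A * |g x|)) := by
            have := hx.abs
            rwa [abs_mul, abs_of_pos hA0] at this
          have h2 : Continuous fun y : ℝ => ENNReal.ofReal (y ^ q) :=
            ENNReal.continuous_ofReal.comp (Real.continuous_rpow_const hq0.le)
          exact (((h2.tendsto _).comp h1).liminf_eq).symm
      _ ≤ liminf (fun j => ∫⁻ x, ENNReal.ofReal (h (1 / ((ns j : ℝ) + 1)) x ^ q)) atTop :=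
          lintegral_liminf_le fun j => ((hconvm _ (hsj (ns j))).abs.pow_const q).ennreal_ofReal
      _ ≤ liminf (fun _ : ℕ => ENNReal.ofReal (C₁ * (4 * n ^ 2 * B) ^ a)) atTop :=
          liminf_le_liminf (Eventually.of_forall fun j => hhB _ (hsj (ns j)))
      _ = _ := liminf_const _
  have e : ∀ x, ENNReal.ofReal (|g x| ^ q)
      = ENNReal.ofReal (A ^ q)⁻¹ * ENNReal.ofReal ((A * |g x|) ^ q) := fun x => by
    rw [← ENNReal.ofReal_mul (by positivity), Real.mul_rpow hA0.le (abs_nonneg _), ← mul_assoc,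
      inv_mul_cancel₀ (by positivity), one_mul]
  calc ∫⁻ p, ENNReal.ofReal (|η p * u p| ^ q)
      = ENNReal.ofReal (A ^ q)⁻¹ * ∫⁻ x, ENNReal.ofReal ((A * |g x|) ^ q) := by
        rw [← lintegral_const_mul' _ _ ENNReal.ofReal_ne_top]
        exact lintegral_congr e
    _ ≤ ENNReal.ofReal (A ^ q)⁻¹ * ENNReal.ofReal (C₁ * (4 * n ^ 2 * B) ^ a) :=
        mul_le_mul' le_rfl hfatou
    _ = _ := by
        rw [← ENNReal.ofReal_mul (by positivity), Real.mul_rpow (by positivity) hB.le]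
        congr 1; ring

end Sobolev

/-! ### Logarithmic cutoff functions -/

section Cutoff

variable {n : ℕ}

/-- A smooth bump on the line, equal to `1` on `[-1, 1]` and to `0` outside `(-2, 2)`. -/
def lineBump : ContDiffBump (0 : ℝ) := ⟨1, 2, one_pos, one_lt_two⟩

lemma exists_abs_deriv_lineBump_le : ∃ M : ℝ, 0 < M ∧ ∀ x, |deriv lineBump x| ≤ M := by
  have hc : Continuous (deriv lineBump) :=
    (lineBump.contDiff (n := 1)).continuous_deriv le_rfl
  have hs : HasCompactSupport (deriv lineBump) := lineBump.hasCompactSupport.deriv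
  obtain ⟨M, hM⟩ := hc.bounded_above_of_compact_support hs
  exact ⟨max M 1, by positivity, fun x => (hM x).trans (le_max_left _ _)⟩

/-- The cutoff function equal to `1` where `|log |p|⁴| ≤ S` and to `0` where `|log |p|⁴| ≥ 2S`. -/
def logCutoff (S : ℝ) (p : Heis n) : ℝ :=
  open Classical in if p = 0 then 0 else lineBump (Real.log (quart 0 p) / S)

lemma logCutoff_eventuallyEq (S : ℝ) {p : Heis n} (hp : p ≠ 0) :
    logCutoff S =ᶠ[𝓝 p] fun p => lineBump (Real.log (quart 0 p) / S) := by
  filter_upwards [isOpen_compl_singleton.mem_nhds hp] with x hx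
  exact if_neg hx

lemma quart_zero_pos {p : Heis n} (hp : p ≠ 0) : 0 < quart 0 p := by
  rw [quart_zero]; exact pow_pos (homNorm_pos hp) 4

lemma log_quart_zero (p : Heis n) : Real.log (quart 0 p) = 4 * Real.log (homNorm p) := by
  rw [quart_zero, Real.log_pow]; norm_num

lemma logCutoff_eq_zero {S : ℝ} (hS : 0 < S) {p : Heis n}
    (h : 2 * S ≤ 4 * |Real.log (homNorm p)|) : logCutoff S p = 0 := by
  unfold logCutoff
  split_ifs with hp
  · rfl
  · refine lineBump.zero_of_le_dist ?_
    rw [Real.dist_eq, sub_zero, abs_div, abs_of_pos hS, log_quart_zero, abs_mul,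
      abs_of_pos (by norm_num : (0 : ℝ) < 4), le_div_iff₀ hS]
    exact h

lemma logCutoff_eq_one {S : ℝ} (hS : 0 < S) {p : Heis n} (hp : p ≠ 0)
    (h : 4 * |Real.log (homNorm p)| ≤ S) : logCutoff S p = 1 := by
  unfold logCutoff
  rw [if_neg hp]
  refine lineBump.one_of_mem_closedBall ?_
  rw [Metric.mem_closedBall, Real.dist_eq, sub_zero, abs_div, abs_of_pos hS, log_quart_zero, abs_mul,
    abs_of_pos (by norm_num : (0 : ℝ) < 4), div_le_iff₀ hS]
  change _ ≤ (1 : ℝ) * S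
  linarith

lemma logCutoff_mem_Icc (S : ℝ) (p : Heis n) : 0 ≤ logCutoff S p ∧ logCutoff S p ≤ 1 := by
  unfold logCutoff
  split_ifs
  · exact ⟨le_rfl, zero_le_one⟩
  · exact ⟨lineBump.nonneg, lineBump.le_one⟩

lemma isCompact_homNorm_Icc {a b : ℝ} (ha : 0 < a) :
    IsCompact {p : Heis n | a ≤ homNorm p ∧ homNorm p ≤ b} := by
  have h := (isCompact_annulus n (b / a)).image (continuous_dil (n := n) a)
  refine h.of_isClosed_subset ((isClosed_le continuous_const continuous_homNorm).inter
      (isClosed_le continuous_homNorm continuous_const)) ?_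
  rintro p ⟨h1, h2⟩
  refine ⟨dil a⁻¹ p, ?_, by rw [dil_dil, mul_inv_cancel₀ ha.ne', dil_one]⟩
  change 1 ≤ homNorm (dil a⁻¹ p) ∧ homNorm (dil a⁻¹ p) ≤ b / a
  rw [homNorm_dil (by positivity), inv_mul_eq_div]
  exact ⟨(one_le_div₀ ha).2 h1, by gcongr⟩

lemma support_logCutoff_subset {S : ℝ} (hS : 0 < S) :
    Function.support (logCutoff S : Heis n → ℝ) ⊆
      {p | Real.exp (-(S / 2)) ≤ homNorm p ∧ homNorm p ≤ Real.exp (S / 2)} := by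
  intro p hp
  have hp0 : p ≠ 0 := fun h => hp (by simp [logCutoff, h])
  have h1 : |Real.log (homNorm p)| < S / 2 := by
    by_contra h
    exact hp (logCutoff_eq_zero hS (by linarith [not_lt.1 h]))
  have h := homNorm_pos hp0
  rw [abs_lt] at h1
  exact ⟨(Real.le_log_iff_exp_le h).1 h1.1.le, (Real.log_le_iff_le_exp h).1 h1.2.le⟩

lemma tsupport_logCutoff_subset {S : ℝ} (hS : 0 < S) :
    tsupport (logCutoff S : Heis n → ℝ) ⊆
      {p | Real.exp (-(S / 2)) ≤ homNorm p ∧ homNorm p ≤ Real.exp (S / 2)} :=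
  closure_minimal (support_logCutoff_subset hS)
    ((isClosed_le continuous_const continuous_homNorm).inter
      (isClosed_le continuous_homNorm continuous_const))

lemma isTest_logCutoff {S : ℝ} (hS : 0 < S) : IsTest (logCutoff S : Heis n → ℝ) := by
  have hsub := tsupport_logCutoff_subset (n := n) hS
  have h0 : tsupport (logCutoff S : Heis n → ℝ) ⊆ {0}ᶜ := by
    rintro p hp rfl
    have h1 := (hsub hp).1
    rw [homNorm_zero] at h1
    exact absurd h1 (not_le.2 (Real.exp_pos _))
  refine ⟨?_, (isCompact_homNorm_Icc (Real.exp_pos _)).of_isClosed_subset (isClosed_tsupport _)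
    hsub, h0⟩
  rw [contDiff_iff_contDiffAt]
  intro p
  by_cases hp : p = 0
  · have : p ∉ tsupport (logCutoff S : Heis n → ℝ) := fun h => h0 h hp
    have he : logCutoff S =ᶠ[𝓝 p] fun _ => (0 : ℝ) := notMem_tsupport_iff_eventuallyEq.1 this
    exact contDiffAt_const.congr_of_eventuallyEq he
  · refine ContDiffAt.congr_of_eventuallyEq ?_ (logCutoff_eventuallyEq S hp)
    have h1 : ContDiffAt ℝ ∞ (fun p : Heis n => Real.log (quart 0 p) / S) p :=
      ((contDiff_quart 0).contDiffAt.log (quart_zero_pos hp).ne').div_const S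
    exact lineBump.contDiff.contDiffAt.comp p h1

lemma fieldDeriv_logCutoff (i : Fin n ⊕ Fin n) {S : ℝ} {p : Heis n} (hp : p ≠ 0) :
    fieldDeriv i (logCutoff S) p = deriv lineBump (Real.log (quart 0 p) / S) *
      ((quart 0 p)⁻¹ / S * fieldDeriv i (quart 0) p) := by
  have e : fieldDeriv i (logCutoff S) p
      = fieldDeriv i (fun p => lineBump (Real.log (quart 0 p) / S)) p := by
    simp only [fieldDeriv]; rw [(logCutoff_eventuallyEq S hp).fderiv_eq]
  have hq : DifferentiableAt ℝ (quart 0 : Heis n → ℝ) p := differentiable_quart 0 p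
  have h1 : DifferentiableAt ℝ (fun p : Heis n => Real.log (quart 0 p) / S) p :=
    (((contDiff_quart 0 (m := 1)).contDiffAt.log (quart_zero_pos hp).ne').div_const S).differentiableAt
      one_ne_zero
  have h2 : HasDerivAt lineBump (deriv lineBump (Real.log (quart 0 p) / S))
      (Real.log (quart 0 p) / S) :=
    ((lineBump.contDiff (n := 1)).differentiable one_ne_zero _).hasDerivAt
  rw [e, fieldDeriv_comp i h2 h1,
    fieldDeriv_comp i (h := fun x => Real.log x / S)
      ((Real.hasDerivAt_log (quart_zero_pos hp).ne').div_const S) hq]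

/-- The gradients of the logarithmic cutoff functions. -/
lemma exists_abs_fieldDeriv_logCutoff_le : ∃ M : ℝ, 0 < M ∧ ∀ (S : ℝ), 0 < S →
    ∀ (i : Fin n ⊕ Fin n) (p : Heis n), p ≠ 0 →
      |fieldDeriv i (logCutoff S) p| ≤ M / S * (homNorm p)⁻¹ := by
  obtain ⟨M, hM, hMb⟩ := exists_abs_deriv_lineBump_le
  refine ⟨4 * M, by positivity, fun S hS i p hp => ?_⟩
  have h := homNorm_pos hp
  have h1 := abs_fieldDeriv_quart_le i 0 p
  rw [quart_zero, show homNorm p ^ 4 = (homNorm p ^ 2) ^ 2 by ring,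
    Real.sqrt_sq (by positivity)] at h1
  rw [fieldDeriv_logCutoff i hp, abs_mul, abs_mul, abs_div, abs_inv, abs_of_pos hS,
    abs_of_pos (quart_zero_pos hp)]
  calc _ ≤ M * ((quart 0 p)⁻¹ / S * (4 * homNorm p ^ 2 * homNorm p)) := by
        have := quart_zero_pos hp
        gcongr
        exact hMb _
    _ = _ := by rw [quart_zero]; field_simp

end Cutoff

/-! ### Homogeneity of the elements of `X_T` and of their gradients -/

section Homogeneity

variable {n : ℕ} {T : ℝ} {hT : 1 < T}

lemma homDim_sub_two_div_two (n : ℕ) : (homDim n - 2) / 2 = n := by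
  unfold homDim; ring

lemma critExp_eq (hn : 1 ≤ n) : critExp n = 2 + 2 / (n : ℝ) := by
  have hn0 : (0 : ℝ) < n := by exact_mod_cast hn
  unfold critExp homDim
  rw [show 2 * (n : ℝ) + 2 - 2 = 2 * n by ring]
  field_simp

lemma X.measurable_toFun (u : X n T hT) : Measurable u.toFun :=
  (AEEqFun.stronglyMeasurable u.1).measurable

lemma X.l2Loc_toFun (u : X n T hT) : L2Loc u.toFun := u.2.1.1

lemma X.toFun_dil (u : X n T hT) : ∀ᵐ p, u.toFun (dil T p) = (T ^ n)⁻¹ * u.toFun p := by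
  have h := u.2.2
  rw [homDim_sub_two_div_two, Real.rpow_neg (by linarith), Real.rpow_natCast] at h
  exact h

lemma dil_ne_zero {r : ℝ} (hr : r ≠ 0) {p : Heis n} (hp : p ≠ 0) : dil r p ≠ 0 := fun h => by
  have := congrArg (dil r⁻¹) h
  rw [dil_dil, inv_mul_cancel₀ hr, dil_one] at this
  exact hp (this.trans (by ext <;> simp [dil]))

lemma L2Loc.comp_dil {u : Heis n → ℝ} (hu : L2Loc u) {r : ℝ} (hr : 0 < r) :
    L2Loc fun p => u (dil r p) := by
  intro K hK h0
  have hm := measurableEmbedding_dil (n := n) hr.ne'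
  have h1 := hu (dil r '' K) (hK.image (continuous_dil r)) (by
    rintro _ ⟨p, hp, rfl⟩
    exact dil_ne_zero hr.ne' (h0 hp))
  have h2 : Measure.map (dil r) (volume.restrict K)
      = ENNReal.ofReal ((r ^ (2 * n + 2))⁻¹) • volume.restrict (dil r '' K) := by
    rw [← Measure.restrict_smul, ← map_dil hr, hm.restrict_map,
      Set.preimage_image_eq _ hm.injective]
  have h3 : MemLp u 2 (Measure.map (dil r) (volume.restrict K)) := by
    rw [h2]; exact h1.smul_measure ENNReal.ofReal_ne_top
  exact (hm.memLp_map_measure_iff).1 h3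

lemma IsTest.comp_dil {φ : Heis n → ℝ} (hφ : IsTest φ) {r : ℝ} (hr : 0 < r) :
    IsTest fun p => φ (dil r p) := by
  have e : (fun p => φ (dil r p)) = φ ∘ dilHomeo n hr.ne' := rfl
  refine ⟨?_, ?_, ?_⟩
  · have : ContDiff ℝ ∞ (dil r : Heis n → Heis n) := by
      rw [← coe_dilL]; exact (dilL n r).contDiff
    exact hφ.smooth.comp this
  · rw [e]; exact hφ.compact.comp_homeomorph _
  · rw [e, tsupport_comp_eq_preimage]
    intro p hp h0
    refine hφ.support hp ?_
    rw [Set.mem_singleton_iff.1 h0]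
    ext <;> simp [dilHomeo, dil]

lemma IsWeakDeriv.comp_dil {i : Fin n ⊕ Fin n} {u v : Heis n → ℝ} (h : IsWeakDeriv i u v) {r : ℝ}
    (hr : 0 < r) : IsWeakDeriv i (fun p => u (dil r p)) (fun p => r * v (dil r p)) := by
  refine ⟨(h.1.comp_dil hr).const_mul r, fun φ hφ => ?_⟩
  set φ' : Heis n → ℝ := fun p => φ (dil r⁻¹ p) with hφ'
  have hφ't : IsTest φ' := hφ.comp_dil (inv_pos.2 hr)
  have e0 : ∀ p : Heis n, dil r⁻¹ (dil r p) = p := fun p => by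
    rw [dil_dil, inv_mul_cancel₀ hr.ne', dil_one]
  have e1 : ∀ p, fieldDeriv i φ p = r * fieldDeriv i φ' (dil r p) := fun p => by
    rw [hφ', fieldDeriv_comp_dil i (hφ.smooth.differentiable (by simp) _), e0, ← mul_assoc,
      mul_inv_cancel₀ hr.ne', one_mul]
  have h1 := h.2 φ' hφ't
  rw [integral_eq_dil hr, integral_eq_dil hr (fun p => v p * φ' p), ← mul_neg] at h1
  have h2 := mul_left_cancel₀ (pow_ne_zero _ hr.ne') h1
  calc ∫ p, u (dil r p) * fieldDeriv i φ p
      = ∫ p, r * (u (dil r p) * fieldDeriv i φ' (dil r p)) :=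
        integral_congr_ae (ae_of_all _ fun p => by dsimp only; rw [e1]; ring)
    _ = -(r * ∫ p, v (dil r p) * φ' (dil r p)) := by rw [integral_const_mul, h2, mul_neg]
    _ = _ := by
        rw [← integral_const_mul]
        congr 1
        exact integral_congr_ae (ae_of_all _ fun p => by simp only [hφ', e0]; ring)

/-- Since `T^n u ∘ δ_T = u`, and a horizontal derivative of `u ∘ δ_T` brings out one factor `T`,
uniqueness of weak derivatives gives the homogeneity one degree lower. -/
lemma X.grad_dil (u : X n T hT) (i : Fin n ⊕ Fin n) :
    ∀ᵐ p, u.grad i (dil T p) = (T ^ (n + 1))⁻¹ * u.grad i p := by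
  have h0 : 0 < T := by linarith
  have h1 := ((u.grad_spec i).comp_dil h0).const_mul (T ^ n)
  have h2 : (fun p => T ^ n * u.toFun (dil T p)) =ᵐ[volume] u.toFun := by
    filter_upwards [u.toFun_dil] with p hp
    rw [hp, ← mul_assoc, mul_inv_cancel₀ (by positivity), one_mul]
  filter_upwards [(h1.congr h2).unique (u.grad_spec i)] with p hp
  rw [← hp, pow_succ]; field_simp

/-- The gradient is only known to be locally `L²` away from the origin; measurability is glued over
countably many dyadic shells. -/
lemma X.aemeasurable_grad (u : X n T hT) (i : Fin n ⊕ Fin n) :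
    AEMeasurable (u.grad i) volume := by
  have h : ∀ k, AEMeasurable (u.grad i) (volume.restrict (shell n 2 k)) := fun k => by
    have hK : shell n 2 k ⊆ {p : Heis n | (2 : ℝ) ^ k ≤ homNorm p ∧ homNorm p ≤ 2 ^ (k + 1)} :=
      fun p hp => ⟨hp.1, hp.2.le⟩
    refine AEMeasurable.mono_set hK
      ((u.grad_spec i).1 _ (isCompact_homNorm_Icc (by positivity)) ?_).1.aemeasurable
    rintro p hp rfl
    have := hp.1
    rw [homNorm_zero] at this
    exact absurd this (not_le.2 (by positivity))
  have h2 : AEMeasurable (u.grad i) (volume.restrict (⋃ k, shell n 2 k)) :=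
    aemeasurable_iUnion_iff.2 h
  rw [iUnion_shell one_lt_two] at h2
  have : (volume : Measure (Heis n)).restrict {0}ᶜ = volume :=
    Measure.restrict_eq_self_of_ae_mem ae_ne_zero
  rwa [this] at h2

lemma X.norm_sq_eq (u : X n T hT) : ‖u‖ ^ 2 = ∫ p in annulus n T, ∑ i, u.grad i p ^ 2 := by
  rw [← real_inner_self_eq_norm_sq]
  change X.prod u u = _
  simp only [X.prod, sq]

lemma X.inner_eq (u v : X n T hT) : inner ℝ u v = ∫ p in annulus n T, ∑ i, u.grad i p * v.grad i p :=
  rfl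

lemma X.lintegral_grad_sq (u : X n T hT) :
    ∫⁻ p in annulus n T, ENNReal.ofReal (∑ i, u.grad i p ^ 2) = ENNReal.ofReal (‖u‖ ^ 2) := by
  rw [X.norm_sq_eq, ofReal_integral_eq_lintegral_ofReal]
  · refine integrable_finsetSum _ fun i _ => ?_
    have := u.integrable_grad_mul u i
    simp only [sq]
    exact this
  · exact ae_of_all _ fun p => Finset.sum_nonneg fun i _ => sq_nonneg _

lemma X.lintegral_sq_ne_top (u : X n T hT) :
    ∫⁻ p in annulus n T, ENNReal.ofReal (u.toFun p ^ 2) ≠ ⊤ := by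
  have h := (u.l2Loc_toFun _ (isCompact_annulus n T) (annulus_subset n T)).integrable_sq
  rw [← ofReal_integral_eq_lintegral_ofReal h (ae_of_all _ fun p => sq_nonneg _)]
  exact ENNReal.ofReal_ne_top

end Homogeneity

/-! ### The Sobolev inequality in `X_T`, uniformly for large `T` -/

section SobolevX

variable {n : ℕ} {T : ℝ} {hT : 1 < T}

/-- A set contained in five shells. -/
lemma setLIntegral_le_five_mul {T : ℝ} (hT : 1 < T) {F : Heis n → ℝ≥0∞}
    (hF : ∀ᵐ p, F (dil T p) = ENNReal.ofReal ((T ^ (2 * n + 2))⁻¹) * F p) :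
    ∫⁻ p in {p : Heis n | T ^ (-2 : ℤ) ≤ homNorm p ∧ homNorm p ≤ T ^ (2 : ℤ)}, F p
      ≤ 5 * ∫⁻ p in annulus n T, F p := by
  -- The shells of index `-2` to `1` miss only the outer sphere `|p| = T²`; the fifth shell is there
  -- to contain it.
  have hsub : {p : Heis n | T ^ (-2 : ℤ) ≤ homNorm p ∧ homNorm p ≤ T ^ (2 : ℤ)}
      ⊆ ⋃ k ∈ Finset.Icc (-2 : ℤ) 2, shell n T k := by
    rintro p ⟨h1, h2⟩
    have hp : 0 < homNorm p := lt_of_lt_of_le (zpow_pos (by linarith) _) h1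
    obtain ⟨k, hk1, hk2⟩ := exists_mem_Ico_zpow hp hT
    have a1 := (zpow_lt_zpow_iff_right₀ hT).1 (h1.trans_lt hk2)
    have a2 := (zpow_le_zpow_iff_right₀ hT).1 (hk1.trans h2)
    simp only [Set.mem_iUnion]
    exact ⟨k, Finset.mem_Icc.2 ⟨by omega, by omega⟩, hk1, hk2⟩
  calc _ ≤ ∫⁻ p in ⋃ k ∈ Finset.Icc (-2 : ℤ) 2, shell n T k, F p := lintegral_mono_set hsub
    _ = ∑ k ∈ Finset.Icc (-2 : ℤ) 2, ∫⁻ p in shell n T k, F p :=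
        lintegral_biUnion_finset (fun i _ j _ hij => pairwise_disjoint_shell hT hij)
          (fun k _ => measurableSet_shell T k) _
    _ = _ := by
        simp only [setLIntegral_shell_eq hT hF]
        rw [Finset.sum_const, nsmul_eq_mul, show (Finset.Icc (-2 : ℤ) 2).card = 5 from rfl]
        norm_num

lemma X.grad_sq_homog (u : X n T hT) : ∀ᵐ p, ENNReal.ofReal (∑ i, u.grad i (dil T p) ^ 2)
    = ENNReal.ofReal ((T ^ (2 * n + 2))⁻¹) * ENNReal.ofReal (∑ i, u.grad i p ^ 2) := by
  have h0 : 0 < T := by linarith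
  filter_upwards [ae_all_iff.2 fun i => u.grad_dil i] with p hp
  rw [← ENNReal.ofReal_mul (by positivity), Finset.mul_sum]
  congr 1
  refine Finset.sum_congr rfl fun i _ => ?_
  rw [hp i, mul_pow, inv_pow, ← pow_mul]
  congr 3; ring

lemma X.hardy_homog (u : X n T hT) :
    ∀ᵐ p, ENNReal.ofReal (u.toFun (dil T p) ^ 2 * (homNorm (dil T p) ^ 2)⁻¹)
      = ENNReal.ofReal ((T ^ (2 * n + 2))⁻¹) *
        ENNReal.ofReal (u.toFun p ^ 2 * (homNorm p ^ 2)⁻¹) := by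
  have h0 : 0 < T := by linarith
  filter_upwards [u.toFun_dil] with p hp
  rw [← ENNReal.ofReal_mul (by positivity), hp, homNorm_dil h0.le]
  congr 1
  rw [mul_pow, mul_pow, mul_inv, inv_pow, pow_add, mul_inv, ← pow_mul, mul_comm n 2]
  ring

/-- The gradient of the product of an element of `X_T` with the logarithmic cutoff function. -/
lemma X.lintegral_cutoffGrad_le (u : X n T hT) {M : ℝ} (hM : 0 < M)
    (hMb : ∀ (S : ℝ), 0 < S → ∀ (i : Fin n ⊕ Fin n) (p : Heis n), p ≠ 0 →
      |fieldDeriv i (logCutoff S) p| ≤ M / S * (homNorm p)⁻¹) :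
    ∫⁻ p, ENNReal.ofReal ((∑ i, |cutoffGrad (logCutoff (4 * Real.log T)) u.toFun u.grad i p|) ^ 2)
      ≤ ENNReal.ofReal (20 * n) * ENNReal.ofReal (‖u‖ ^ 2)
        + ENNReal.ofReal (40 * n ^ 2 * (M / (4 * Real.log T)) ^ 2) *
          ∫⁻ p in annulus n T, ENNReal.ofReal (u.toFun p ^ 2 * (homNorm p ^ 2)⁻¹) := by
  have h0 : 0 < T := by linarith
  have hlog : 0 < Real.log T := Real.log_pos hT
  -- As the cutoff is expressed through `log |p|⁴`, this value makes it equal to `1` for `T⁻¹ ≤ |p|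
  -- ≤ T` and supported in `T⁻² ≤ |p| ≤ T²`, while its gradient gains the factor `1 / log T`.
  set S := 4 * Real.log T with hS
  have hS0 : 0 < S := by positivity
  set η : Heis n → ℝ := logCutoff S with hη
  set W : Set (Heis n) := {p : Heis n | T ^ (-2 : ℤ) ≤ homNorm p ∧ homNorm p ≤ T ^ (2 : ℤ)} with hW
  have hWm : MeasurableSet W := (measurableSet_le measurable_const measurable_homNorm).inter
    (measurableSet_le measurable_homNorm measurable_const)
  have e1 : Real.exp (S / 2) = T ^ (2 : ℤ) := by
    rw [hS, show 4 * Real.log T / 2 = (2 : ℕ) * Real.log T by push_cast; ring, Real.exp_nat_mul,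
      Real.exp_log h0]
    norm_cast
  have e2 : Real.exp (-(S / 2)) = T ^ (-2 : ℤ) := by rw [Real.exp_neg, e1, zpow_neg]
  have htsup : tsupport η ⊆ W := by
    have := tsupport_logCutoff_subset (n := n) hS0
    rwa [e1, e2] at this
  set c : ℝ := (M / S) ^ 2 with hc
  have hpt : ∀ p, ENNReal.ofReal ((∑ i, |cutoffGrad η u.toFun u.grad i p|) ^ 2) ≤
      W.indicator (fun p => ENNReal.ofReal (4 * n) * ENNReal.ofReal (∑ i, u.grad i p ^ 2)
        + ENNReal.ofReal (8 * n ^ 2 * c) *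
          ENNReal.ofReal (u.toFun p ^ 2 * (homNorm p ^ 2)⁻¹)) p := by
    intro p
    by_cases hp : p ∈ W
    · have hp0 : p ≠ 0 := by
        rintro rfl
        have := hp.1
        rw [homNorm_zero] at this
        exact absurd this (not_le.2 (zpow_pos h0 _))
      have hρ := homNorm_pos hp0
      rw [Set.indicator_of_mem hp, ← ENNReal.ofReal_mul (by positivity),
        ← ENNReal.ofReal_mul (by positivity), ← ENNReal.ofReal_add (by positivity) (by positivity)]
      refine ENNReal.ofReal_le_ofReal ?_
      have b1 : ∀ i, |cutoffGrad η u.toFun u.grad i p| ^ 2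
          ≤ 2 * u.grad i p ^ 2 + 2 * (c * (u.toFun p ^ 2 * (homNorm p ^ 2)⁻¹)) := by
        intro i
        have hη1 := logCutoff_mem_Icc S p
        have hd := hMb S hS0 i p hp0
        have hd2 : fieldDeriv i η p ^ 2 ≤ c * (homNorm p ^ 2)⁻¹ := by
          rw [← sq_abs, hc, ← inv_pow, ← mul_pow]
          exact pow_le_pow_left₀ (abs_nonneg _) hd 2
        have hη2 : η p ^ 2 ≤ 1 := pow_le_one₀ hη1.1 hη1.2
        rw [sq_abs, cutoffGrad]
        have k1 : (η p * u.grad i p) ^ 2 ≤ u.grad i p ^ 2 := by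
          rw [mul_pow]; exact mul_le_of_le_one_left (sq_nonneg _) hη2
        have k2 : (u.toFun p * fieldDeriv i η p) ^ 2
            ≤ c * (u.toFun p ^ 2 * (homNorm p ^ 2)⁻¹) := by
          rw [mul_pow]
          calc _ ≤ u.toFun p ^ 2 * (c * (homNorm p ^ 2)⁻¹) := by gcongr
            _ = _ := by ring
        nlinarith [sq_nonneg (η p * u.grad i p - u.toFun p * fieldDeriv i η p)]
      have hcard : (Finset.univ : Finset (Fin n ⊕ Fin n)).card = n + n := by simp
      -- Cauchy–Schwarz over the `2n` components costs a factor `2n`, the square of a sum of two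
      -- terms a factor `2`, and the Hardy term is counted once for each component: hence `4n` and
      -- `8n²`, later multiplied by the five shells.
      calc (∑ i, |cutoffGrad η u.toFun u.grad i p|) ^ 2
          ≤ (n + n : ℕ) * ∑ i, |cutoffGrad η u.toFun u.grad i p| ^ 2 := by
            have := sq_sum_le_card_mul_sum_sq (s := (Finset.univ : Finset (Fin n ⊕ Fin n)))
              (f := fun i => |cutoffGrad η u.toFun u.grad i p|)
            rwa [hcard] at this
        _ ≤ (n + n : ℕ) * ∑ i, (2 * u.grad i p ^ 2
              + 2 * (c * (u.toFun p ^ 2 * (homNorm p ^ 2)⁻¹))) := by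
            gcongr with i; exact b1 i
        _ = _ := by
            rw [Finset.sum_add_distrib, ← Finset.mul_sum, Finset.sum_const, hcard, nsmul_eq_mul]
            push_cast; ring
    · have h1 : p ∉ tsupport η := fun h => hp (htsup h)
      have h2 : η p = 0 := image_eq_zero_of_notMem_tsupport h1
      have h3 : ∀ i, fieldDeriv i η p = 0 := fun i =>
        image_eq_zero_of_notMem_tsupport fun h => h1 (tsupport_fieldDeriv_subset i η h)
      simp [cutoffGrad, h2, h3]
  have hm2 : Measurable fun p : Heis n => ENNReal.ofReal (u.toFun p ^ 2 * (homNorm p ^ 2)⁻¹) :=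
    ((u.measurable_toFun.pow_const 2).mul (measurable_homNorm.pow_const 2).inv).ennreal_ofReal
  calc _ ≤ ∫⁻ p in W, (ENNReal.ofReal (4 * n) * ENNReal.ofReal (∑ i, u.grad i p ^ 2)
        + ENNReal.ofReal (8 * n ^ 2 * c) *
          ENNReal.ofReal (u.toFun p ^ 2 * (homNorm p ^ 2)⁻¹)) := by
        rw [← lintegral_indicator hWm]; exact lintegral_mono hpt
    _ = ENNReal.ofReal (4 * n) * (∫⁻ p in W, ENNReal.ofReal (∑ i, u.grad i p ^ 2))
        + ENNReal.ofReal (8 * n ^ 2 * c) *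
          ∫⁻ p in W, ENNReal.ofReal (u.toFun p ^ 2 * (homNorm p ^ 2)⁻¹) := by
        rw [lintegral_add_right _ (hm2.const_mul _), lintegral_const_mul' _ _ ENNReal.ofReal_ne_top,
          lintegral_const_mul' _ _ ENNReal.ofReal_ne_top]
    _ ≤ ENNReal.ofReal (4 * n) * (5 * ENNReal.ofReal (‖u‖ ^ 2))
        + ENNReal.ofReal (8 * n ^ 2 * c) *
          (5 * ∫⁻ p in annulus n T, ENNReal.ofReal (u.toFun p ^ 2 * (homNorm p ^ 2)⁻¹)) := by
        refine add_le_add (mul_le_mul' le_rfl ?_) (mul_le_mul' le_rfl ?_)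
        · rw [← u.lintegral_grad_sq]
          exact setLIntegral_le_five_mul hT u.grad_sq_homog
        · exact setLIntegral_le_five_mul hT u.hardy_homog
    _ = _ := by
        have k1 : ENNReal.ofReal (4 * n) * 5 = ENNReal.ofReal (20 * n) := by
          rw [show (5 : ℝ≥0∞) = ENNReal.ofReal 5 by simp, ← ENNReal.ofReal_mul (by positivity)]
          congr 1; ring
        have k2 : ENNReal.ofReal (8 * n ^ 2 * c) * 5 = ENNReal.ofReal (40 * n ^ 2 * c) := by
          rw [show (5 : ℝ≥0∞) = ENNReal.ofReal 5 by simp, ← ENNReal.ofReal_mul (by positivity)]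
          congr 1; ring
        rw [← mul_assoc, ← mul_assoc, k1, k2]

/-- Hölder's inequality for the Hardy term. -/
lemma X.lintegral_hardy_le (hn : 1 ≤ n) (u : X n T hT) {c : ℝ} (hc : 0 < c)
    (hcb : ∫⁻ p in annulus n T, ENNReal.ofReal ((homNorm p ^ (2 * n + 2))⁻¹)
      ≤ ENNReal.ofReal (c * Real.log T)) (hlog : 1 ≤ Real.log T) :
    ∫⁻ p in annulus n T, ENNReal.ofReal (u.toFun p ^ 2 * (homNorm p ^ 2)⁻¹)
      ≤ (∫⁻ p in annulus n T, ENNReal.ofReal (|u.toFun p| ^ (2 + 2 / (n : ℝ)))) ^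
          (1 / (1 + 1 / (n : ℝ))) * ENNReal.ofReal ((c + 1) * Real.log T) := by
  have hn0 : (0 : ℝ) < n := by exact_mod_cast hn
  set a : ℝ := 1 + 1 / (n : ℝ) with ha
  have ha0 : 0 < a := by positivity
  -- These are the exponents `Q/(Q-2)` and `Q/2`: they turn `u²` into `|u|^{2*}` and `|p|^{-2}` into
  -- `|p|^{-Q}`.
  have hconj : a.HolderConjugate ((n : ℝ) + 1) := by
    rw [Real.holderConjugate_iff]
    refine ⟨by rw [ha]; linarith [one_div_pos.2 hn0], ?_⟩
    rw [ha]; field_simp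
  have hF : AEMeasurable (fun p => ENNReal.ofReal (u.toFun p ^ 2)) (volume.restrict (annulus n T)) :=
    (u.measurable_toFun.pow_const 2).ennreal_ofReal.aemeasurable
  have hG : AEMeasurable (fun p : Heis n => ENNReal.ofReal ((homNorm p ^ 2)⁻¹))
      (volume.restrict (annulus n T)) := (measurable_ofReal_homNorm_pow_inv 2).aemeasurable
  have h := ENNReal.lintegral_mul_le_Lp_mul_Lq (volume.restrict (annulus n T)) hconj hF hG
  have e1 : ∀ p, ENNReal.ofReal (u.toFun p ^ 2) ^ a = ENNReal.ofReal (|u.toFun p| ^ (2 + 2 / (n : ℝ))) := by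
    intro p
    rw [ENNReal.ofReal_rpow_of_nonneg (sq_nonneg _) ha0.le, ← sq_abs, ← Real.rpow_natCast,
      ← Real.rpow_mul (abs_nonneg _)]
    congr 2; rw [ha]; push_cast; ring
  have e2 : ∀ p : Heis n, ENNReal.ofReal ((homNorm p ^ 2)⁻¹) ^ ((n : ℝ) + 1)
      = ENNReal.ofReal ((homNorm p ^ (2 * n + 2))⁻¹) := by
    intro p
    have := homNorm_nonneg p
    rw [ENNReal.ofReal_rpow_of_nonneg (by positivity) (by positivity),
      show (n : ℝ) + 1 = ((n + 1 : ℕ) : ℝ) by push_cast; rfl, Real.rpow_natCast, inv_pow, ← pow_mul]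
    congr 3
  simp only [e1, e2] at h
  refine le_trans (le_of_eq (lintegral_congr fun p => ?_)) (h.trans (mul_le_mul' le_rfl ?_))
  · rw [Pi.mul_apply, ← ENNReal.ofReal_mul (sq_nonneg _)]
  · calc _ ≤ ENNReal.ofReal ((c + 1) * Real.log T) ^ (1 / ((n : ℝ) + 1)) := by
          refine ENNReal.rpow_le_rpow (hcb.trans (ENNReal.ofReal_le_ofReal ?_)) (by positivity)
          nlinarith
      -- The base is at least `1`, so the exponent may be raised to `1`. Linear growth in `log T` is
      -- affordable because the cutoff gains `(log T)^{-2}`.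
      _ ≤ ENNReal.ofReal ((c + 1) * Real.log T) ^ (1 : ℝ) := by
          refine ENNReal.rpow_le_rpow_of_exponent_le ?_ ?_
          · rw [← ENNReal.ofReal_one]
            exact ENNReal.ofReal_le_ofReal (by nlinarith)
          · rw [div_le_one (by positivity)]; linarith
      _ = _ := ENNReal.rpow_one _

lemma logCutoff_eq_one_of_mem_annulus (hT : 1 < T) {p : Heis n} (hp : p ∈ annulus n T) :
    logCutoff (4 * Real.log T) p = 1 := by
  have hp0 : 0 < homNorm p := zero_lt_one.trans_le hp.1
  have hlog : 0 < Real.log T := Real.log_pos hT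
  refine logCutoff_eq_one (by positivity) (homNorm_pos_iff.1 hp0) ?_
  rw [abs_of_nonneg (Real.log_nonneg hp.1)]
  have := Real.log_le_log hp0 hp.2
  linarith

/-- The Sobolev inequality in `X_T`: its constant does not depend on `T`. -/
theorem exists_sobolev_X (hn : 1 ≤ n) : ∃ C T₁ : ℝ, 0 < C ∧ 1 < T₁ ∧ ∀ (T : ℝ) (hT : 1 < T),
    T₁ ≤ T → ∀ u : X n T hT,
      ∫⁻ p in annulus n T, ENNReal.ofReal (|u.toFun p| ^ (2 + 2 / (n : ℝ)))
        ≤ ENNReal.ofReal ((C * ‖u‖ ^ 2) ^ (1 + 1 / (n : ℝ))) := by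
  obtain ⟨C, hC, hsob⟩ := exists_sobolev_cutoff hn
  obtain ⟨M, hM, hMb⟩ := exists_abs_fieldDeriv_logCutoff_le (n := n)
  obtain ⟨c, hc, hcb⟩ := exists_setLIntegral_annulus_le n
  have hn0 : (0 : ℝ) < n := by exact_mod_cast hn
  set q : ℝ := 2 + 2 / (n : ℝ) with hq
  set a : ℝ := 1 + 1 / (n : ℝ) with ha
  have ha0 : 0 < a := by positivity
  set C' : ℝ := C ^ (1 / a) with hC'
  have hC'0 : 0 < C' := by positivity
  -- Inserting Hölder's inequality into the cutoff term leaves the coefficient `40 n² (M / (4 log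
  -- T))² (c+1) log T = κ / log T`.
  set κ : ℝ := 40 * n ^ 2 * M ^ 2 * (c + 1) / 16 with hκ
  have hκ0 : 0 < κ := by positivity
  refine ⟨40 * n * C', Real.exp (1 + 2 * κ * C'), by positivity,
    Real.one_lt_exp_iff.2 (by positivity), ?_⟩
  intro T hT hT₁ u
  have h0 : 0 < T := by linarith
  have hlogT : 1 + 2 * κ * C' ≤ Real.log T := (Real.le_log_iff_exp_le h0).2 hT₁
  have hlog1 : 1 ≤ Real.log T := by linarith [mul_pos (mul_pos two_pos hκ0) hC'0]
  have hlog2 : 2 * κ * C' ≤ Real.log T := by linarith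
  have hlog0 : 0 < Real.log T := by linarith
  set E : ℝ≥0∞ := ∫⁻ p in annulus n T, ENNReal.ofReal (|u.toFun p| ^ q) with hE
  set P : ℝ≥0∞ := ∫⁻ p in annulus n T, ENNReal.ofReal (u.toFun p ^ 2 * (homNorm p ^ 2)⁻¹) with hP
  have hPt : P ≠ ⊤ := by
    refine ne_top_of_le_ne_top u.lintegral_sq_ne_top (setLIntegral_mono
      (u.measurable_toFun.pow_const 2).ennreal_ofReal fun p hp => ENNReal.ofReal_le_ofReal ?_)
    exact mul_le_of_le_one_right (sq_nonneg _) (inv_le_one_of_one_le₀ (one_le_pow₀ hp.1))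
  have hgrad := u.lintegral_cutoffGrad_le hM hMb
  rw [← hP] at hgrad
  -- any bound for the gradient of the cut off function bounds `E`
  have hsob' : ∀ B : ℝ, 0 < B →
      ENNReal.ofReal (20 * n) * ENNReal.ofReal (‖u‖ ^ 2)
        + ENNReal.ofReal (40 * n ^ 2 * (M / (4 * Real.log T)) ^ 2) * P ≤ ENNReal.ofReal B →
      E ≤ ENNReal.ofReal (C * B ^ a) := by
    intro B hB hle
    have h1 := hsob u.toFun (logCutoff (4 * Real.log T)) u.grad u.measurable_toFun u.l2Loc_toFun
      u.grad_spec (isTest_logCutoff (by positivity)) B hB (hgrad.trans hle)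
    refine le_trans ?_ h1
    calc E = ∫⁻ p in annulus n T,
          ENNReal.ofReal (|logCutoff (4 * Real.log T) p * u.toFun p| ^ q) := by
          refine setLIntegral_congr_fun (isCompact_annulus n T).measurableSet fun p hp => ?_
          rw [logCutoff_eq_one_of_mem_annulus hT hp, one_mul]
      _ ≤ _ := setLIntegral_le_lintegral _ _
  -- Absorbing a multiple of `E` into itself requires its finiteness beforehand. It comes from the
  -- Sobolev inequality with a non-uniform bound, using only that `u` is in `L²(Ω_T)`.
  have hEt : E ≠ ⊤ := by
    set Z := ENNReal.ofReal (20 * n) * ENNReal.ofReal (‖u‖ ^ 2)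
        + ENNReal.ofReal (40 * n ^ 2 * (M / (4 * Real.log T)) ^ 2) * P with hZ
    have hZt : Z ≠ ⊤ := ENNReal.add_ne_top.2 ⟨ENNReal.mul_ne_top ENNReal.ofReal_ne_top
      ENNReal.ofReal_ne_top, ENNReal.mul_ne_top ENNReal.ofReal_ne_top hPt⟩
    refine ne_top_of_le_ne_top ENNReal.ofReal_ne_top (hsob' (Z.toReal + 1) (by positivity) ?_)
    rw [← ENNReal.ofReal_toReal hZt, ENNReal.toReal_ofReal ENNReal.toReal_nonneg]
    exact ENNReal.ofReal_le_ofReal (by linarith)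
  set e : ℝ := E.toReal with he
  have he0 : 0 ≤ e := ENNReal.toReal_nonneg
  have hEe : E = ENNReal.ofReal e := (ENNReal.ofReal_toReal hEt).symm
  set f : ℝ := e ^ (1 / a) with hf
  have hf0 : 0 ≤ f := by positivity
  have hPle : P ≤ ENNReal.ofReal (f * ((c + 1) * Real.log T)) := by
    have := u.lintegral_hardy_le hn hc (hcb T hlog1 h0) hlog1
    rwa [← hE, hEe, ENNReal.ofReal_rpow_of_nonneg he0 (by positivity),
      ← ENNReal.ofReal_mul (by positivity)] at this
  -- The Sobolev inequality with cutoff wants a positive bound, whereas `‖u‖` may vanish; the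
  -- estimate is proved for `b > ‖u‖²` and `b` then decreases to `‖u‖²`.
  have key : ∀ b : ℝ, 0 < b → ‖u‖ ^ 2 ≤ b → E ≤ ENNReal.ofReal ((40 * n * C' * b) ^ a) := by
    intro b hb hub
    set B : ℝ := 20 * n * b + κ / Real.log T * f with hB
    have hB0 : 0 < B := by positivity
    have h1 : E ≤ ENNReal.ofReal (C * B ^ a) := by
      refine hsob' B hB0 ?_
      calc _ ≤ ENNReal.ofReal (20 * n) * ENNReal.ofReal b
            + ENNReal.ofReal (40 * n ^ 2 * (M / (4 * Real.log T)) ^ 2) *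
              ENNReal.ofReal (f * ((c + 1) * Real.log T)) :=
            add_le_add (mul_le_mul' le_rfl (ENNReal.ofReal_le_ofReal hub)) (mul_le_mul' le_rfl hPle)
        _ = _ := by
            rw [← ENNReal.ofReal_mul (by positivity), ← ENNReal.ofReal_mul (by positivity),
              ← ENNReal.ofReal_add (by positivity) (by positivity)]
            congr 1
            rw [hB, hκ]; field_simp; ring
    have h2 : e ≤ C * B ^ a := by
      rw [hEe] at h1
      exact (ENNReal.ofReal_le_ofReal_iff (by positivity)).1 h1
    have h3 : f ≤ C' * B := by
      calc f ≤ (C * B ^ a) ^ (1 / a) := Real.rpow_le_rpow he0 h2 (by positivity)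
        _ = C' * B := by
            rw [Real.mul_rpow hC.le (by positivity), ← Real.rpow_mul hB0.le,
              mul_one_div_cancel ha0.ne', Real.rpow_one]
    -- The absorption: the threshold on `T` was chosen so that `log T ≥ 2 κ C'`, which leaves at
    -- most half of `f` on the right.
    have h4 : C' * (κ / Real.log T * f) ≤ f / 2 := by
      have : C' * (κ / Real.log T) ≤ 1 / 2 := by
        rw [mul_div_assoc', div_le_iff₀ hlog0]; linarith
      nlinarith
    have h5 : f ≤ 40 * n * C' * b := by
      have : C' * B = C' * (20 * n * b) + C' * (κ / Real.log T * f) := by rw [hB]; ring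
      nlinarith
    rw [hEe]
    refine ENNReal.ofReal_le_ofReal ?_
    have : e = f ^ a := by
      rw [hf, ← Real.rpow_mul he0, one_div_mul_cancel ha0.ne', Real.rpow_one]
    rw [this]
    exact Real.rpow_le_rpow hf0 h5 ha0.le
  have hcont : Tendsto (fun b : ℝ => ENNReal.ofReal ((40 * n * C' * b) ^ a)) (𝓝[>] (‖u‖ ^ 2))
      (𝓝 (ENNReal.ofReal ((40 * n * C' * ‖u‖ ^ 2) ^ a))) := by
    have : Continuous fun b : ℝ => ENNReal.ofReal ((40 * n * C' * b) ^ a) :=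
      ENNReal.continuous_ofReal.comp ((Real.continuous_rpow_const ha0.le).comp
        (continuous_const.mul continuous_id))
    exact (this.tendsto _).mono_left nhdsWithin_le_nhds
  refine ge_of_tendsto hcont ?_
  filter_upwards [self_mem_nhdsWithin] with b hb
  exact key b (lt_of_le_of_lt (sq_nonneg _) hb) (le_of_lt hb)

end SobolevX

/-! ### Riesz representation in complete seminormed inner product spaces -/

/-- The form vanishes on vectors of zero seminorm, so it descends to the separation quotient, which
is a Hilbert space; any lift of the representing vector works. Testing on that vector itself gives
the norm bound. -/
lemma exists_inner_eq_of_completeSpace {E : Type*} [SeminormedAddCommGroup E]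
    [InnerProductSpace ℝ E] [CompleteSpace E] (ℓ : E →L[ℝ] ℝ) {B : ℝ} (hB0 : 0 ≤ B)
    (hB : ∀ x, |ℓ x| ≤ B * ‖x‖) : ∃ g : E, innerSL ℝ g = ℓ ∧ ‖g‖ ≤ B := by
  let ℓ' : SeparationQuotient E →L[ℝ] ℝ :=
    SeparationQuotient.liftCLM ℓ fun x y h => (h.map ℓ.continuous).eq
  obtain ⟨g, hg⟩ := SeparationQuotient.surjective_mk
    ((InnerProductSpace.toDual ℝ (SeparationQuotient E)).symm ℓ')
  have key : ∀ x, inner ℝ g x = ℓ x := fun x => by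
    rw [← SeparationQuotient.inner_mk_mk, hg, InnerProductSpace.toDual_symm_apply]
    exact SeparationQuotient.liftCLM_mk ℓ _ x
  refine ⟨g, ContinuousLinearMap.ext fun x => key x, ?_⟩
  have h1 := hB g
  rw [← key g, real_inner_self_eq_norm_sq, abs_of_nonneg (sq_nonneg _)] at h1
  by_contra! h
  nlinarith [norm_nonneg g]

/-! ### Completeness of `X_T` -/

section Completeness

variable {n : ℕ} {T : ℝ} {hT : 1 < T}

/-- The extension by homogeneity of a function on the shell `1 ≤ |x| < T`. -/
def homogExt (T c : ℝ) (f : Heis n → ℝ) (p : Heis n) : ℝ :=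
  c ^ ⌊Real.logb T (homNorm p)⌋ * f (dil (T ^ (-⌊Real.logb T (homNorm p)⌋)) p)

lemma homogExt_dil (hT : 1 < T) {c : ℝ} (hc : c ≠ 0) (f : Heis n → ℝ) {p : Heis n} (hp : p ≠ 0) :
    homogExt T c f (dil T p) = c * homogExt T c f p := by
  have h0 : 0 < T := by linarith
  have hk : ⌊Real.logb T (homNorm (dil T p))⌋ = ⌊Real.logb T (homNorm p)⌋ + 1 := by
    rw [homNorm_dil h0.le, Real.logb_mul h0.ne' (homNorm_pos hp).ne',
      Real.logb_self_eq_one hT, add_comm, Int.floor_add_one]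
  unfold homogExt
  rw [hk, dil_dil, zpow_add_one₀ hc, neg_add, ← sub_eq_add_neg, zpow_sub_one₀ h0.ne',
    inv_mul_cancel_right₀ h0.ne']
  ring

lemma homogExt_of_mem_shell (hT : 1 < T) (c : ℝ) (f : Heis n → ℝ) {p : Heis n}
    (hp : p ∈ shell n T 0) : homogExt T c f p = f p := by
  have h1 : 1 ≤ homNorm p := by simpa using hp.1
  have h2 : homNorm p < T := by simpa using hp.2
  have hk : ⌊Real.logb T (homNorm p)⌋ = 0 := by
    rw [Int.floor_eq_zero_iff]
    exact ⟨Real.logb_nonneg hT h1, by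
      rw [Real.logb_lt_iff_lt_rpow hT (by linarith), Real.rpow_one]; exact h2⟩
  simp [homogExt, hk, dil_one]

/-- The integer part takes countably many values, and for each fixed value the expression is
measurable. -/
lemma measurable_homogExt (T c : ℝ) {f : Heis n → ℝ} (hf : Measurable f) :
    Measurable (homogExt T c f) := by
  have h1 : Measurable fun q : Heis n × ℤ => c ^ q.2 * f (dil (T ^ (-q.2)) q.1) :=
    measurable_from_prod_countable_left fun k =>
      (hf.comp (continuous_dil (T ^ (-k))).measurable).const_mul (c ^ k)
  have h2 : Measurable fun p : Heis n => ⌊Real.logb T (homNorm p)⌋ := by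
    have : Measurable fun p : Heis n => Real.logb T (homNorm p) :=
      (Real.measurable_log.comp measurable_homNorm).div_const _
    exact Int.measurable_floor.comp this
  exact h1.comp (measurable_id.prodMk h2)

lemma eLpNorm_two_eq {α : Type*} [MeasurableSpace α] {μ : Measure α} (f : α → ℝ) :
    eLpNorm f 2 μ = (∫⁻ x, ENNReal.ofReal (f x ^ 2) ∂μ) ^ ((1 : ℝ) / 2) := by
  rw [eLpNorm_eq_lintegral_rpow_enorm_toReal (by norm_num) (by norm_num)]
  simp only [ENNReal.toReal_ofNat]
  congr 1
  refine lintegral_congr fun x => ?_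
  rw [Real.enorm_eq_ofReal_abs, ENNReal.ofReal_rpow_of_nonneg (abs_nonneg _) (by norm_num),
    Real.rpow_two, sq_abs]

/-- A compact set avoiding the origin meets finitely many shells, and homogeneity compares each of
them with the annulus. Convergence on one annulus is therefore local convergence. -/
lemma exists_eLpNorm_compact_le (hT : 1 < T) {c : ℝ} (hc : 0 < c) {K : Set (Heis n)}
    (hK : IsCompact K) (h0 : K ⊆ {0}ᶜ) : ∃ C : ℝ≥0∞, C ≠ ⊤ ∧ ∀ f : Heis n → ℝ,
      (∀ᵐ p, f (dil T p) = c * f p) →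
        eLpNorm f 2 (volume.restrict K) ≤ C * eLpNorm f 2 (volume.restrict (annulus n T)) := by
  obtain ⟨C, hC, h⟩ := setLIntegral_compact_le (n := n) hT (c := ENNReal.ofReal (c ^ 2))
    (by simpa using hc.ne') ENNReal.ofReal_ne_top hK h0
  refine ⟨C ^ ((1 : ℝ) / 2), ENNReal.rpow_ne_top_of_nonneg (by norm_num) hC, fun f hf => ?_⟩
  rw [eLpNorm_two_eq, eLpNorm_two_eq, ← ENNReal.mul_rpow_of_nonneg _ _ (by norm_num)]
  refine ENNReal.rpow_le_rpow (h _ ?_) (by norm_num)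
  filter_upwards [hf] with p hp
  rw [hp, mul_pow, ENNReal.ofReal_mul (sq_nonneg _)]

/-- A sequence of functions which are homogeneous under `δ_T` and Cauchy in `L²(Ω_T)` converges
in `L²_loc(ℍⁿ \ {0})`. -/
lemma exists_homog_limit (hT : 1 < T) {c : ℝ} (hc : 0 < c) {f : ℕ → Heis n → ℝ}
    (hf : ∀ j, L2Loc (f j)) (hh : ∀ j, ∀ᵐ p, f j (dil T p) = c * f j p) {B : ℕ → ℝ≥0∞}
    (hB : ∑' j, B j ≠ ⊤) (hcau : ∀ N j k, N ≤ j → N ≤ k →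
      eLpNorm (f j - f k) 2 (volume.restrict (annulus n T)) < B N) :
    ∃ g : Heis n → ℝ, Measurable g ∧ L2Loc g ∧ (∀ᵐ p, g (dil T p) = c * g p) ∧
      ∀ K : Set (Heis n), IsCompact K → K ⊆ {0}ᶜ →
        Tendsto (fun j => eLpNorm (f j - g) 2 (volume.restrict K)) atTop (𝓝 0) := by
  obtain ⟨f₀, hf₀, hlim⟩ := Lp.cauchy_complete_eLpNorm (by norm_num)
    (fun j => hf j _ (isCompact_annulus n T) (annulus_subset n T)) hB hcau
  set f₁ : Heis n → ℝ := hf₀.1.mk f₀ with hf₁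
  have hf₁m : Measurable f₁ := hf₀.1.stronglyMeasurable_mk.measurable
  -- The limit is known on the annulus only and is extended by homogeneity from the half-open shell,
  -- which is a fundamental domain and differs from the annulus by a null sphere.
  set g := homogExt T c f₁ with hg
  have hgm : Measurable g := measurable_homogExt T c hf₁m
  have hgh : ∀ᵐ p, g (dil T p) = c * g p := by
    filter_upwards [ae_ne_zero (n := n)] with p hp
    exact homogExt_dil hT hc.ne' f₁ hp
  have hgf : g =ᵐ[volume.restrict (annulus n T)] f₀ := by
    have h1 : ∀ᵐ p ∂(volume.restrict (annulus n T)), p ∈ shell n T 0 := by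
      rw [Measure.restrict_congr_set (annulus_ae_eq_shell n T)]
      exact ae_restrict_mem (measurableSet_shell T 0)
    filter_upwards [h1, hf₀.1.ae_eq_mk] with p hp hp2
    rw [hp2, hg, homogExt_of_mem_shell hT c f₁ hp]
  have hgA : MemLp g 2 (volume.restrict (annulus n T)) := (memLp_congr_ae hgf).2 hf₀
  refine ⟨g, hgm, fun K hK h0 => ?_, hgh, fun K hK h0 => ?_⟩
  · obtain ⟨C, hC, h⟩ := exists_eLpNorm_compact_le hT hc hK h0
    exact ⟨hgm.aestronglyMeasurable, (h g hgh).trans_lt (ENNReal.mul_lt_top hC.lt_top hgA.2)⟩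
  · obtain ⟨C, hC, h⟩ := exists_eLpNorm_compact_le hT hc hK h0
    have h1 : Tendsto (fun j => C * eLpNorm (f j - g) 2 (volume.restrict (annulus n T)))
        atTop (𝓝 0) := by
      have : ∀ j, eLpNorm (f j - g) 2 (volume.restrict (annulus n T))
          = eLpNorm (f j - f₀) 2 (volume.restrict (annulus n T)) := fun j =>
        eLpNorm_congr_ae (by filter_upwards [hgf] with p hp; simp [hp])
      simp only [this]
      simpa using ENNReal.Tendsto.const_mul hlim (Or.inr hC)
    refine tendsto_of_tendsto_of_tendsto_of_le_of_le tendsto_const_nhds h1 (fun _ => zero_le)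
      fun j => h _ ?_
    filter_upwards [hgh, hh j] with p hp1 hp2
    simp only [Pi.sub_apply, hp1, hp2]
    ring

/-- Cauchy–Schwarz on the support of `g`; this is what passes the definition of weak derivatives to
the limit. -/
lemma tendsto_integral_mul_of_tendsto_eLpNorm {f : ℕ → Heis n → ℝ} {u g : Heis n → ℝ}
    (hf : ∀ j, L2Loc (f j)) (hu : L2Loc u) (hg : Continuous g) (hc : HasCompactSupport g)
    (h0 : tsupport g ⊆ {0}ᶜ)
    (h : Tendsto (fun j => eLpNorm (f j - u) 2 (volume.restrict (tsupport g))) atTop (𝓝 0)) :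
    Tendsto (fun j => ∫ p, f j p * g p) atTop (𝓝 (∫ p, u p * g p)) := by
  have hgL : MemLp g 2 (volume.restrict (tsupport g)) :=
    (hg.memLp_of_hasCompactSupport hc).restrict _
  refine tendsto_integral_of_L1 _ (hu.integrable_mul hg hc h0).1
    (Eventually.of_forall fun j => (hf j).integrable_mul hg hc h0) ?_
  have h1 : Tendsto (fun j => eLpNorm (f j - u) 2 (volume.restrict (tsupport g)) *
      eLpNorm g 2 (volume.restrict (tsupport g))) atTop (𝓝 0) := by
    simpa using ENNReal.Tendsto.mul_const h (Or.inr hgL.2.ne)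
  refine tendsto_of_tendsto_of_tendsto_of_le_of_le tendsto_const_nhds h1 (fun _ => zero_le)
    fun j => ?_
  have hm := (isClosed_tsupport g).measurableSet
  calc ∫⁻ p, ‖f j p * g p - u p * g p‖ₑ
      = ∫⁻ p in tsupport g, ‖f j p * g p - u p * g p‖ₑ := by
        rw [← lintegral_indicator hm]
        refine lintegral_congr fun p => ?_
        by_cases hp : p ∈ tsupport g
        · rw [Set.indicator_of_mem hp]
        · rw [Set.indicator_of_notMem hp, image_eq_zero_of_notMem_tsupport hp]; simp
    _ = ∫⁻ p in tsupport g, ((fun p => ‖(f j - u) p‖ₑ) * fun p => ‖g p‖ₑ) p := by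
        refine lintegral_congr fun p => ?_
        rw [← sub_mul, enorm_mul]; rfl
    _ ≤ _ := by
        have hd : AEMeasurable (fun p => ‖(f j - u) p‖ₑ) (volume.restrict (tsupport g)) :=
          ((hf j _ hc h0).1.sub (hu _ hc h0).1).enorm
        have := ENNReal.lintegral_mul_le_Lp_mul_Lq (volume.restrict (tsupport g))
          Real.HolderConjugate.two_two hd hgL.1.enorm
        rw [eLpNorm_eq_lintegral_rpow_enorm_toReal (by norm_num) (by norm_num),
          eLpNorm_eq_lintegral_rpow_enorm_toReal (by norm_num) (by norm_num)]
        simpa using this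

/-- The element of `X_T` given by a function. -/
lemma X.exists_of_isWeakDeriv (hT : 1 < T) {u : Heis n → ℝ} {v : Fin n ⊕ Fin n → Heis n → ℝ}
    (hm : AEStronglyMeasurable u volume) (hu : L2Loc u) (hv : ∀ i, IsWeakDeriv i u (v i))
    (hh : ∀ᵐ p, u (dil T p) = (T ^ n)⁻¹ * u p) :
    ∃ w : X n T hT, w.toFun =ᵐ[volume] u ∧ ∀ i, w.grad i =ᵐ[volume] v i := by
  have hT0 : T ≠ 0 := by linarith
  have e := AEEqFun.coeFn_mk u hm
  have ed := (quasiMeasurePreserving_dil (n := n) hT0).ae e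
  have hmem : AEEqFun.mk u hm ∈ XSub n T hT := by
    refine ⟨S1Loc.congr ⟨hu, fun i => ⟨_, hv i⟩⟩ e.symm, ?_⟩
    filter_upwards [e, ed, hh] with p h1 h2 h3
    rw [h1, h2, h3, homDim_sub_two_div_two, Real.rpow_neg (by linarith), Real.rpow_natCast]
  refine ⟨⟨_, hmem⟩, e, fun i => ?_⟩
  exact (X.grad_spec _ i).unique ((hv i).congr e.symm)

lemma X.toFun_sub (u v : X n T hT) : (u - v).toFun =ᵐ[volume] u.toFun - v.toFun :=
  AEEqFun.coeFn_sub u.1 v.1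

lemma X.toFun_add (u v : X n T hT) : (u + v).toFun =ᵐ[volume] u.toFun + v.toFun :=
  AEEqFun.coeFn_add u.1 v.1

lemma X.toFun_smul (c : ℝ) (u : X n T hT) : (c • u).toFun =ᵐ[volume] c • u.toFun :=
  AEEqFun.coeFn_smul c u.1

lemma X.grad_sub (u v : X n T hT) (i : Fin n ⊕ Fin n) :
    (u - v).grad i =ᵐ[volume] u.grad i - v.grad i := by
  have e : u - v = u + (-1 : ℝ) • v := by rw [neg_one_smul, sub_eq_add_neg]
  rw [e]
  filter_upwards [X.grad_add u ((-1 : ℝ) • v) i, X.grad_smul (-1) v i] with p h1 h2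
  rw [h1, h2, Pi.sub_apply]; ring

lemma X.eLpNorm_grad_le (u : X n T hT) (i : Fin n ⊕ Fin n) :
    eLpNorm (u.grad i) 2 (volume.restrict (annulus n T)) ≤ ENNReal.ofReal ‖u‖ := by
  rw [eLpNorm_two_eq]
  calc _ ≤ (ENNReal.ofReal (‖u‖ ^ 2)) ^ ((1 : ℝ) / 2) := by
        refine ENNReal.rpow_le_rpow ?_ (by norm_num)
        rw [← u.lintegral_grad_sq]
        exact lintegral_mono fun p => ENNReal.ofReal_le_ofReal
          (Finset.single_le_sum (f := fun i => u.grad i p ^ 2) (fun _ _ => sq_nonneg _)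
            (Finset.mem_univ i))
    _ = _ := by
        rw [ENNReal.ofReal_rpow_of_nonneg (sq_nonneg _) (by norm_num), ← Real.sqrt_eq_rpow,
          Real.sqrt_sq (norm_nonneg u)]

/-- If the norm of `X_T` controls the norm of `L²(Ω_T)`, then `X_T` is complete. -/
theorem X.completeSpace_of_eLpNorm_le {K : ℝ} (hK0 : 0 < K) (hK : ∀ u : X n T hT,
    eLpNorm u.toFun 2 (volume.restrict (annulus n T)) ≤ ENNReal.ofReal (K * ‖u‖)) :
    CompleteSpace (X n T hT) := by
  have h0 : 0 < T := by linarith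
  have hsum : ∀ a : ℝ, 0 < a → ∑' j : ℕ, ENNReal.ofReal (a * (1 / 2) ^ j) ≠ ⊤ := fun a ha => by
    rw [← ENNReal.ofReal_tsum_of_nonneg (fun j => by positivity)
      (summable_geometric_two.mul_left a)]
    exact ENNReal.ofReal_ne_top
  -- It suffices to treat sequences that are Cauchy at a summable rate, as `exists_homog_limit`
  -- asks. The functions and each component of their gradients converge separately, and the limits
  -- are then related through test functions.
  refine Metric.complete_of_convergent_controlled_sequences (fun j => (1 / 2 : ℝ) ^ j)
    (fun j => by positivity) fun u hu => ?_
  have hu' : ∀ N j k, N ≤ j → N ≤ k → ‖u j - u k‖ < (1 / 2) ^ N := fun N j k hj hk => by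
    rw [← dist_eq_norm]; exact hu N j k hj hk
  obtain ⟨f, hfm, hfL, hfh, hflim⟩ := exists_homog_limit hT (c := (T ^ n)⁻¹) (by positivity)
    (f := fun j => (u j).toFun) (fun j => (u j).l2Loc_toFun) (fun j => (u j).toFun_dil)
    (hsum K hK0) (fun N j k hj hk => by
      rw [← eLpNorm_congr_ae (ae_restrict_of_ae (X.toFun_sub (u j) (u k)))]
      refine (hK _).trans_lt ((ENNReal.ofReal_lt_ofReal_iff (by positivity)).2 ?_)
      exact mul_lt_mul_of_pos_left (hu' N j k hj hk) hK0)
  choose v hvm hvL hvh hvlim using fun i => exists_homog_limit hT (c := (T ^ (n + 1))⁻¹)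
    (by positivity) (f := fun j => (u j).grad i) (fun j => ((u j).grad_spec i).1)
    (fun j => (u j).grad_dil i) (hsum 1 one_pos) (fun N j k hj hk => by
      rw [← eLpNorm_congr_ae (ae_restrict_of_ae (X.grad_sub (u j) (u k) i))]
      refine (X.eLpNorm_grad_le _ i).trans_lt ((ENNReal.ofReal_lt_ofReal_iff (by positivity)).2 ?_)
      rw [one_mul]; exact hu' N j k hj hk)
  have hw : ∀ i, IsWeakDeriv i f (v i) := fun i => by
    refine ⟨hvL i, fun φ hφ => ?_⟩
    have hsub := tsupport_fieldDeriv_subset i φ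
    have l1 := tendsto_integral_mul_of_tendsto_eLpNorm (fun j => (u j).l2Loc_toFun) hfL
      (contDiff_fieldDeriv i hφ.smooth).continuous (hasCompactSupport_fieldDeriv i hφ.compact)
      (hsub.trans hφ.support)
      (hflim _ (hasCompactSupport_fieldDeriv i hφ.compact) (hsub.trans hφ.support))
    have l2 := tendsto_integral_mul_of_tendsto_eLpNorm (fun j => ((u j).grad_spec i).1) (hvL i)
      hφ.smooth.continuous hφ.compact hφ.support (hvlim i _ hφ.compact hφ.support)
    refine tendsto_nhds_unique l1 (l2.neg.congr fun j => ?_)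
    exact (((u j).grad_spec i).2 φ hφ).symm
  obtain ⟨w, hwf, hwv⟩ := X.exists_of_isWeakDeriv hT hfm.aestronglyMeasurable hfL hw hfh
  refine ⟨w, ?_⟩
  rw [tendsto_iff_norm_sub_tendsto_zero]
  have hsq : Tendsto (fun j => ENNReal.ofReal (‖u j - w‖ ^ 2)) atTop (𝓝 0) := by
    have e : ∀ j, ENNReal.ofReal (‖u j - w‖ ^ 2) =
        ∑ i, eLpNorm ((u j).grad i - v i) 2 (volume.restrict (annulus n T)) ^ (2 : ℝ) := by
      intro j
      have hg : ∀ i, ((u j - w).grad i) =ᵐ[volume.restrict (annulus n T)] (u j).grad i - v i :=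
        fun i => by
          filter_upwards [ae_restrict_of_ae (X.grad_sub (u j) w i), ae_restrict_of_ae (hwv i)]
            with p h1 h2
          rw [h1, Pi.sub_apply, Pi.sub_apply, h2]
      rw [← X.lintegral_grad_sq]
      simp only [ENNReal.ofReal_sum_of_nonneg (fun i _ => sq_nonneg (_ : ℝ))]
      rw [lintegral_finsetSum' _ fun i _ =>
        ((X.aemeasurable_grad _ i).pow_const 2).ennreal_ofReal.restrict]
      refine Finset.sum_congr rfl fun i _ => ?_
      rw [← eLpNorm_congr_ae (hg i), eLpNorm_two_eq, ← ENNReal.rpow_mul]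
      norm_num
    simp only [e]
    have : (0 : ℝ≥0∞) = ∑ i : Fin n ⊕ Fin n, (0 : ℝ≥0∞) ^ (2 : ℝ) := by simp
    rw [this]
    refine tendsto_finsetSum _ fun i _ => ?_
    exact ((ENNReal.continuous_rpow_const (y := 2)).tendsto 0).comp
      (hvlim i _ (isCompact_annulus n T) (annulus_subset n T))
  have h2 : Tendsto (fun j => ‖u j - w‖ ^ 2) atTop (𝓝 0) := by
    have := (ENNReal.tendsto_toReal ENNReal.zero_ne_top).comp hsq
    simpa [Function.comp_def, ENNReal.toReal_ofReal, sq_nonneg] using this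
  have h3 := h2.sqrt
  simpa [Real.sqrt_sq, norm_nonneg] using h3

/-- The Hardy inequality in `X_T`. -/
lemma exists_hardy_X (hn : 1 ≤ n) : ∃ C T₁ : ℝ, 0 < C ∧ 1 < T₁ ∧ ∀ (T : ℝ) (hT : 1 < T),
    T₁ ≤ T → 1 ≤ Real.log T ∧ ∀ u : X n T hT,
      ∫⁻ p in annulus n T, ENNReal.ofReal (u.toFun p ^ 2 * (homNorm p ^ 2)⁻¹)
        ≤ ENNReal.ofReal (C * Real.log T * ‖u‖ ^ 2) := by
  obtain ⟨C, T₁, hC, hT₁, hsob⟩ := exists_sobolev_X hn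
  obtain ⟨c, hc, hcb⟩ := exists_setLIntegral_annulus_le n
  have hn0 : (0 : ℝ) < n := by exact_mod_cast hn
  refine ⟨C * (c + 1), max T₁ (Real.exp 1), by positivity, lt_max_of_lt_left hT₁,
    fun T hT hle => ?_⟩
  have h0 : 0 < T := by linarith
  have hlog : 1 ≤ Real.log T := (Real.le_log_iff_exp_le h0).2 ((le_max_right _ _).trans hle)
  refine ⟨hlog, fun u => ?_⟩
  have ha : (0 : ℝ) < 1 + 1 / n := by positivity
  have h2 : (∫⁻ p in annulus n T, ENNReal.ofReal (|u.toFun p| ^ (2 + 2 / (n : ℝ)))) ^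
          (1 / (1 + 1 / (n : ℝ))) ≤ ENNReal.ofReal (C * ‖u‖ ^ 2) := by
    refine (ENNReal.rpow_le_rpow (hsob T hT ((le_max_left _ _).trans hle) u)
      (by positivity)).trans ?_
    rw [ENNReal.ofReal_rpow_of_nonneg (by positivity) (by positivity),
      ← Real.rpow_mul (by positivity), mul_one_div_cancel ha.ne', Real.rpow_one]
  refine (u.lintegral_hardy_le hn hc (hcb T hlog h0) hlog).trans
    ((mul_le_mul' h2 le_rfl).trans (le_of_eq ?_))
  rw [← ENNReal.ofReal_mul (by positivity)]
  congr 1; ring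

/-- The Poincaré inequality in `X_T`. -/
lemma exists_poincare_X (hn : 1 ≤ n) : ∃ T₁ : ℝ, 1 < T₁ ∧ ∀ (T : ℝ) (hT : 1 < T), T₁ ≤ T →
    ∃ K : ℝ, 0 < K ∧ ∀ u : X n T hT,
      ∫⁻ p in annulus n T, ENNReal.ofReal (u.toFun p ^ 2) ≤ ENNReal.ofReal (K * ‖u‖ ^ 2) := by
  obtain ⟨C, T₁, hC, hT₁, h⟩ := exists_hardy_X hn
  refine ⟨T₁, hT₁, fun T hT hle => ?_⟩
  have h0 : 0 < T := by linarith
  obtain ⟨hlog, hu⟩ := h T hT hle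
  -- The growth of this constant with `T` is harmless: it enters the completeness and the
  -- differentiability, but not the size of the gradient.
  refine ⟨T ^ 2 * (C * Real.log T), by positivity, fun u => ?_⟩
  calc ∫⁻ p in annulus n T, ENNReal.ofReal (u.toFun p ^ 2)
      ≤ ENNReal.ofReal (T ^ 2) *
        ∫⁻ p in annulus n T, ENNReal.ofReal (u.toFun p ^ 2 * (homNorm p ^ 2)⁻¹) := by
        rw [← lintegral_const_mul' _ _ ENNReal.ofReal_ne_top]
        refine setLIntegral_mono' (isCompact_annulus n T).measurableSet fun p hp => ?_
        rw [← ENNReal.ofReal_mul (by positivity)]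
        refine ENNReal.ofReal_le_ofReal ?_
        have hp0 : 0 < homNorm p := zero_lt_one.trans_le hp.1
        have : 1 ≤ T ^ 2 * (homNorm p ^ 2)⁻¹ := by
          rw [← div_eq_mul_inv, one_le_div (by positivity)]
          exact pow_le_pow_left₀ hp0.le hp.2 2
        nlinarith [sq_nonneg (u.toFun p)]
    _ ≤ ENNReal.ofReal (T ^ 2) * ENNReal.ofReal (C * Real.log T * ‖u‖ ^ 2) :=
        mul_le_mul' le_rfl (hu u)
    _ = _ := by rw [← ENNReal.ofReal_mul (by positivity), mul_assoc (T ^ 2)]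

/-- For large `T` the space `X_T` is complete. -/
theorem exists_completeSpace_X (hn : 1 ≤ n) : ∃ T₁ : ℝ, 1 < T₁ ∧ ∀ (T : ℝ) (hT : 1 < T),
    T₁ ≤ T → CompleteSpace (X n T hT) := by
  obtain ⟨T₁, hT₁, h⟩ := exists_poincare_X hn
  refine ⟨T₁, hT₁, fun T hT hle => ?_⟩
  obtain ⟨K, hK0, hK⟩ := h T hT hle
  refine X.completeSpace_of_eLpNorm_le (K := √K) (Real.sqrt_pos.2 hK0) fun u => ?_
  rw [eLpNorm_two_eq]
  refine (ENNReal.rpow_le_rpow (hK u) (by norm_num)).trans (le_of_eq ?_)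
  rw [ENNReal.ofReal_rpow_of_nonneg (by positivity) (by norm_num), ← Real.sqrt_eq_rpow,
    Real.sqrt_mul hK0.le, Real.sqrt_sq (norm_nonneg u)]

end Completeness

/-! ### Two-sided geometric sums -/

section ScaleMin

/-- The function `min (x, 1/x)`, which measures how far apart two scales of ratio `x` are. -/
def scaleMin (x : ℝ) : ℝ := min x x⁻¹

lemma scaleMin_nonneg {x : ℝ} (hx : 0 ≤ x) : 0 ≤ scaleMin x := le_min hx (inv_nonneg.2 hx)

lemma scaleMin_pos {x : ℝ} (hx : 0 < x) : 0 < scaleMin x := lt_min hx (inv_pos.2 hx)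

lemma scaleMin_le_one (x : ℝ) : scaleMin x ≤ 1 := by
  rcases le_total x 1 with h | h
  · exact (min_le_left _ _).trans h
  · exact (min_le_right _ _).trans (inv_le_one_of_one_le₀ h)

/-- Whichever of `x`, `x⁻¹` is at most `1` realizes the minimum, and there a power with exponent at
least `1` is below the first power. This lets decay rates with different exponents on the two sides
be treated alike. -/
lemma le_scaleMin_of_le_pow {x a : ℝ} (hx : 0 < x) {m k : ℕ} (hm : 1 ≤ m) (hk : 1 ≤ k)
    (h1 : a ≤ x ^ m) (h2 : a ≤ x⁻¹ ^ k) : a ≤ scaleMin x := by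
  rcases le_total x 1 with h | h
  · have h' : 1 ≤ x⁻¹ := (one_le_inv₀ hx).2 h
    refine h1.trans (le_min ?_ ?_)
    · simpa using pow_le_pow_of_le_one hx.le h hm
    · exact (pow_le_one₀ hx.le h).trans h'
  · have h' : x⁻¹ ≤ 1 := inv_le_one_of_one_le₀ h
    have h'' : 0 ≤ x⁻¹ := (inv_pos.2 hx).le
    refine h2.trans (le_min ?_ ?_)
    · exact (pow_le_one₀ h'' h').trans h
    · simpa using pow_le_pow_of_le_one h'' h' hk

lemma hasSum_pow_natAbs {a : ℝ} (h0 : 0 ≤ a) (h1 : a < 1) :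
    HasSum (fun k : ℤ => a ^ k.natAbs) ((1 - a)⁻¹ + a * (1 - a)⁻¹) := by
  refine HasSum.of_nat_of_neg_add_one ?_ ?_
  · simpa using hasSum_geometric_of_lt_one h0 h1
  · have : (fun k : ℕ => a ^ (-((k : ℤ) + 1)).natAbs) = fun k : ℕ => a * a ^ k := by
      funext k
      rw [show (-((k : ℤ) + 1)).natAbs = k + 1 by omega, pow_succ, mul_comm]
    rw [this]
    exact (hasSum_geometric_of_lt_one h0 h1).mul_left a

/-- Among the numbers `x / T^k` at most one is far from both `0` and `∞`. -/
lemma exists_tsum_scaleMin_le {T : ℝ} (hT : 2 ≤ T) {x : ℝ} (hx : 0 < x) :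
    Summable (fun k : ℤ => scaleMin (x / T ^ k)) ∧
      ∃ k₀ : ℤ, ∑' k : ℤ, (if k = k₀ then 0 else scaleMin (x / T ^ k)) ≤ 4 * (√T)⁻¹ := by
  have h0 : 0 < T := by linarith
  have hs : 0 < √T := Real.sqrt_pos.2 h0
  have hss : √T * √T = T := Real.mul_self_sqrt h0.le
  -- The factor `√T` centres the choice: `x / T^{k₀}` lies between `T^{-1/2}` and `T^{1/2}`, so the
  -- terms are at most `√T · T^{-|k - k₀|}`. Without the index `k₀` this sums to `2 √T T⁻¹ / (1 -
  -- T⁻¹) ≤ 4 T^{-1/2}`.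
  obtain ⟨k₀, hk1, hk2⟩ := exists_mem_Ico_zpow (x := x * √T) (by positivity)
    (by linarith : (1 : ℝ) < T)
  rw [zpow_add_one₀ h0.ne'] at hk2
  have hTk : 0 < T ^ k₀ := zpow_pos h0 _
  set a : ℝ := T⁻¹ with ha
  have ha0 : 0 < a := inv_pos.2 h0
  have ha1 : a ≤ 1 / 2 := by
    rw [ha, ← one_div]; exact one_div_le_one_div_of_le two_pos hT
  have y1 : x / T ^ k₀ ≤ √T := by
    rw [div_le_iff₀ hTk]
    nlinarith
  have y2 : (x / T ^ k₀)⁻¹ ≤ √T := by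
    rw [inv_div, div_le_iff₀ hx]; linarith
  have hbound : ∀ k : ℤ, scaleMin (x / T ^ k) ≤ √T * a ^ (k - k₀).natAbs := by
    intro k
    have hk : T ^ k = T ^ k₀ * T ^ (k - k₀) := by rw [← zpow_add₀ h0.ne']; congr 1; ring
    rcases le_total 0 (k - k₀) with h | h
    · refine (min_le_left _ _).trans ?_
      obtain ⟨m, hm⟩ := Int.eq_ofNat_of_zero_le h
      rw [hk, hm, Int.natAbs_natCast, zpow_natCast, ← div_div, ha, inv_pow, ← div_eq_mul_inv]
      gcongr
    · refine (min_le_right _ _).trans ?_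
      obtain ⟨m, hm⟩ := Int.eq_ofNat_of_zero_le (by omega : 0 ≤ -(k - k₀))
      have hm' : k - k₀ = -(m : ℤ) := by omega
      rw [hk, hm', Int.natAbs_neg, Int.natAbs_natCast, zpow_neg, zpow_natCast, ← div_div, ha,
        inv_pow, div_inv_eq_mul, mul_inv]
      gcongr
  have hsum := (hasSum_pow_natAbs ha0.le (by linarith)).mul_left (√T)
  have hsum' : HasSum (fun k : ℤ => √T * a ^ (k - k₀).natAbs)
      (√T * ((1 - a)⁻¹ + a * (1 - a)⁻¹)) :=
    ((Equiv.subRight k₀).hasSum_iff (f := fun k : ℤ => √T * a ^ k.natAbs)).2 hsum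
  have hS : Summable (fun k : ℤ => scaleMin (x / T ^ k)) :=
    Summable.of_nonneg_of_le (fun k => scaleMin_nonneg (by positivity)) hbound hsum'.summable
  refine ⟨hS, k₀, ?_⟩
  have e := hsum'.summable.tsum_eq_add_tsum_ite k₀
  rw [hsum'.tsum_eq, sub_self, Int.natAbs_zero, pow_zero, mul_one] at e
  have hite : ∀ f : ℤ → ℝ, Summable f → Summable fun k => if k = k₀ then 0 else f k := by
    intro f hf
    refine (hf.indicator {k₀}ᶜ).congr fun k => ?_
    by_cases h : k = k₀ <;> simp [h]
  calc _ ≤ ∑' k : ℤ, (if k = k₀ then 0 else √T * a ^ (k - k₀).natAbs) := by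
        refine hasSum_le (fun k => ?_) (hite _ hS).hasSum (hite _ hsum'.summable).hasSum
        split_ifs
        · exact le_rfl
        · exact hbound k
    _ = √T * ((1 - a)⁻¹ + a * (1 - a)⁻¹) - √T := by linarith
    _ = √T * a * (2 * (1 - a)⁻¹) := by
        have : (1 - a) ≠ 0 := by linarith
        field_simp; ring
    _ ≤ √T * a * (2 * 2) := by
        have : (1 - a)⁻¹ ≤ 2 := by
          rw [inv_le_comm₀ (by linarith) two_pos]; linarith
        gcongr
    _ = _ := by
        rw [ha]
        have : T⁻¹ = (√T)⁻¹ * (√T)⁻¹ := by rw [← mul_inv, hss]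
        rw [this]; field_simp; norm_num

lemma tsum_scaleMin_le {T : ℝ} (hT : 2 ≤ T) {x : ℝ} (hx : 0 < x) :
    ∑' k : ℤ, scaleMin (x / T ^ k) ≤ 5 := by
  have h0 : 0 < T := by linarith
  obtain ⟨hs, k₀, hk⟩ := exists_tsum_scaleMin_le hT hx
  rw [hs.tsum_eq_add_tsum_ite k₀]
  have h1 : scaleMin (x / T ^ k₀) ≤ 1 := scaleMin_le_one _
  have h2 : (√T)⁻¹ ≤ 1 := inv_le_one_of_one_le₀ (Real.one_le_sqrt.2 (by linarith))
  linarith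

end ScaleMin

/-! ### The bubbles -/

section Bubbles

variable {n : ℕ} {T : ℝ}

/-- The bubbles are multiples of the regularized fundamental solutions, whose derivatives and
equation are already computed. -/
lemma bubbleScaled_eq {s : ℝ} (hs : 0 < s) (p : Heis n) :
    bubbleScaled n s p = (2 * (n : ℝ)) ^ n * s ^ n * greenReg s p := by
  have hq := quart_pos hs p
  have e1 : (dil s⁻¹ p).2 ^ 2 + (1 + zSq (dil s⁻¹ p)) ^ 2 = (s ^ 4)⁻¹ * quart s p := by
    have := quart_dil s⁻¹ s p
    rw [inv_mul_cancel₀ hs.ne', inv_pow] at this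
    rw [← this, quart, one_pow]
  have e2 : (homDim n - 2) / 4 = (n : ℝ) / 2 := by unfold homDim; ring
  have e3 : (2 - homDim n) / 2 = -(n : ℝ) := by unfold homDim; ring
  rw [bubbleScaled, bubble, e1, e2, e3, Real.mul_rpow (by positivity) hq.le, greenReg,
    Real.rpow_neg hs.le, Real.rpow_natCast, neg_div, Real.rpow_neg hq.le,
    Real.inv_rpow (by positivity), ← Real.rpow_natCast s 4, ← Real.rpow_mul hs.le,
    show ((4 : ℕ) : ℝ) * ((n : ℝ) / 2) = ((2 * n : ℕ) : ℝ) by push_cast; ring, Real.rpow_natCast]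
  have : 0 < quart s p ^ ((n : ℝ) / 2) := by positivity
  field_simp
  ring

lemma contDiff_bubbleScaled {s : ℝ} (hs : 0 < s) {m : WithTop ℕ∞} :
    ContDiff ℝ m (bubbleScaled n s) := by
  rw [show bubbleScaled n s = fun p => (2 * (n : ℝ)) ^ n * s ^ n * greenReg s p from
    funext fun p => bubbleScaled_eq hs p]
  exact contDiff_const.mul (contDiff_greenReg hs)

lemma bubbleScaled_nonneg {s : ℝ} (hs : 0 < s) (p : Heis n) : 0 ≤ bubbleScaled n s p := by
  rw [bubbleScaled_eq hs, greenReg]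
  have := quart_pos hs p
  positivity

lemma fieldDeriv_bubbleScaled (i : Fin n ⊕ Fin n) {s : ℝ} (hs : 0 < s) (p : Heis n) :
    fieldDeriv i (bubbleScaled n s) p
      = (2 * (n : ℝ)) ^ n * s ^ n * fieldDeriv i (greenReg s) p := by
  rw [show bubbleScaled n s = fun p => (2 * (n : ℝ)) ^ n * s ^ n * greenReg s p from
    funext fun p => bubbleScaled_eq hs p,
    fieldDeriv_const_mul i _ ((contDiff_greenReg hs (m := 1)).differentiable (by simp) p)]

/-- The bubbles solve the critical equation. -/
lemma sum_fieldDeriv_fieldDeriv_bubbleScaled (hn : 1 ≤ n) {s : ℝ} (hs : 0 < s) (p : Heis n) :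
    ∑ i, fieldDeriv i (fieldDeriv i (bubbleScaled n s)) p
      = -bubbleScaled n s p ^ (1 + 2 / (n : ℝ)) := by
  have hn0 : (0 : ℝ) < n := by exact_mod_cast hn
  have hq := quart_pos hs p
  have e : ∀ i, fieldDeriv i (fieldDeriv i (bubbleScaled n s)) p
      = (2 * (n : ℝ)) ^ n * s ^ n * fieldDeriv i (fieldDeriv i (greenReg s)) p := by
    intro i
    rw [show fieldDeriv i (bubbleScaled n s) =
      fun p => (2 * (n : ℝ)) ^ n * s ^ n * fieldDeriv i (greenReg s) p from
      funext fun p => fieldDeriv_bubbleScaled i hs p, fieldDeriv_const_mul]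
    exact (contDiff_fieldDeriv i (contDiff_greenReg hs)).differentiable (by simp) p
  rw [Finset.sum_congr rfl fun i _ => e i, ← Finset.mul_sum, sum_fieldDeriv_fieldDeriv_greenReg hs,
    bubbleScaled_eq hs, greenReg, massReg, mul_neg, neg_inj]
  have hb : (0 : ℝ) ≤ 2 * n * s := by positivity
  -- Here the constant `(2n)^n` is used: `(2ns)^n` to the power `1 + 2/n` is `(2ns)^{n+2} = (2ns)^n
  -- · 4n²s²`, and `D_s^{-n/2}` becomes `D_s^{-n/2-1}`.
  rw [← mul_pow, Real.mul_rpow (by positivity) (by positivity), ← Real.rpow_natCast (2 * n * s) n,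
    ← Real.rpow_mul hb, ← Real.rpow_mul hq.le,
    show (n : ℝ) * (1 + 2 / n) = ((n + 2 : ℕ) : ℝ) by push_cast; field_simp,
    show -(n : ℝ) / 2 * (1 + 2 / n) = -(n : ℝ) / 2 - 1 by field_simp; ring, Real.rpow_natCast,
    Real.rpow_natCast]
  ring

lemma quart_dil_div {s : ℝ} (hT : 0 < T) (p : Heis n) :
    quart s (dil T p) = T ^ 4 * quart (s / T) p := by
  rw [← quart_dil, mul_div_cancel₀ _ hT.ne']

/-- Composition with `δ_T` shifts the index in the family of scales `r / T^k`; this is the source of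
the homogeneity of the sum. -/
lemma bubbleScaled_dil {s : ℝ} (hT : 0 < T) (hs : 0 < s) (p : Heis n) :
    bubbleScaled n s (dil T p) = (T ^ n)⁻¹ * bubbleScaled n (s / T) p := by
  have hq := quart_pos (div_pos hs hT) p
  rw [bubbleScaled_eq hs, bubbleScaled_eq (div_pos hs hT), greenReg, greenReg,
    quart_dil_div hT, Real.mul_rpow (by positivity) hq.le, ← Real.rpow_natCast T 4,
    ← Real.rpow_mul hT.le, show ((4 : ℕ) : ℝ) * (-(n : ℝ) / 2) = -((2 * n : ℕ) : ℝ) by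
      push_cast; ring, Real.rpow_neg hT.le, Real.rpow_natCast, div_pow]
  field_simp
  ring

lemma fieldDeriv_bubbleScaled_dil (i : Fin n ⊕ Fin n) {s : ℝ} (hT : 0 < T) (hs : 0 < s)
    (p : Heis n) : fieldDeriv i (bubbleScaled n s) (dil T p)
      = (T ^ (n + 1))⁻¹ * fieldDeriv i (bubbleScaled n (s / T)) p := by
  have hd : ∀ s : ℝ, 0 < s → Differentiable ℝ (bubbleScaled n s) := fun s hs =>
    (contDiff_bubbleScaled hs (m := 1)).differentiable (by simp)
  have h1 := fieldDeriv_comp_dil i (hd s hs (dil T p))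
  simp only [bubbleScaled_dil hT hs] at h1
  rw [fieldDeriv_const_mul i _ (hd _ (div_pos hs hT) p)] at h1
  rw [pow_succ, mul_inv, mul_assoc, mul_left_comm, h1, inv_mul_cancel_left₀ hT.ne']

/-- From `D_s ≥ |p|⁴` comes the factor `(s/|p|)^n`, from `D_s ≥ s⁴` the factor `(|p|/s)^n`. -/
lemma bubbleScaled_le (hn : 1 ≤ n) {s : ℝ} (hs : 0 < s) {p : Heis n} (hp : p ≠ 0) :
    bubbleScaled n s p
      ≤ (2 * (n : ℝ)) ^ n * (homNorm p ^ n)⁻¹ * scaleMin (s / homNorm p) := by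
  have hρ := homNorm_pos hp
  have hx : 0 < s / homNorm p := div_pos hs hρ
  have e : bubbleScaled n s p = (2 * (n : ℝ)) ^ n * (homNorm p ^ n)⁻¹ *
      (homNorm p ^ n * s ^ n * greenReg s p) := by
    rw [bubbleScaled_eq hs]; field_simp
  rw [e]
  have hg : greenReg s p = quart s p ^ (-((n : ℝ) / 2)) := by rw [greenReg, neg_div]
  have e4 : -(4 * ((n : ℝ) / 2)) = -((2 * n : ℕ) : ℝ) := by push_cast; ring
  have b1 := quart_rpow_le s hp (a := (n : ℝ) / 2) (by positivity)
  have b2 := quart_rpow_le' hs p (a := (n : ℝ) / 2) (by positivity)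
  rw [← hg, e4, Real.rpow_neg hρ.le, Real.rpow_natCast] at b1
  rw [← hg, e4, Real.rpow_neg hs.le, Real.rpow_natCast] at b2
  gcongr
  refine le_scaleMin_of_le_pow hx hn hn ?_ ?_
  · calc _ ≤ homNorm p ^ n * s ^ n * (homNorm p ^ (2 * n))⁻¹ := by gcongr
      _ = _ := by rw [div_pow]; field_simp; ring
  · calc _ ≤ homNorm p ^ n * s ^ n * (s ^ (2 * n))⁻¹ := by gcongr
      _ = _ := by rw [inv_div, div_pow]; field_simp; ring

/-- The same two regimes, now with the factors `(s/|p|)^n` and `(|p|/s)^{n+2}`. -/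
lemma abs_fieldDeriv_bubbleScaled_le (hn : 1 ≤ n) (i : Fin n ⊕ Fin n) {s : ℝ} (hs : 0 < s)
    {p : Heis n} (hp : p ≠ 0) : |fieldDeriv i (bubbleScaled n s) p|
      ≤ (2 * (n : ℝ)) ^ (n + 1) * (homNorm p ^ (n + 1))⁻¹ * scaleMin (s / homNorm p) := by
  have hρ := homNorm_pos hp
  have hx : 0 < s / homNorm p := div_pos hs hρ
  set Q := quart s p ^ (-((n : ℝ) + 1) / 2) with hQ
  have hg : Q = quart s p ^ (-(((n : ℝ) + 1) / 2)) := by rw [hQ, neg_div]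
  have e4 : -(4 * (((n : ℝ) + 1) / 2)) = -((2 * n + 2 : ℕ) : ℝ) := by push_cast; ring
  have b1 := quart_rpow_le s hp (a := ((n : ℝ) + 1) / 2) (by positivity)
  have b2 := quart_rpow_le' hs p (a := ((n : ℝ) + 1) / 2) (by positivity)
  rw [← hg, e4, Real.rpow_neg hρ.le, Real.rpow_natCast] at b1
  rw [← hg, e4, Real.rpow_neg hs.le, Real.rpow_natCast] at b2
  rw [fieldDeriv_bubbleScaled i hs, abs_mul, abs_of_nonneg (by positivity)]
  calc _ ≤ (2 * (n : ℝ)) ^ n * s ^ n * (2 * n * Q * homNorm p) := by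
        gcongr; exact abs_fieldDeriv_greenReg_le i hs p
    _ = (2 * (n : ℝ)) ^ (n + 1) * (homNorm p ^ (n + 1))⁻¹ * (homNorm p ^ (n + 2) * s ^ n * Q) := by
        field_simp; ring
    _ ≤ _ := by
        gcongr
        refine le_scaleMin_of_le_pow hx hn (by omega : 1 ≤ n + 2) ?_ ?_
        · calc _ ≤ homNorm p ^ (n + 2) * s ^ n * (homNorm p ^ (2 * n + 2))⁻¹ := by gcongr
            _ = _ := by rw [div_pow]; field_simp; ring
        · calc _ ≤ homNorm p ^ (n + 2) * s ^ n * (s ^ (2 * n + 2))⁻¹ := by gcongr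
            _ = _ := by rw [inv_div, div_pow]; field_simp; ring

lemma bubbleScaled_rpow_le (hn : 1 ≤ n) {s : ℝ} (hs : 0 < s) {p : Heis n} (hp : p ≠ 0) :
    bubbleScaled n s p ^ (1 + 2 / (n : ℝ))
      ≤ (2 * (n : ℝ)) ^ (n + 2) * (homNorm p ^ (n + 2))⁻¹ * scaleMin (s / homNorm p) := by
  have hn0 : (0 : ℝ) < n := by exact_mod_cast hn
  have hρ := homNorm_pos hp
  have hx : 0 < s / homNorm p := div_pos hs hρ
  have hm := scaleMin_nonneg hx.le
  have e : ∀ a : ℝ, 0 ≤ a → (a ^ n) ^ (1 + 2 / (n : ℝ)) = a ^ (n + 2) := fun a ha => by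
    rw [← Real.rpow_natCast a n, ← Real.rpow_mul ha,
      show (n : ℝ) * (1 + 2 / n) = ((n + 2 : ℕ) : ℝ) by push_cast; field_simp, Real.rpow_natCast]
  calc _ ≤ ((2 * (n : ℝ)) ^ n * (homNorm p ^ n)⁻¹ * scaleMin (s / homNorm p)) ^
        (1 + 2 / (n : ℝ)) :=
        Real.rpow_le_rpow (bubbleScaled_nonneg hs p) (bubbleScaled_le hn hs hp) (by positivity)
    _ = (2 * (n : ℝ)) ^ (n + 2) * (homNorm p ^ (n + 2))⁻¹ *
        scaleMin (s / homNorm p) ^ (1 + 2 / (n : ℝ)) := by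
        rw [Real.mul_rpow (by positivity) hm, Real.mul_rpow (by positivity) (by positivity),
          e _ (by positivity), ← inv_pow, e _ (by positivity), inv_pow]
    _ ≤ _ := by
        gcongr
        calc scaleMin (s / homNorm p) ^ (1 + 2 / (n : ℝ)) ≤ scaleMin (s / homNorm p) ^ (1 : ℝ) :=
              Real.rpow_le_rpow_of_exponent_ge (scaleMin_pos hx) (scaleMin_le_one _)
                (by linarith [div_pos two_pos hn0])
          _ = _ := Real.rpow_one _

end Bubbles

/-! ### Series of functions with the decay of the bubbles -/

section Series

variable {n : ℕ} {T r : ℝ}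

lemma l2Loc_of_abs_le {u : Heis n → ℝ} (hm : AEStronglyMeasurable u volume) {C : ℝ} {m : ℕ}
    (h : ∀ p : Heis n, p ≠ 0 → |u p| ≤ C * (homNorm p ^ m)⁻¹) : L2Loc u := by
  intro K hK h0
  have : IsFiniteMeasure (volume.restrict K) := ⟨by
    rw [Measure.restrict_apply_univ]; exact hK.measure_lt_top⟩
  have hc : ContinuousOn (fun p : Heis n => C * (homNorm p ^ m)⁻¹) K :=
    continuousOn_const.mul ((continuous_homNorm.pow m).continuousOn.inv₀ fun p hp =>
      (pow_pos (homNorm_pos (h0 hp)) m).ne')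
  obtain ⟨B, hB⟩ := hK.exists_bound_of_continuousOn hc
  refine MemLp.of_bound hm.restrict B ?_
  filter_upwards [ae_restrict_mem hK.measurableSet] with p hp
  exact (h p (h0 hp)).trans ((le_abs_self _).trans (hB p hp))

lemma aestronglyMeasurable_tsum {α : Type*} [MeasurableSpace α] {μ : Measure α} {f : ℤ → α → ℝ}
    (hf : ∀ k, AEStronglyMeasurable (f k) μ) (hs : ∀ᵐ p ∂μ, Summable fun k => f k p) :
    AEStronglyMeasurable (fun p => ∑' k, f k p) μ := by
  refine aestronglyMeasurable_of_tendsto_ae (atTop : Filter (Finset ℤ))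
    (f := fun s p => ∑ k ∈ s, f k p) (fun s => ?_) ?_
  · exact Finset.aestronglyMeasurable_fun_sum s fun k _ => hf k
  · filter_upwards [hs] with p hp
    exact hp.hasSum

/-- The functions `f k` decay like the bubbles at the scales `r / T^k`. -/
def ScaleDecay (T r C : ℝ) (m : ℕ) (f : ℤ → Heis n → ℝ) : Prop :=
  ∀ k p, p ≠ 0 → |f k p| ≤ C * (homNorm p ^ m)⁻¹ * scaleMin (r / T ^ k / homNorm p)

variable {C : ℝ} {m : ℕ} {f : ℤ → Heis n → ℝ}

lemma summable_scaleMin (hT : 2 ≤ T) (hr : 0 < r) {p : Heis n} (hp : p ≠ 0) :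
    Summable (fun k : ℤ => scaleMin (r / T ^ k / homNorm p)) ∧
      ∑' k : ℤ, scaleMin (r / T ^ k / homNorm p) ≤ 5 := by
  have hx : 0 < r / homNorm p := div_pos hr (homNorm_pos hp)
  have e : ∀ k : ℤ, r / T ^ k / homNorm p = r / homNorm p / T ^ k := fun k => div_right_comm _ _ _
  simp only [e]
  exact ⟨(exists_tsum_scaleMin_le hT hx).1, tsum_scaleMin_le hT hx⟩

lemma ScaleDecay.summable_norm (h : ScaleDecay T r C m f) (hT : 2 ≤ T) (hr : 0 < r) {p : Heis n}
    (hp : p ≠ 0) : Summable fun k => |f k p| :=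
  Summable.of_nonneg_of_le (fun _ => abs_nonneg _) (fun k => h k p hp)
    ((summable_scaleMin hT hr hp).1.mul_left _)

lemma ScaleDecay.summable (h : ScaleDecay T r C m f) (hT : 2 ≤ T) (hr : 0 < r) {p : Heis n}
    (hp : p ≠ 0) : Summable fun k => f k p :=
  (h.summable_norm hT hr hp).of_abs

lemma ScaleDecay.abs_tsum_le (h : ScaleDecay T r C m f) (hC : 0 ≤ C) (hT : 2 ≤ T) (hr : 0 < r)
    {p : Heis n} (hp : p ≠ 0) : |∑' k, f k p| ≤ 5 * C * (homNorm p ^ m)⁻¹ := by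
  have hρ := homNorm_pos hp
  obtain ⟨h1, h2⟩ := summable_scaleMin hT hr hp
  calc |∑' k, f k p| ≤ ∑' k, |f k p| := by
        exact norm_tsum_le_tsum_norm (f := fun k => f k p) (h.summable_norm hT hr hp)
    _ ≤ C * (homNorm p ^ m)⁻¹ * ∑' k : ℤ, scaleMin (r / T ^ k / homNorm p) :=
        hasSum_le (fun k => h k p hp) (h.summable_norm hT hr hp).hasSum (h1.hasSum.mul_left _)
    _ ≤ C * (homNorm p ^ m)⁻¹ * 5 := by gcongr
    _ = _ := by ring

lemma ScaleDecay.aestronglyMeasurable_tsum (h : ScaleDecay T r C m f) (hT : 2 ≤ T) (hr : 0 < r)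
    (hf : ∀ k, AEStronglyMeasurable (f k) volume) :
    AEStronglyMeasurable (fun p => ∑' k, f k p) volume :=
  Heisenberg.aestronglyMeasurable_tsum hf (by
    filter_upwards [ae_ne_zero (n := n)] with p hp
    exact h.summable hT hr hp)

lemma ScaleDecay.l2Loc_tsum (h : ScaleDecay T r C m f) (hC : 0 ≤ C) (hT : 2 ≤ T) (hr : 0 < r)
    (hf : ∀ k, AEStronglyMeasurable (f k) volume) : L2Loc (fun p => ∑' k, f k p) :=
  l2Loc_of_abs_le (h.aestronglyMeasurable_tsum hT hr hf) fun _ hp => h.abs_tsum_le hC hT hr hp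

/-- The series of absolute values is itself locally `L²`, so its product with `|g|` dominates. This
allows termwise integration, hence termwise weak differentiation. -/
lemma ScaleDecay.hasSum_integral_mul (h : ScaleDecay T r C m f) (hC : 0 ≤ C) (hT : 2 ≤ T)
    (hr : 0 < r) (hf : ∀ k, AEStronglyMeasurable (f k) volume) {g : Heis n → ℝ}
    (hg : Continuous g) (hc : HasCompactSupport g) (h0 : tsupport g ⊆ {0}ᶜ) :
    HasSum (fun k => ∫ p, f k p * g p) (∫ p, (∑' k, f k p) * g p) := by
  have hT0 : 0 < T := by linarith
  have habs : ScaleDecay T r C m fun k p => |f k p| := fun k p hp => by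
    rw [abs_abs]; exact h k p hp
  have habsm : ∀ k, AEStronglyMeasurable (fun p => |f k p|) volume := fun k => (hf k).norm
  refine hasSum_integral_of_dominated_convergence (fun k p => |f k p| * |g p|)
    (fun k => (hf k).mul hg.aestronglyMeasurable)
    (fun k => ae_of_all _ fun p => by rw [Real.norm_eq_abs, abs_mul]) ?_ ?_ ?_
  · filter_upwards [ae_ne_zero (n := n)] with p hp
    exact (habs.summable hT hr hp).mul_right _
  · simp only [tsum_mul_right]
    refine (habs.l2Loc_tsum hC hT hr habsm).integrable_mul hg.abs ?_ ?_
    · exact hc.norm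
    · have : tsupport (fun p => |g p|) = tsupport g := by
        unfold tsupport; congr 1; ext p; simp
      rw [this]; exact h0
  · filter_upwards [ae_ne_zero (n := n)] with p hp
    exact (h.summable hT hr hp).hasSum.mul_right _

end Series

/-! ### The periodized bubble as an element of `X_T` -/

section Periodized

variable {n : ℕ} {T r : ℝ}

lemma scaleDecay_bubbleScaled (hn : 1 ≤ n) (hT : 0 < T) (hr : 0 < r) :
    ScaleDecay T r ((2 * (n : ℝ)) ^ n) n fun k => bubbleScaled n (r / T ^ k) := fun k p hp => by
  have hs : 0 < r / T ^ k := by positivity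
  rw [abs_of_nonneg (bubbleScaled_nonneg hs p)]
  exact bubbleScaled_le hn hs hp

lemma scaleDecay_fieldDeriv_bubbleScaled (hn : 1 ≤ n) (hT : 0 < T) (hr : 0 < r)
    (i : Fin n ⊕ Fin n) : ScaleDecay T r ((2 * (n : ℝ)) ^ (n + 1)) (n + 1)
      fun k => fieldDeriv i (bubbleScaled n (r / T ^ k)) := fun k _ hp =>
  abs_fieldDeriv_bubbleScaled_le hn i (by positivity) hp

lemma scaleDecay_bubbleScaled_rpow (hn : 1 ≤ n) (hT : 0 < T) (hr : 0 < r) :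
    ScaleDecay T r ((2 * (n : ℝ)) ^ (n + 2)) (n + 2)
      fun k p => bubbleScaled n (r / T ^ k) p ^ (1 + 2 / (n : ℝ)) := fun k p hp => by
  have hs : 0 < r / T ^ k := by positivity
  rw [abs_of_nonneg (Real.rpow_nonneg (bubbleScaled_nonneg hs p) _)]
  exact bubbleScaled_rpow_le hn hs hp

lemma periodizedBubble_dil (hT : 0 < T) (hr : 0 < r) (p : Heis n) :
    periodizedBubble n r T (dil T p) = (T ^ n)⁻¹ * periodizedBubble n r T p := by
  have e : ∀ k : ℤ, r / T ^ k / T = r / T ^ (k + 1) := fun k => by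
    rw [zpow_add_one₀ hT.ne', div_div]
  unfold periodizedBubble
  rw [← tsum_mul_left, ← (Equiv.addRight (1 : ℤ)).tsum_eq
    fun k => (T ^ n)⁻¹ * bubbleScaled n (r / T ^ k) p]
  refine tsum_congr fun k => ?_
  rw [bubbleScaled_dil hT (by positivity), e, Equiv.coe_addRight]

lemma periodizedBubble_nonneg (hT : 0 < T) (hr : 0 < r) (p : Heis n) :
    0 ≤ periodizedBubble n r T p :=
  tsum_nonneg fun _ => bubbleScaled_nonneg (by positivity) p

/-- The periodized bubble belongs to `X_T`, and its gradient is the sum of the gradients. -/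
theorem exists_periodizedBubble (hn : 1 ≤ n) (hT : 1 < T) (hT2 : 2 ≤ T) (hr : 0 < r) :
    ∃ Ψ : X n T hT, Ψ.toFun =ᵐ[volume] periodizedBubble n r T ∧
      ∀ i, Ψ.grad i =ᵐ[volume] fun p => ∑' k : ℤ, fieldDeriv i (bubbleScaled n (r / T ^ k)) p := by
  have h0 : 0 < T := by linarith
  have hsm : ∀ k : ℤ, ContDiff ℝ ∞ (bubbleScaled n (r / T ^ k)) := fun k =>
    contDiff_bubbleScaled (by positivity)
  have hd := scaleDecay_bubbleScaled (n := n) hn h0 hr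
  have hm : ∀ k : ℤ, AEStronglyMeasurable (bubbleScaled n (r / T ^ k)) volume := fun k =>
    (hsm k).continuous.aestronglyMeasurable
  refine X.exists_of_isWeakDeriv hT (hd.aestronglyMeasurable_tsum hT2 hr hm)
    (hd.l2Loc_tsum (by positivity) hT2 hr hm) (fun i => ?_)
    (ae_of_all _ (periodizedBubble_dil h0 hr))
  have hdi := scaleDecay_fieldDeriv_bubbleScaled (n := n) hn h0 hr i
  have hmi : ∀ k : ℤ, AEStronglyMeasurable (fieldDeriv i (bubbleScaled n (r / T ^ k))) volume :=
    fun k => (contDiff_fieldDeriv i (hsm k)).continuous.aestronglyMeasurable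
  refine ⟨hdi.l2Loc_tsum (by positivity) hT2 hr hmi, fun φ hφ => ?_⟩
  have s1 := hd.hasSum_integral_mul (by positivity) hT2 hr hm
    (contDiff_fieldDeriv i hφ.smooth).continuous (hasCompactSupport_fieldDeriv i hφ.compact)
    ((tsupport_fieldDeriv_subset i φ).trans hφ.support)
  have s2 := hdi.hasSum_integral_mul (by positivity) hT2 hr hmi hφ.smooth.continuous hφ.compact
    hφ.support
  -- Each bubble is smooth on the whole group, so the integration by parts is classical term by
  -- term.
  have e : (fun k : ℤ => ∫ p, bubbleScaled n (r / T ^ k) p * fieldDeriv i φ p)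
      = fun k : ℤ => -∫ p, fieldDeriv i (bubbleScaled n (r / T ^ k)) p * φ p := funext fun k =>
    integral_mul_fieldDeriv i (hsm k) hφ.smooth hφ.compact
  rw [e] at s1
  exact s1.unique s2.neg

end Periodized

/-! ### The weak form of the equation for the periodized bubble -/

section WeakEquation

variable {n : ℕ} {T r : ℝ}

/-- The integral of `F` is the same over every shell, and on the shell of index `k` the weight is at
most `T · scaleMin (r / T^k)`, which is summable in `k`. -/
lemma lintegral_scaleMin_mul_ne_top (hT : 2 ≤ T) (hr : 0 < r) {F : Heis n → ℝ≥0∞}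
    (hF : ∀ᵐ p, F (dil T p) = ENNReal.ofReal ((T ^ (2 * n + 2))⁻¹) * F p)
    (hfin : ∫⁻ p in annulus n T, F p ≠ ⊤) :
    ∫⁻ p, ENNReal.ofReal (scaleMin (r / homNorm p)) * F p ≠ ⊤ := by
  have h0 : 0 < T := by linarith
  have hT1 : 1 < T := by linarith
  have hle : ∀ k : ℤ, ∫⁻ p in shell n T k, ENNReal.ofReal (scaleMin (r / homNorm p)) * F p
      ≤ ENNReal.ofReal (T * scaleMin (r / T ^ k)) * ∫⁻ p in annulus n T, F p := by
    intro k
    have hk : 0 < T ^ k := zpow_pos h0 k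
    rw [← setLIntegral_shell_eq hT1 hF k, ← lintegral_const_mul' _ _ ENNReal.ofReal_ne_top]
    refine setLIntegral_mono' (measurableSet_shell T k) fun p hp => ?_
    refine mul_le_mul' (ENNReal.ofReal_le_ofReal ?_) le_rfl
    have hp1 : T ^ k ≤ homNorm p := hp.1
    have hp2 : homNorm p ≤ T * T ^ k := by
      have := hp.2.le
      rwa [zpow_add_one₀ h0.ne', mul_comm] at this
    have hρ : 0 < homNorm p := hk.trans_le hp1
    unfold scaleMin
    rw [mul_min_of_nonneg _ _ h0.le]
    refine min_le_min ?_ ?_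
    · calc r / homNorm p ≤ r / T ^ k := by gcongr
        _ ≤ T * (r / T ^ k) := le_mul_of_one_le_left (by positivity) hT1.le
    · rw [inv_div, inv_div, ← mul_div_assoc]
      gcongr
  rw [lintegral_eq_tsum_shell hT1]
  refine ne_top_of_le_ne_top ?_ (ENNReal.tsum_le_tsum hle)
  rw [ENNReal.tsum_mul_right]
  refine ENNReal.mul_ne_top ?_ hfin
  rw [← ENNReal.ofReal_tsum_of_nonneg
    (fun k => mul_nonneg h0.le (scaleMin_nonneg (by positivity)))
    ((exists_tsum_scaleMin_le hT hr).1.mul_left T)]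
  exact ENNReal.ofReal_ne_top

/-- Integrability on `ℍⁿ` of the product of a function with the decay of the bubbles and of a
function homogeneous under `δ_T`. -/
lemma integrable_of_abs_le_scaleMin (hT : 2 ≤ T) (hr : 0 < r) {w G : Heis n → ℝ} {a m : ℕ}
    (ham : a + m = 2 * n + 2) (hw : L2Loc w) (hwh : ∀ᵐ p, w (dil T p) = (T ^ a)⁻¹ * w p)
    (hG : AEStronglyMeasurable G volume) {C : ℝ} (hC : 0 ≤ C)
    (h : ∀ p, p ≠ 0 → |G p| ≤ C * (homNorm p ^ m)⁻¹ * scaleMin (r / homNorm p) * |w p|) :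
    Integrable G := by
  have h0 : 0 < T := by linarith
  set F : Heis n → ℝ≥0∞ := fun p => ENNReal.ofReal ((homNorm p ^ m)⁻¹ * |w p|) with hF
  have hFh : ∀ᵐ p, F (dil T p) = ENNReal.ofReal ((T ^ (2 * n + 2))⁻¹) * F p := by
    filter_upwards [hwh] with p hp
    simp only [hF]
    rw [← ENNReal.ofReal_mul (by positivity), hp, homNorm_dil h0.le, abs_mul,
      abs_of_pos (by positivity : 0 < (T ^ a)⁻¹), mul_pow, mul_inv, ← ham, pow_add, mul_inv]
    congr 1; ring
  have hfin : ∫⁻ p in annulus n T, F p ≠ ⊤ := by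
    have : IsFiniteMeasure (volume.restrict (annulus n T)) := ⟨by
      rw [Measure.restrict_apply_univ]; exact (isCompact_annulus n T).measure_lt_top⟩
    have hi := (hw _ (isCompact_annulus n T) (annulus_subset n T)).integrable (by norm_num)
    refine ne_top_of_le_ne_top hi.2.ne
      (setLIntegral_mono' (isCompact_annulus n T).measurableSet fun p hp => ?_)
    rw [Real.enorm_eq_ofReal_abs]
    refine ENNReal.ofReal_le_ofReal (mul_le_of_le_one_left (abs_nonneg _) ?_)
    exact inv_le_one_of_one_le₀ (one_le_pow₀ hp.1)
  have key := lintegral_scaleMin_mul_ne_top hT hr hFh hfin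
  refine ⟨hG, ?_⟩
  have hle : ∫⁻ p, ‖G p‖ₑ ≤ ∫⁻ p, ENNReal.ofReal C *
      (ENNReal.ofReal (scaleMin (r / homNorm p)) * F p) := by
    refine lintegral_mono_ae ?_
    filter_upwards [ae_ne_zero (n := n)] with p hp
    have hρ := homNorm_pos hp
    rw [Real.enorm_eq_ofReal_abs, hF, ← ENNReal.ofReal_mul (scaleMin_nonneg (by positivity)),
      ← ENNReal.ofReal_mul hC]
    refine ENNReal.ofReal_le_ofReal ((h p hp).trans (le_of_eq (by ring)))
  refine hle.trans_lt ?_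
  rw [lintegral_const_mul' _ _ ENNReal.ofReal_ne_top]
  exact ENNReal.mul_lt_top ENNReal.ofReal_lt_top key.lt_top

lemma ScaleDecay.integrable_mul {C : ℝ} {m a : ℕ} {f : ℤ → Heis n → ℝ} {w : Heis n → ℝ}
    (h : ScaleDecay T r C m f) (hC : 0 ≤ C) (hT : 2 ≤ T) (hr : 0 < r)
    (hf : ∀ k, AEStronglyMeasurable (f k) volume) (ham : a + m = 2 * n + 2) (hw : L2Loc w)
    (hwm : AEStronglyMeasurable w volume) (hwh : ∀ᵐ p, w (dil T p) = (T ^ a)⁻¹ * w p) :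
    Integrable fun p => f 0 p * w p := by
  refine integrable_of_abs_le_scaleMin hT hr ham hw hwh ((hf 0).mul hwm) hC fun p hp => ?_
  rw [abs_mul]
  gcongr
  simpa using h 0 p hp

/-- Unfolding of an integral over `ℍⁿ` into an integral over the annulus. -/
lemma ScaleDecay.integral_mul_eq {C : ℝ} {m a : ℕ} {f : ℤ → Heis n → ℝ} {w : Heis n → ℝ}
    (h : ScaleDecay T r C m f) (hC : 0 ≤ C) (hT : 2 ≤ T) (hr : 0 < r)
    (hf : ∀ k, AEStronglyMeasurable (f k) volume)
    (hfh : ∀ k p, f k (dil T p) = (T ^ m)⁻¹ * f (k + 1) p) (ham : a + m = 2 * n + 2)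
    (hw : L2Loc w) (hwm : AEStronglyMeasurable w volume)
    (hwh : ∀ᵐ p, w (dil T p) = (T ^ a)⁻¹ * w p) :
    ∫ p, f 0 p * w p = ∫ p in annulus n T, (∑' k, f k p) * w p := by
  rw [integral_unfold (by linarith : 1 < T) (H := fun k p => f k p * w p)
    (fun k => (hf k).mul hwm) (h.integrable_mul hC hT hr hf ham hw hwm hwh)]
  · simp only [tsum_mul_right]
  · intro k
    filter_upwards [hwh] with p hp
    rw [hp, hfh, ← ham, pow_add, mul_inv]; ring

lemma tendsto_logCutoff {p : Heis n} (hp : p ≠ 0) :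
    Tendsto (fun j : ℕ => logCutoff ((j : ℝ) + 1) p) atTop (𝓝 1) := by
  refine tendsto_const_nhds.congr' ?_
  obtain ⟨N, hN⟩ := exists_nat_ge (4 * |Real.log (homNorm p)|)
  filter_upwards [eventually_ge_atTop N] with j hj
  have hj' : (N : ℝ) ≤ j := by exact_mod_cast hj
  exact (logCutoff_eq_one (by positivity) hp (by linarith)).symm

lemma tendsto_fieldDeriv_logCutoff (i : Fin n ⊕ Fin n) {p : Heis n} (hp : p ≠ 0) :
    Tendsto (fun j : ℕ => fieldDeriv i (logCutoff ((j : ℝ) + 1)) p) atTop (𝓝 0) := by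
  obtain ⟨M, hM, hMb⟩ := exists_abs_fieldDeriv_logCutoff_le (n := n)
  have h1 : Tendsto (fun j : ℕ => M / ((j : ℝ) + 1) * (homNorm p)⁻¹) atTop (𝓝 0) := by
    have : Tendsto (fun j : ℕ => M / ((j : ℝ) + 1)) atTop (𝓝 0) :=
      Tendsto.const_div_atTop (tendsto_atTop_add_const_right _ _ tendsto_natCast_atTop_atTop) M
    simpa using this.mul_const (homNorm p)⁻¹
  exact squeeze_zero_norm (fun j => hMb _ (by positivity) i p hp) h1

/-- The bubbles are weak solutions of the critical equation against the elements of `X_T`. -/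
lemma sum_integral_fieldDeriv_bubbleScaled (hn : 1 ≤ n) {hT : 1 < T} (hT2 : 2 ≤ T) (hr : 0 < r)
    (ψ : X n T hT) : ∑ i, ∫ p, fieldDeriv i (bubbleScaled n r) p * ψ.grad i p
      = ∫ p, bubbleScaled n r p ^ (1 + 2 / (n : ℝ)) * ψ.toFun p := by
  obtain ⟨M, hM, hMb⟩ := exists_abs_fieldDeriv_logCutoff_le (n := n)
  have hn0 : (0 : ℝ) < n := by exact_mod_cast hn
  set W := bubbleScaled n r with hW
  set e : ℝ := 1 + 2 / (n : ℝ) with he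
  have hsm : ContDiff ℝ ∞ W := contDiff_bubbleScaled hr
  have hsmi : ∀ i, ContDiff ℝ ∞ (fieldDeriv i W) := fun i => contDiff_fieldDeriv i hsm
  have hψm : AEStronglyMeasurable ψ.toFun volume := ψ.measurable_toFun.aestronglyMeasurable
  have hWc : Continuous fun p => W p ^ e :=
    hsm.continuous.rpow_const fun p => Or.inr (by positivity)
  -- The elements of `X_T` are neither compactly supported nor controlled at the origin. These
  -- cutoffs exhaust the punctured space with gradients at most `M / ((j+1) |p|)`.
  set η : ℕ → Heis n → ℝ := fun j => logCutoff ((j : ℝ) + 1) with hη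
  have hηt : ∀ j, IsTest (η j) := fun j => isTest_logCutoff (by positivity)
  have hη1 : ∀ j p, |η j p| ≤ 1 := fun j p => by
    have := logCutoff_mem_Icc (n := n) ((j : ℝ) + 1) p
    rw [abs_of_nonneg this.1]; exact this.2
  have hηm : ∀ j, AEStronglyMeasurable (η j) volume := fun j =>
    (hηt j).smooth.continuous.aestronglyMeasurable
  have i1 : Integrable fun p => W p ^ e * ψ.toFun p := by
    refine integrable_of_abs_le_scaleMin hT2 hr (by ring : n + (n + 2) = 2 * n + 2) ψ.l2Loc_toFun
      ψ.toFun_dil (hWc.aestronglyMeasurable.mul hψm) (by positivity : 0 ≤ (2 * (n : ℝ)) ^ (n + 2))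
      fun p hp => ?_
    rw [abs_mul, abs_of_nonneg (Real.rpow_nonneg (bubbleScaled_nonneg hr p) _)]
    gcongr
    exact bubbleScaled_rpow_le hn hr hp
  have i2 : ∀ i, Integrable fun p => fieldDeriv i W p * ψ.grad i p := fun i => by
    refine integrable_of_abs_le_scaleMin hT2 hr (by ring : (n + 1) + (n + 1) = 2 * n + 2)
      (ψ.grad_spec i).1 (ψ.grad_dil i) ((hsmi i).continuous.aestronglyMeasurable.mul
        (ψ.aemeasurable_grad i).aestronglyMeasurable)
      (by positivity : 0 ≤ (2 * (n : ℝ)) ^ (n + 1)) fun p hp => ?_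
    rw [abs_mul]
    gcongr
    exact abs_fieldDeriv_bubbleScaled_le hn i hr hp
  -- This function dominates the terms containing the gradient of the cutoff: the factor `|p|⁻¹`
  -- completes the exponents of `ψ` and of the gradient of the bubble to `n + (n + 2) = Q`.
  have i3 : ∀ i, Integrable fun p => M * (homNorm p)⁻¹ * (ψ.toFun p * fieldDeriv i W p) :=
    fun i => by
    refine integrable_of_abs_le_scaleMin hT2 hr (by ring : n + (n + 2) = 2 * n + 2) ψ.l2Loc_toFun
      ψ.toFun_dil ((measurable_homNorm.inv.const_mul M).aestronglyMeasurable.mul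
        (hψm.mul (hsmi i).continuous.aestronglyMeasurable))
      (by positivity : 0 ≤ M * (2 * (n : ℝ)) ^ (n + 1)) fun p hp => ?_
    have hρ := homNorm_pos hp
    rw [abs_mul, abs_of_pos (by positivity : 0 < M * (homNorm p)⁻¹), abs_mul]
    calc _ ≤ M * (homNorm p)⁻¹ * (|ψ.toFun p| * ((2 * (n : ℝ)) ^ (n + 1) *
          (homNorm p ^ (n + 1))⁻¹ * scaleMin (r / homNorm p))) := by
          gcongr; exact abs_fieldDeriv_bubbleScaled_le hn i hr hp
      _ = _ := by rw [pow_succ (homNorm p) (n + 1), mul_inv]; ring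
  have lA : Tendsto (fun j => ∫ p, η j p * (W p ^ e * ψ.toFun p)) atTop
      (𝓝 (∫ p, W p ^ e * ψ.toFun p)) := by
    refine tendsto_integral_of_dominated_convergence (fun p => |W p ^ e * ψ.toFun p|)
      (fun j => (hηm j).mul i1.1) i1.abs (fun j => ae_of_all _ fun p => ?_) ?_
    · rw [Real.norm_eq_abs, abs_mul]
      exact mul_le_of_le_one_left (abs_nonneg _) (hη1 j p)
    · filter_upwards [ae_ne_zero (n := n)] with p hp
      simpa using (tendsto_logCutoff hp).mul_const (W p ^ e * ψ.toFun p)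
  have lB : ∀ i, Tendsto (fun j => ∫ p, (η j p * ψ.grad i p + ψ.toFun p * fieldDeriv i (η j) p) *
      fieldDeriv i W p) atTop (𝓝 (∫ p, fieldDeriv i W p * ψ.grad i p)) := by
    intro i
    refine tendsto_integral_of_dominated_convergence (fun p => |fieldDeriv i W p * ψ.grad i p|
      + |M * (homNorm p)⁻¹ * (ψ.toFun p * fieldDeriv i W p)|) (fun j => ?_)
      ((i2 i).abs.add (i3 i).abs) (fun j => ?_) ?_
    · exact (((hηm j).mul (ψ.aemeasurable_grad i).aestronglyMeasurable).add
        (hψm.mul (contDiff_fieldDeriv i (hηt j).smooth).continuous.aestronglyMeasurable)).mul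
        (hsmi i).continuous.aestronglyMeasurable
    · filter_upwards [ae_ne_zero (n := n)] with p hp
      have hρ := homNorm_pos hp
      rw [Real.norm_eq_abs, add_mul]
      refine (abs_add_le _ _).trans (add_le_add ?_ ?_)
      · rw [mul_assoc, abs_mul, mul_comm (ψ.grad i p)]
        exact mul_le_of_le_one_left (abs_nonneg _) (hη1 j p)
      · rw [mul_right_comm, mul_comm, abs_mul, abs_mul (M * _)]
        refine mul_le_mul_of_nonneg_right ?_ (abs_nonneg _)
        refine (hMb _ (by positivity) i p hp).trans ((le_abs_self _).trans' ?_)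
        gcongr
        exact div_le_self hM.le (by linarith [(Nat.cast_nonneg j : (0 : ℝ) ≤ j)])
    · filter_upwards [ae_ne_zero (n := n)] with p hp
      have := (((tendsto_logCutoff hp).mul_const (ψ.grad i p)).add
        ((tendsto_fieldDeriv_logCutoff i hp).const_mul (ψ.toFun p))).mul_const (fieldDeriv i W p)
      simpa [mul_comm] using this
  have hAB : ∀ j, ∫ p, η j p * (W p ^ e * ψ.toFun p) =
      ∑ i, ∫ p, (η j p * ψ.grad i p + ψ.toFun p * fieldDeriv i (η j) p) * fieldDeriv i W p := by
    intro j
    have hI : ∀ i, Integrable fun p => η j p * ψ.toFun p * fieldDeriv i (fieldDeriv i W) p :=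
      fun i => by
      have hs : tsupport (fun p => η j p * fieldDeriv i (fieldDeriv i W) p) ⊆ tsupport (η j) :=
        tsupport_mul_subset_left
      refine (ψ.l2Loc_toFun.integrable_mul (g := fun p => η j p * fieldDeriv i (fieldDeriv i W) p)
        ?_ (hηt j).compact.mul_right (hs.trans (hηt j).support)).congr
        (ae_of_all _ fun p => by ring)
      exact (hηt j).smooth.continuous.mul (contDiff_fieldDeriv i (hsmi i)).continuous
    have h1 : ∀ i, ∫ p, (η j p * ψ.grad i p + ψ.toFun p * fieldDeriv i (η j) p) * fieldDeriv i W p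
        = -∫ p, η j p * ψ.toFun p * fieldDeriv i (fieldDeriv i W) p := fun i => by
      rw [integral_cutoff_mul_fieldDeriv ψ.l2Loc_toFun (ψ.grad_spec i) (hηt j) (hsmi i), neg_neg]
    simp only [h1]
    rw [Finset.sum_neg_distrib, ← integral_finsetSum _ fun i _ => hI i, ← integral_neg]
    refine integral_congr_ae (ae_of_all _ fun p => ?_)
    dsimp only
    rw [← Finset.mul_sum, sum_fieldDeriv_fieldDeriv_bubbleScaled hn hr]
    ring
  refine tendsto_nhds_unique (tendsto_finsetSum _ fun i _ => lB i) (lA.congr hAB)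

/-- The weak equation satisfied by the periodized bubble. -/
theorem inner_periodizedBubble (hn : 1 ≤ n) {hT : 1 < T} (hT2 : 2 ≤ T) (hr : 0 < r)
    {Ψ : X n T hT} (hΨ : ∀ i, Ψ.grad i =ᵐ[volume]
      fun p => ∑' k : ℤ, fieldDeriv i (bubbleScaled n (r / T ^ k)) p) (ψ : X n T hT) :
    inner ℝ Ψ ψ = ∫ p in annulus n T,
      (∑' k : ℤ, bubbleScaled n (r / T ^ k) p ^ (1 + 2 / (n : ℝ))) * ψ.toFun p := by
  have h0 : 0 < T := by linarith
  have hn0 : (0 : ℝ) < n := by exact_mod_cast hn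
  have hk : ∀ k : ℤ, 0 < r / T ^ k := fun k => by positivity
  have hdiv : ∀ k : ℤ, r / T ^ k / T = r / T ^ (k + 1) := fun k => by
    rw [zpow_add_one₀ h0.ne', div_div]
  have hψm : AEStronglyMeasurable ψ.toFun volume := ψ.measurable_toFun.aestronglyMeasurable
  have e1 : inner ℝ Ψ ψ = ∑ i, ∫ p in annulus n T,
      (∑' k : ℤ, fieldDeriv i (bubbleScaled n (r / T ^ k)) p) * ψ.grad i p := by
    rw [X.inner_eq, integral_finsetSum _ fun i _ => Ψ.integrable_grad_mul ψ i]
    refine Finset.sum_congr rfl fun i _ => integral_congr_ae ?_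
    filter_upwards [ae_restrict_of_ae (hΨ i)] with p hp
    rw [hp]
  -- Unfolding replaces the series on the annulus by a single bubble on the group; the exponents of
  -- the two gradients add up to `Q`. After the weak equation of that bubble, its power is folded
  -- back with the exponents `n` and `n + 2`.
  have e2 : ∀ i, ∫ p in annulus n T, (∑' k : ℤ, fieldDeriv i (bubbleScaled n (r / T ^ k)) p) *
      ψ.grad i p = ∫ p, fieldDeriv i (bubbleScaled n r) p * ψ.grad i p := fun i => by
    have := (scaleDecay_fieldDeriv_bubbleScaled hn h0 hr i).integral_mul_eq (by positivity) hT2 hr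
      (fun k => (contDiff_fieldDeriv i
        (contDiff_bubbleScaled (hk k))).continuous.aestronglyMeasurable)
      (fun k p => by rw [fieldDeriv_bubbleScaled_dil i h0 (hk k), hdiv])
      (by ring : (n + 1) + (n + 1) = 2 * n + 2) (ψ.grad_spec i).1
      (ψ.aemeasurable_grad i).aestronglyMeasurable (ψ.grad_dil i)
    rw [← this, zpow_zero, div_one]
  rw [e1, Finset.sum_congr rfl fun i _ => e2 i, sum_integral_fieldDeriv_bubbleScaled hn hT2 hr]
  have := (scaleDecay_bubbleScaled_rpow hn h0 hr).integral_mul_eq (by positivity) hT2 hr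
    (fun k => ((contDiff_bubbleScaled (n := n) (hk k) (m := 1)).continuous.rpow_const
      fun p => Or.inr (by positivity)).aestronglyMeasurable)
    (fun k p => by
      rw [bubbleScaled_dil h0 (hk k), hdiv,
        Real.mul_rpow (by positivity) (bubbleScaled_nonneg (hk (k + 1)) p),
        Real.inv_rpow (by positivity), ← Real.rpow_natCast T n, ← Real.rpow_mul h0.le,
        show (n : ℝ) * (1 + 2 / n) = ((n + 2 : ℕ) : ℝ) by push_cast; field_simp,
        Real.rpow_natCast])
    (by ring : n + (n + 2) = 2 * n + 2) ψ.l2Loc_toFun hψm ψ.toFun_dil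
  rw [← this, zpow_zero, div_one]

end WeakEquation

/-! ### Elementary inequalities for powers -/

section Powers

lemma abs_rpow_sub_rpow_le {e : ℝ} (he : 1 ≤ e) {x y M : ℝ} (hx : 0 ≤ x) (hxM : x ≤ M)
    (hy : 0 ≤ y) (hyM : y ≤ M) : |x ^ e - y ^ e| ≤ e * M ^ (e - 1) * |x - y| := by
  have h := Convex.norm_image_sub_le_of_norm_hasDerivWithin_le (𝕜 := ℝ) (f := fun t : ℝ => t ^ e)
    (f' := fun t => e * t ^ (e - 1)) (s := Set.Icc 0 M) (C := e * M ^ (e - 1))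
    (fun t _ => (Real.hasDerivAt_rpow_const (Or.inr he)).hasDerivWithinAt)
    (fun t ht => by
      rw [Real.norm_eq_abs, abs_of_nonneg (mul_nonneg (by linarith) (Real.rpow_nonneg ht.1 _))]
      exact mul_le_mul_of_nonneg_left (Real.rpow_le_rpow ht.1 ht.2 (by linarith)) (by linarith))
    (convex_Icc 0 M) ⟨hy, hyM⟩ ⟨hx, hxM⟩
  simpa [Real.norm_eq_abs] using h

/-- Second order Taylor estimate for `|t|^q`, `q > 2`, at a point of a bounded interval. -/
lemma abs_rpow_taylor_le {e : ℝ} (he : 1 < e) {a A h : ℝ} (ha : 0 ≤ a) (haA : a ≤ A) :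
    |(|a + h| ^ (e + 1) - |a| ^ (e + 1) - (e + 1) * (a ^ e * h))|
      ≤ (e + 1) * e * 2 ^ (e - 1) * max 1 (A ^ (e - 1)) * (h ^ 2 + |h| ^ (e + 1)) := by
  have hA : 0 ≤ A := ha.trans haA
  have he0 : 0 < e - 1 := by linarith
  set M := a + |h| with hM
  have hM0 : 0 ≤ M := by positivity
  -- The function `|t|^{e+1} - (e+1) a^e t` has zero derivative at `a`. Bounding its derivative by a
  -- multiple of `|h|` between `a` and `a + h` makes the mean value inequality give a quadratic
  -- remainder.
  have hbd : ∀ t ∈ Set.uIcc a (a + h),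
      ‖(e + 1) * |t| ^ (e + 1 - 2) * t - (e + 1) * a ^ e‖ ≤ (e + 1) * (e * M ^ (e - 1) * |h|) := by
    intro t ht
    have hth : |t - a| ≤ |h| := by simpa using Set.abs_sub_left_of_mem_uIcc ht
    have htM : |t| ≤ M := by
      calc |t| = |a + (t - a)| := by ring_nf
        _ ≤ |a| + |t - a| := abs_add_le _ _
        _ ≤ M := by rw [abs_of_nonneg ha]; linarith
    have haM : a ≤ M := by rw [hM]; linarith [abs_nonneg h]
    rw [mul_assoc, ← mul_sub, Real.norm_eq_abs, abs_mul, abs_of_pos (by linarith : 0 < e + 1)]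
    refine mul_le_mul_of_nonneg_left ?_ (by linarith)
    rw [show e + 1 - 2 = e - 1 by ring]
    have hpow : ∀ x : ℝ, 0 ≤ x → x ^ (e - 1) * x = x ^ e := fun x hx => by
      rcases hx.eq_or_lt with rfl | hx
      · rw [mul_zero, Real.zero_rpow (by linarith)]
      · rw [← Real.rpow_add_one hx.ne']; congr 1; ring
    have hMe : 0 ≤ M ^ (e - 1) := Real.rpow_nonneg hM0 _
    rcases le_total 0 t with h0 | h0
    · rw [abs_of_nonneg h0] at htM ⊢
      rw [hpow t h0]
      refine (abs_rpow_sub_rpow_le he.le h0 htM ha haM).trans ?_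
      gcongr
    -- When `t` and `a` lie on opposite sides of `0`, one has `|t - a| = |t| + a`, so the two powers
    -- are bounded separately.
    · have e1 : |t| ^ (e - 1) * t = -|t| ^ e := by
        rw [← hpow |t| (abs_nonneg t), abs_of_nonpos h0]; ring
      have e2 : |t - a| = |t| + a := by rw [abs_of_nonpos h0, abs_of_nonpos (by linarith)]; ring
      rw [e1, show -|t| ^ e - a ^ e = -(|t| ^ e + a ^ e) by ring, abs_neg,
        abs_of_nonneg (by positivity), ← hpow |t| (abs_nonneg t), ← hpow a ha]
      calc _ ≤ M ^ (e - 1) * |t| + M ^ (e - 1) * a := by gcongr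
        _ = 1 * M ^ (e - 1) * |t - a| := by rw [e2]; ring
        _ ≤ _ := by gcongr
  have key := Convex.norm_image_sub_le_of_norm_hasDerivWithin_le (𝕜 := ℝ)
    (f := fun t : ℝ => |t| ^ (e + 1) - (e + 1) * a ^ e * t)
    (f' := fun t => (e + 1) * |t| ^ (e + 1 - 2) * t - (e + 1) * a ^ e) (s := Set.uIcc a (a + h))
    (fun t _ => ((hasDerivAt_abs_rpow t (by linarith : 1 < e + 1)).sub
      (by simpa using (hasDerivAt_id t).const_mul ((e + 1) * a ^ e))).hasDerivWithinAt) hbd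
    (convex_uIcc a (a + h)) Set.left_mem_uIcc Set.right_mem_uIcc
  rw [Real.norm_eq_abs, Real.norm_eq_abs, add_sub_cancel_left] at key
  have hMle : M ^ (e - 1) ≤ 2 ^ (e - 1) * (max 1 (A ^ (e - 1)) * (1 + |h| ^ (e - 1))) := by
    calc M ^ (e - 1) ≤ (2 * max A |h|) ^ (e - 1) := by
          refine Real.rpow_le_rpow hM0 ?_ he0.le
          linarith [le_max_left A |h|, le_max_right A |h|]
      _ = 2 ^ (e - 1) * max A |h| ^ (e - 1) :=
          Real.mul_rpow two_pos.le (hA.trans (le_max_left _ _))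
      _ ≤ _ := by
          gcongr
          have m1 : (1 : ℝ) ≤ max 1 (A ^ (e - 1)) := le_max_left _ _
          have m2 : A ^ (e - 1) ≤ max 1 (A ^ (e - 1)) := le_max_right _ _
          have m3 : 0 ≤ |h| ^ (e - 1) := by positivity
          rcases max_cases A |h| with ⟨h1, _⟩ | ⟨h1, _⟩ <;> rw [h1] <;> nlinarith
  have hpow2 : |h| ^ (e - 1) * h ^ 2 = |h| ^ (e + 1) := by
    rcases eq_or_ne h 0 with rfl | hh
    · simp [Real.zero_rpow (by linarith : e + 1 ≠ 0)]
    · rw [← sq_abs, ← Real.rpow_natCast |h| 2, ← Real.rpow_add (abs_pos.2 hh)]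
      congr 1; push_cast; ring
  calc _ = |(|a + h| ^ (e + 1) - (e + 1) * a ^ e * (a + h) -
        (|a| ^ (e + 1) - (e + 1) * a ^ e * a))| := by congr 1; ring
    _ ≤ (e + 1) * (e * M ^ (e - 1) * |h|) * |h| := key
    _ = (e + 1) * e * h ^ 2 * M ^ (e - 1) := by rw [← sq_abs h]; ring
    _ ≤ (e + 1) * e * h ^ 2 * (2 ^ (e - 1) * (max 1 (A ^ (e - 1)) * (1 + |h| ^ (e - 1)))) := by
        gcongr
    _ = (e + 1) * e * 2 ^ (e - 1) * max 1 (A ^ (e - 1)) * (h ^ 2 + |h| ^ (e - 1) * h ^ 2) := by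
        ring
    _ = _ := by rw [hpow2]

end Powers

/-! ### The error of the periodized bubble -/

section Error

variable {n : ℕ} {T r : ℝ}

/-- Away from one index, the sum of a series with the decay of the bubbles is small. -/
lemma exists_tsum_ite_le (hT : 2 ≤ T) (hr : 0 < r) {p : Heis n} (hp : p ≠ 0) :
    ∃ k₀ : ℤ, ∀ (f : ℤ → Heis n → ℝ) (C : ℝ) (m : ℕ), 0 ≤ C → ScaleDecay T r C m f →
      |∑' k, (if k = k₀ then 0 else f k p)| ≤ 4 * C * (homNorm p ^ m)⁻¹ * (√T)⁻¹ := by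
  have hρ := homNorm_pos hp
  -- The index depends only on `T`, `r` and `|p|`, so the same one serves for the bubbles and for
  -- their powers.
  obtain ⟨hs, k₀, hk₀⟩ := exists_tsum_scaleMin_le hT (div_pos hr hρ)
  refine ⟨k₀, fun f C m hC h => ?_⟩
  have hite : ∀ f : ℤ → ℝ, Summable f → Summable fun k => if k = k₀ then 0 else f k := by
    intro f hf
    refine (hf.indicator {k₀}ᶜ).congr fun k => ?_
    by_cases h : k = k₀ <;> simp [h]
  have e : ∀ k : ℤ, r / T ^ k / homNorm p = r / homNorm p / T ^ k := fun k => div_right_comm _ _ _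
  have hle : ∀ k, ‖(if k = k₀ then 0 else f k p)‖ ≤ C * (homNorm p ^ m)⁻¹ *
      (if k = k₀ then 0 else scaleMin (r / homNorm p / T ^ k)) := fun k => by
    split_ifs
    · simp
    · rw [← e]; exact h k p hp
  have hsum := (hite _ hs).mul_left (C * (homNorm p ^ m)⁻¹)
  have h1 := tsum_of_norm_bounded hsum.hasSum hle
  rw [tsum_mul_left] at h1
  calc _ ≤ _ := h1
    _ ≤ C * (homNorm p ^ m)⁻¹ * (4 * (√T)⁻¹) := by gcongr
    _ = _ := by ring

/-- The periodized bubble is almost a solution of the critical equation. -/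
lemma exists_abs_periodizedBubble_rpow_sub_le (hn : 1 ≤ n) : ∃ C : ℝ, 0 < C ∧
    ∀ T r : ℝ, 2 ≤ T → 0 < r → ∀ p : Heis n, p ≠ 0 →
      |(∑' k : ℤ, bubbleScaled n (r / T ^ k) p ^ (1 + 2 / (n : ℝ)))
        - periodizedBubble n r T p ^ (1 + 2 / (n : ℝ))| ≤ C * (√T)⁻¹ * (homNorm p ^ (n + 2))⁻¹ := by
  have hn0 : (0 : ℝ) < n := by exact_mod_cast hn
  set e : ℝ := 1 + 2 / (n : ℝ) with he
  have he1 : 1 ≤ e := by rw [he]; linarith [div_pos two_pos hn0]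
  set c : ℝ := (2 * (n : ℝ)) ^ n with hc
  have hc0 : 0 < c := by positivity
  set D : ℝ := (5 * c) ^ (e - 1) with hD
  have hD0 : 0 < D := by positivity
  refine ⟨4 * (2 * (n : ℝ)) ^ (n + 2) + e * D * (4 * c), by positivity, ?_⟩
  intro T r hT hr p hp
  have h0 : 0 < T := by linarith
  have hρ := homNorm_pos hp
  obtain ⟨k₀, hk₀⟩ := exists_tsum_ite_le hT hr hp
  have d1 := scaleDecay_bubbleScaled (n := n) hn h0 hr
  have d2 := scaleDecay_bubbleScaled_rpow (n := n) hn h0 hr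
  have s1 := (d1.summable hT hr hp).tsum_eq_add_tsum_ite k₀
  have s2 := (d2.summable hT hr hp).tsum_eq_add_tsum_ite k₀
  have b1 := hk₀ _ _ _ hc0.le d1
  have b2 := hk₀ _ _ _ (by positivity) d2
  have hΨ : periodizedBubble n r T p = ∑' k : ℤ, bubbleScaled n (r / T ^ k) p := rfl
  have hΨ0 := periodizedBubble_nonneg h0 hr p
  have hk : ∀ k : ℤ, 0 ≤ bubbleScaled n (r / T ^ k) p := fun k =>
    bubbleScaled_nonneg (by positivity) p
  set a := bubbleScaled n (r / T ^ k₀) p with ha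
  set b := ∑' k : ℤ, (if k = k₀ then 0 else bubbleScaled n (r / T ^ k) p) with hb
  have hb0 : 0 ≤ b := tsum_nonneg fun k => by split_ifs <;> simp [hk]
  have hΨle : periodizedBubble n r T p ≤ 5 * c * (homNorm p ^ n)⁻¹ :=
    (le_abs_self _).trans (d1.abs_tsum_le hc0.le hT hr hp)
  have hΨab : periodizedBubble n r T p = a + b := hΨ.trans s1
  have hpw : (5 * c * (homNorm p ^ n)⁻¹) ^ (e - 1) = D * (homNorm p ^ 2)⁻¹ := by
    rw [Real.mul_rpow (by positivity) (by positivity), ← hD, Real.inv_rpow (by positivity),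
      ← Real.rpow_natCast (homNorm p) n, ← Real.rpow_mul hρ.le,
      show (n : ℝ) * (e - 1) = ((2 : ℕ) : ℝ) by rw [he]; push_cast; field_simp; ring,
      Real.rpow_natCast]
  -- The mean value bound: `Ψ - a` is the small sum `b`, while `Ψ^{e-1}` is at most a multiple of
  -- `|p|^{-2}` because `n (e - 1) = 2`.
  have b3 : |periodizedBubble n r T p ^ e - a ^ e| ≤
      e * (D * (homNorm p ^ 2)⁻¹) * (4 * c * (homNorm p ^ n)⁻¹ * (√T)⁻¹) := by
    have := abs_rpow_sub_rpow_le he1 hΨ0 hΨle (hk k₀) (by linarith : a ≤ _)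
    rw [hpw, hΨab, add_sub_cancel_left] at this
    rw [hΨab]
    exact this.trans (by gcongr)
  -- The dominant power `a ^ e` is moved from the series to the power of the sum, so that both
  -- resulting terms are small.
  calc _ = |(∑' k : ℤ, (if k = k₀ then 0 else bubbleScaled n (r / T ^ k) p ^ e))
        - (periodizedBubble n r T p ^ e - a ^ e)| := by rw [s2]; congr 1; ring
    _ ≤ 4 * (2 * (n : ℝ)) ^ (n + 2) * (homNorm p ^ (n + 2))⁻¹ * (√T)⁻¹ +
        e * (D * (homNorm p ^ 2)⁻¹) * (4 * c * (homNorm p ^ n)⁻¹ * (√T)⁻¹) :=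
        (abs_sub _ _).trans (add_le_add b2 b3)
    _ = _ := by rw [pow_add (homNorm p), mul_inv]; ring

/-- A consequence of the inequalities of Hardy and Cauchy–Schwarz. -/
lemma exists_lintegral_inv_mul_abs_le (hn : 1 ≤ n) : ∃ K T₁ : ℝ, 0 < K ∧ 1 < T₁ ∧
    ∀ (T : ℝ) (hT : 1 < T), T₁ ≤ T → ∀ u : X n T hT,
      ∫⁻ p in annulus n T, ENNReal.ofReal ((homNorm p ^ (n + 2))⁻¹ * |u.toFun p|)
        ≤ ENNReal.ofReal (K * Real.log T * ‖u‖) := by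
  obtain ⟨C, T₁, hC, hT₁, hardy⟩ := exists_hardy_X hn
  obtain ⟨c, hc, hcb⟩ := exists_setLIntegral_annulus_le n
  refine ⟨√c * √C, T₁, by positivity, hT₁, fun T hT hle u => ?_⟩
  have h0 : 0 < T := by linarith
  obtain ⟨hlog, hu⟩ := hardy T hT hle
  have hlog0 : 0 < Real.log T := by linarith
  have hm1 : AEMeasurable (fun p : Heis n => ENNReal.ofReal ((homNorm p ^ (n + 1))⁻¹))
      (volume.restrict (annulus n T)) := (measurable_ofReal_homNorm_pow_inv (n + 1)).aemeasurable
  have hm2 : AEMeasurable (fun p => ENNReal.ofReal (|u.toFun p| * (homNorm p)⁻¹))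
      (volume.restrict (annulus n T)) :=
    (u.measurable_toFun.abs.mul measurable_homNorm.inv).ennreal_ofReal.aemeasurable
  -- The weight is split as `|p|^{-(n+1)} |p|^{-1}`: the first factor squares to `|p|^{-Q}`, the
  -- second with `u` to the Hardy term, and each contributes `√(log T)`.
  have hcs := ENNReal.lintegral_mul_le_Lp_mul_Lq (volume.restrict (annulus n T))
    Real.HolderConjugate.two_two hm1 hm2
  have e1 : ∀ p : Heis n, ENNReal.ofReal ((homNorm p ^ (n + 1))⁻¹) ^ (2 : ℝ)
      = ENNReal.ofReal ((homNorm p ^ (2 * n + 2))⁻¹) := fun p => by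
    have := homNorm_nonneg p
    rw [ENNReal.ofReal_rpow_of_nonneg (by positivity) (by norm_num), Real.rpow_two, inv_pow,
      ← pow_mul]
    congr 3; ring
  have e2 : ∀ p : Heis n, ENNReal.ofReal (|u.toFun p| * (homNorm p)⁻¹) ^ (2 : ℝ)
      = ENNReal.ofReal (u.toFun p ^ 2 * (homNorm p ^ 2)⁻¹) := fun p => by
    have := homNorm_nonneg p
    rw [ENNReal.ofReal_rpow_of_nonneg (by positivity) (by norm_num), Real.rpow_two, mul_pow,
      sq_abs, inv_pow]
  simp only [e1, e2] at hcs
  calc _ = ∫⁻ p in annulus n T, ((fun p : Heis n => ENNReal.ofReal ((homNorm p ^ (n + 1))⁻¹)) *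
        fun p => ENNReal.ofReal (|u.toFun p| * (homNorm p)⁻¹)) p := by
        refine lintegral_congr fun p => ?_
        have := homNorm_nonneg p
        rw [Pi.mul_apply, ← ENNReal.ofReal_mul (by positivity), pow_succ _ (n + 1), mul_inv]
        congr 1; ring
    _ ≤ _ := hcs
    _ ≤ ENNReal.ofReal (c * Real.log T) ^ ((1 : ℝ) / 2) *
        ENNReal.ofReal (C * Real.log T * ‖u‖ ^ 2) ^ ((1 : ℝ) / 2) :=
        mul_le_mul' (ENNReal.rpow_le_rpow (hcb T hlog h0) (by norm_num))
          (ENNReal.rpow_le_rpow (hu u) (by norm_num))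
    _ = _ := by
        rw [ENNReal.ofReal_rpow_of_nonneg (by positivity) (by norm_num),
          ENNReal.ofReal_rpow_of_nonneg (by positivity) (by norm_num),
          ← ENNReal.ofReal_mul (by positivity), ← Real.sqrt_eq_rpow, ← Real.sqrt_eq_rpow,
          Real.sqrt_mul hc.le, Real.sqrt_mul (by positivity), Real.sqrt_mul (by positivity),
          Real.sqrt_sq (norm_nonneg u)]
        congr 1
        calc _ = √c * √C * (√(Real.log T) * √(Real.log T)) * ‖u‖ := by ring
          _ = _ := by rw [Real.mul_self_sqrt hlog0.le]

end Error

/-! ### The Fréchet differential of the functional -/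

section Differential

variable {n : ℕ} {T : ℝ} {hT : 1 < T}

lemma integrable_and_integral_le {α : Type*} [MeasurableSpace α] {μ : Measure α} {f : α → ℝ}
    (hm : AEStronglyMeasurable f μ) (h0 : ∀ x, 0 ≤ f x) {B : ℝ} (hB : 0 ≤ B)
    (h : ∫⁻ x, ENNReal.ofReal (f x) ∂μ ≤ ENNReal.ofReal B) :
    Integrable f μ ∧ ∫ x, f x ∂μ ≤ B := by
  refine ⟨(lintegral_ofReal_ne_top_iff_integrable hm (ae_of_all _ h0)).1
    (ne_top_of_le_ne_top ENNReal.ofReal_ne_top h), ?_⟩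
  rw [integral_eq_lintegral_of_nonneg_ae (ae_of_all _ h0) hm]
  exact ENNReal.toReal_le_of_le_ofReal hB h

lemma functional_eq (hn : 1 ≤ n) {u : X n T hT}
    (hu : IntegrableOn (fun p => |u.toFun p| ^ (2 + 2 / (n : ℝ))) (annulus n T)) :
    functional n T hT u = 1 / 2 * ‖u‖ ^ 2
      - 1 / (2 + 2 / (n : ℝ)) * ∫ p in annulus n T, |u.toFun p| ^ (2 + 2 / (n : ℝ)) := by
  have hg : IntegrableOn (fun p => ∑ i, u.grad i p ^ 2) (annulus n T) := by
    refine integrable_finsetSum _ fun i _ => ?_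
    simp only [sq]
    exact u.integrable_grad_mul u i
  rw [functional, critExp_eq hn, integral_sub (hg.const_mul _) (hu.const_mul _),
    integral_const_mul, integral_const_mul, X.norm_sq_eq]

/-- `J_T` is Fréchet differentiable at the nonnegative bounded elements of `X_T`. -/
theorem hasFDerivAt_functional (hn : 1 ≤ n) {C K A : ℝ} (hC : 0 < C) (hK : 0 < K)
    (hsob : ∀ u : X n T hT, ∫⁻ p in annulus n T, ENNReal.ofReal (|u.toFun p| ^ (2 + 2 / (n : ℝ)))
        ≤ ENNReal.ofReal ((C * ‖u‖ ^ 2) ^ (1 + 1 / (n : ℝ))))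
    (hpoin : ∀ u : X n T hT, ∫⁻ p in annulus n T, ENNReal.ofReal (u.toFun p ^ 2)
      ≤ ENNReal.ofReal (K * ‖u‖ ^ 2)) {Ψ : X n T hT} {P : Heis n → ℝ}
    (hP : Ψ.toFun =ᵐ[volume] P) (hP0 : ∀ p, 0 ≤ P p) (hPA : ∀ p ∈ annulus n T, P p ≤ A)
    (hPe : L2Loc fun p => P p ^ (1 + 2 / (n : ℝ))) (ℓ : X n T hT →L[ℝ] ℝ)
    (hℓ : ∀ ψ : X n T hT, ℓ ψ = inner ℝ Ψ ψ
      - ∫ p in annulus n T, P p ^ (1 + 2 / (n : ℝ)) * ψ.toFun p) :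
    HasFDerivAt (functional n T hT) ℓ Ψ := by
  have hn0 : (0 : ℝ) < n := by exact_mod_cast hn
  set e : ℝ := 1 + 2 / (n : ℝ) with he
  have he1 : 1 < e := by rw [he]; linarith [div_pos two_pos hn0]
  set a : ℝ := 1 + 1 / (n : ℝ) with ha
  have ha1 : 1 ≤ a := by rw [ha]; linarith [one_div_pos.2 hn0]
  have hq : 2 + 2 / (n : ℝ) = e + 1 := by rw [he]; ring
  rw [hq] at hsob
  set D : ℝ := (e + 1) * e * 2 ^ (e - 1) * max 1 (A ^ (e - 1)) with hD
  have hD0 : 0 < D := by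
    have : 0 < max 1 (A ^ (e - 1)) := zero_lt_one.trans_le (le_max_left _ _)
    positivity
  have hcont : Continuous fun t : ℝ => |t| ^ (e + 1) :=
    continuous_abs.rpow_const fun _ => Or.inr (by linarith)
  have hI : ∀ u : X n T hT, IntegrableOn (fun p => |u.toFun p| ^ (e + 1)) (annulus n T) ∧
      ∫ p in annulus n T, |u.toFun p| ^ (e + 1) ≤ (C * ‖u‖ ^ 2) ^ a := fun u =>
    integrable_and_integral_le (hcont.measurable.comp u.measurable_toFun).aestronglyMeasurable
      (fun p => Real.rpow_nonneg (abs_nonneg _) _) (by positivity) (hsob u)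
  have hI2 : ∀ u : X n T hT, IntegrableOn (fun p => u.toFun p ^ 2) (annulus n T) ∧
      ∫ p in annulus n T, u.toFun p ^ 2 ≤ K * ‖u‖ ^ 2 := fun u =>
    integrable_and_integral_le (u.measurable_toFun.pow_const 2).aestronglyMeasurable
      (fun p => sq_nonneg _) (by positivity) (hpoin u)
  have hPh : ∀ u : X n T hT, IntegrableOn (fun p => P p ^ e * u.toFun p) (annulus n T) := fun u =>
    (hPe _ (isCompact_annulus n T) (annulus_subset n T)).integrable_mul
      (u.l2Loc_toFun _ (isCompact_annulus n T) (annulus_subset n T))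
  have hJ : ∀ u : X n T hT, functional n T hT u = 1 / 2 * ‖u‖ ^ 2
      - 1 / (e + 1) * ∫ p in annulus n T, |u.toFun p| ^ (e + 1) := fun u => by
    have := functional_eq hn (u := u)
    rw [hq] at this
    exact this (hI u).1
  have key : ∀ h : X n T hT, |functional n T hT (Ψ + h) - functional n T hT Ψ - ℓ h|
      ≤ 1 / 2 * ‖h‖ ^ 2 + D * (K * ‖h‖ ^ 2 + (C * ‖h‖ ^ 2) ^ a) := by
    intro h
    have hR : |(∫ p in annulus n T, |(Ψ + h).toFun p| ^ (e + 1))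
        - (∫ p in annulus n T, |Ψ.toFun p| ^ (e + 1))
        - (e + 1) * ∫ p in annulus n T, P p ^ e * h.toFun p|
        ≤ D * (K * ‖h‖ ^ 2 + (C * ‖h‖ ^ 2) ^ a) := by
      have hd : Integrable (fun p => |(Ψ + h).toFun p| ^ (e + 1) - |Ψ.toFun p| ^ (e + 1))
        (volume.restrict (annulus n T)) := (hI _).1.sub (hI _).1
      rw [← integral_const_mul, ← integral_sub (hI _).1 (hI _).1,
        ← integral_sub hd ((hPh h).const_mul _), ← Real.norm_eq_abs]
      calc _ ≤ ∫ p in annulus n T, D * (h.toFun p ^ 2 + |h.toFun p| ^ (e + 1)) := by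
            refine norm_integral_le_of_norm_le (((hI2 h).1.add (hI h).1).const_mul D) ?_
            filter_upwards [ae_restrict_of_ae hP, ae_restrict_of_ae (X.toFun_add Ψ h),
              ae_restrict_mem (isCompact_annulus n T).measurableSet] with p h1 h2 hp
            rw [Real.norm_eq_abs, h2, Pi.add_apply, h1]
            exact abs_rpow_taylor_le he1 (hP0 p) (hPA p hp)
        _ = D * ((∫ p in annulus n T, h.toFun p ^ 2)
            + ∫ p in annulus n T, |h.toFun p| ^ (e + 1)) := by
            rw [integral_const_mul, integral_add (hI2 h).1 (hI h).1]
        _ ≤ _ := by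
            gcongr
            · exact (hI2 h).2
            · exact (hI h).2
    set R := (∫ p in annulus n T, |(Ψ + h).toFun p| ^ (e + 1))
        - (∫ p in annulus n T, |Ψ.toFun p| ^ (e + 1))
        - (e + 1) * ∫ p in annulus n T, P p ^ e * h.toFun p with hRdef
    -- The quadratic part expands exactly and leaves `½ ‖h‖²`, so only the power term needs the
    -- Taylor estimate.
    have e1 : functional n T hT (Ψ + h) - functional n T hT Ψ - ℓ h
        = 1 / 2 * ‖h‖ ^ 2 - 1 / (e + 1) * R := by
      rw [hJ, hJ, hℓ, norm_add_sq_real, hRdef]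
      have : e + 1 ≠ 0 := by linarith
      field_simp
      ring
    rw [e1]
    refine (abs_sub _ _).trans (add_le_add (le_of_eq (abs_of_nonneg (by positivity))) ?_)
    rw [abs_mul, abs_of_pos (by positivity)]
    refine le_trans (mul_le_of_le_one_left (abs_nonneg _) ?_) hR
    rw [div_le_one (by linarith)]; linarith
  -- For `‖u - Ψ‖ ≤ 1` the Sobolev contribution, of order `2a ≥ 2` in the norm, is also bounded by
  -- the square.
  have hbig : (fun u => functional n T hT u - functional n T hT Ψ - ℓ (u - Ψ))
      =O[𝓝 Ψ] fun u => ‖u - Ψ‖ ^ 2 := by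
    refine Asymptotics.IsBigO.of_bound (1 / 2 + D * (K + C ^ a)) ?_
    filter_upwards [Metric.ball_mem_nhds Ψ one_pos] with u hu
    rw [mem_ball_iff_norm] at hu
    have h1 := key (u - Ψ)
    rw [add_sub_cancel] at h1
    rw [Real.norm_eq_abs, Real.norm_eq_abs, abs_of_nonneg (sq_nonneg ‖u - Ψ‖)]
    refine h1.trans ?_
    set x := ‖u - Ψ‖ ^ 2 with hx
    have hx0 : 0 ≤ x := sq_nonneg _
    have hx1 : x ≤ 1 := pow_le_one₀ (norm_nonneg _) hu.le
    have h2 : (C * x) ^ a ≤ C ^ a * x := by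
      rw [Real.mul_rpow hC.le hx0]
      gcongr
      rcases hx0.eq_or_lt with h | h
      · rw [← h, Real.zero_rpow (by linarith)]
      · simpa using Real.rpow_le_rpow_of_exponent_ge h hx1 ha1
    calc _ ≤ 1 / 2 * x + D * (K * x + C ^ a * x) := by gcongr
      _ = _ := by ring
  refine HasFDerivAt.of_isLittleO (hbig.trans_isLittleO ?_)
  have ht : Tendsto (fun u : X n T hT => u - Ψ) (𝓝 Ψ) (𝓝 0) := by
    have : Tendsto (fun u : X n T hT => u - Ψ) (𝓝 Ψ) (𝓝 (Ψ - Ψ)) :=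
      (continuous_id.sub continuous_const).tendsto Ψ
    rwa [sub_self] at this
  exact (Asymptotics.isLittleO_norm_pow_id one_lt_two).comp_tendsto ht

end Differential

/-! ### The gradient of the functional at the periodized bubble -/

section Gradient

variable {n : ℕ} {T r : ℝ} {hT : 1 < T}

/-- The error of the periodized bubble, as a linear form on `X_T`. -/
lemma exists_clm_error {C K : ℝ} (hn : 1 ≤ n) (hT2 : 2 ≤ T) (hr : 0 < r) (hC : 0 < C)
    (hK : 0 < K)
    (herr : ∀ p : Heis n, p ≠ 0 → |(∑' k : ℤ, bubbleScaled n (r / T ^ k) p ^ (1 + 2 / (n : ℝ)))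
        - periodizedBubble n r T p ^ (1 + 2 / (n : ℝ))| ≤ C * (√T)⁻¹ * (homNorm p ^ (n + 2))⁻¹)
    (hinv : ∀ u : X n T hT,
      ∫⁻ p in annulus n T, ENNReal.ofReal ((homNorm p ^ (n + 2))⁻¹ * |u.toFun p|)
        ≤ ENNReal.ofReal (K * Real.log T * ‖u‖))
    {Ψ : X n T hT} (hΨ : ∀ i, Ψ.grad i =ᵐ[volume]
      fun p => ∑' k : ℤ, fieldDeriv i (bubbleScaled n (r / T ^ k)) p)
    (hPe : L2Loc fun p => periodizedBubble n r T p ^ (1 + 2 / (n : ℝ))) :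
    ∃ ℓ : X n T hT →L[ℝ] ℝ, (∀ ψ : X n T hT, ℓ ψ = inner ℝ Ψ ψ
        - ∫ p in annulus n T, periodizedBubble n r T p ^ (1 + 2 / (n : ℝ)) * ψ.toFun p) ∧
      ∀ ψ, |ℓ ψ| ≤ C * (√T)⁻¹ * (K * Real.log T) * ‖ψ‖ := by
  have h0 : 0 < T := by linarith
  have hn0 : (0 : ℝ) < n := by exact_mod_cast hn
  have hlog : 0 < Real.log T := Real.log_pos hT
  set e : ℝ := 1 + 2 / (n : ℝ) with he
  have hLe : L2Loc fun p : Heis n => ∑' k : ℤ, bubbleScaled n (r / T ^ k) p ^ e :=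
    (scaleDecay_bubbleScaled_rpow hn h0 hr).l2Loc_tsum (by positivity) hT2 hr fun k =>
      ((contDiff_bubbleScaled (n := n) (by positivity : 0 < r / T ^ k) (m := 1)).continuous.rpow_const
        fun p => Or.inr (by positivity)).aestronglyMeasurable
  have hint : ∀ {f : Heis n → ℝ}, L2Loc f → ∀ ψ : X n T hT,
      IntegrableOn (fun p => f p * ψ.toFun p) (annulus n T) := fun hf ψ =>
    (hf _ (isCompact_annulus n T) (annulus_subset n T)).integrable_mul
      (ψ.l2Loc_toFun _ (isCompact_annulus n T) (annulus_subset n T))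
  let L : X n T hT →ₗ[ℝ] ℝ :=
    { toFun := fun ψ => inner ℝ Ψ ψ
        - ∫ p in annulus n T, periodizedBubble n r T p ^ e * ψ.toFun p
      map_add' := fun ψ φ => by
        have : ∫ p in annulus n T, periodizedBubble n r T p ^ e * (ψ + φ).toFun p
            = ∫ p in annulus n T, (periodizedBubble n r T p ^ e * ψ.toFun p
              + periodizedBubble n r T p ^ e * φ.toFun p) := by
          refine integral_congr_ae ?_
          filter_upwards [ae_restrict_of_ae (X.toFun_add ψ φ)] with p hp
          rw [hp, Pi.add_apply, mul_add]
        rw [this, integral_add (hint hPe ψ) (hint hPe φ), inner_add_right]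
        ring
      map_smul' := fun c ψ => by
        have : ∫ p in annulus n T, periodizedBubble n r T p ^ e * (c • ψ).toFun p
            = ∫ p in annulus n T, c * (periodizedBubble n r T p ^ e * ψ.toFun p) := by
          refine integral_congr_ae ?_
          filter_upwards [ae_restrict_of_ae (X.toFun_smul c ψ)] with p hp
          rw [hp, Pi.smul_apply, smul_eq_mul]; ring
        rw [this, integral_const_mul, real_inner_smul_right, RingHom.id_apply, smul_eq_mul]
        ring }
  have hB : ∀ ψ, ‖L ψ‖ ≤ C * (√T)⁻¹ * (K * Real.log T) * ‖ψ‖ := by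
    intro ψ
    -- The weak equation of the periodized bubble replaces the inner product by an integral, so that
    -- only the pointwise error remains.
    have e1 : L ψ = ∫ p in annulus n T, ((∑' k : ℤ, bubbleScaled n (r / T ^ k) p ^ e) * ψ.toFun p
        - periodizedBubble n r T p ^ e * ψ.toFun p) := by
      rw [integral_sub (hint hLe ψ) (hint hPe ψ), ← inner_periodizedBubble hn hT2 hr hΨ]
      rfl
    obtain ⟨i1, i2⟩ := integrable_and_integral_le (μ := volume.restrict (annulus n T))
      (f := fun p => (homNorm p ^ (n + 2))⁻¹ * |ψ.toFun p|)
      (((measurable_homNorm.pow_const (n + 2)).inv.mul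
        ψ.measurable_toFun.abs).aestronglyMeasurable)
      (fun p => mul_nonneg (inv_nonneg.2 (pow_nonneg (homNorm_nonneg p) _)) (abs_nonneg _))
      (by positivity) (hinv ψ)
    rw [e1]
    calc _ ≤ ∫ p in annulus n T, C * (√T)⁻¹ * ((homNorm p ^ (n + 2))⁻¹ * |ψ.toFun p|) := by
          refine norm_integral_le_of_norm_le (i1.const_mul _) ?_
          filter_upwards [ae_restrict_mem (isCompact_annulus n T).measurableSet] with p hp
          rw [← sub_mul, Real.norm_eq_abs, abs_mul, ← mul_assoc]
          gcongr
          exact herr p (annulus_subset n T hp)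
      _ ≤ C * (√T)⁻¹ * (K * Real.log T * ‖ψ‖) := by
          rw [integral_const_mul]; gcongr
      _ = _ := by ring
  exact ⟨L.mkContinuous _ hB, fun ψ => rfl, hB⟩

end Gradient

end

end Heisenberg

theorem mainTheorem3 (n : ℕ) (hn : 1 ≤ n) (ε : ℝ) (hε : 0 < ε) :
    ∃ T₀ : ℝ, 1 < T₀ ∧ ∀ (T : ℝ) (hT : 1 < T), T₀ ≤ T → ∀ r : ℝ, 0 < r →
      (∀ p : Heis n, p ≠ 0 → Summable fun k : ℤ => bubbleScaled n (r / T ^ k) p) ∧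
      ∃ Ψ : X n T hT, IsPeriodizedBubble r Ψ ∧
        ∃ g : X n T hT, IsGradientAt (functional n T hT) g Ψ ∧ ‖g‖ < ε := by
  obtain ⟨S, T₁, hS, -, hsob⟩ := exists_sobolev_X hn
  obtain ⟨T₂, -, hpoin⟩ := exists_poincare_X hn
  obtain ⟨T₃, -, hcomplete⟩ := exists_completeSpace_X hn
  obtain ⟨K, T₄, hK, -, hinv⟩ := exists_lintegral_inv_mul_abs_le hn
  obtain ⟨C, hC, herr⟩ := exists_abs_periodizedBubble_rpow_sub_le hn
  -- The pointwise error contributes `T^{-1/2}` and its integration against `ψ` a factor `log T`;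
  -- their product tends to zero.
  have hlim : Filter.Tendsto (fun T : ℝ => C * K * (Real.log T / T ^ (1 / 2 : ℝ)))
      Filter.atTop (nhds 0) := by
    simpa using (isLittleO_log_rpow_atTop
      (by norm_num : (0 : ℝ) < 1 / 2)).tendsto_div_nhds_zero.const_mul (C * K)
  obtain ⟨T₅, hT₅⟩ := Filter.eventually_atTop.1 (hlim.eventually (gt_mem_nhds hε))
  -- The bound `2` is for the geometric sums over scales, `T₁` to `T₄` are for the functional
  -- inequalities and the completeness of `X_T`; only `T₅` depends on `ε`, and none depends on `r`.
  refine ⟨max 2 (max T₁ (max T₂ (max T₃ (max T₄ T₅)))), lt_max_of_lt_left one_lt_two,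
    fun T hT hle r hr => ?_⟩
  simp only [max_le_iff] at hle
  obtain ⟨h2, h₁, h₂, h₃, h₄, h₅⟩ := hle
  have h0 : 0 < T := by linarith
  have hn0 : (0 : ℝ) < n := by exact_mod_cast hn
  have hdecay := scaleDecay_bubbleScaled (n := n) hn h0 hr
  refine ⟨fun p hp => hdecay.summable h2 hr hp, ?_⟩
  obtain ⟨Ψ, hΨ, hΨg⟩ := exists_periodizedBubble hn hT h2 hr
  refine ⟨Ψ, hΨ, ?_⟩
  have hP0 := periodizedBubble_nonneg (n := n) h0 hr
  have hPle : ∀ p : Heis n, p ≠ 0 →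
      periodizedBubble n r T p ≤ 5 * (2 * (n : ℝ)) ^ n * (homNorm p ^ n)⁻¹ := fun p hp =>
    (le_abs_self _).trans (hdecay.abs_tsum_le (by positivity) h2 hr hp)
  have hPA : ∀ p ∈ annulus n T, periodizedBubble n r T p ≤ 5 * (2 * (n : ℝ)) ^ n := fun p hp =>
    (hPle p (annulus_subset n T hp)).trans (mul_le_of_le_one_right (by positivity)
      (inv_le_one_of_one_le₀ (one_le_pow₀ hp.1)))
  have hPm : AEStronglyMeasurable (periodizedBubble n r T) volume :=
    hdecay.aestronglyMeasurable_tsum h2 hr fun k =>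
      (contDiff_bubbleScaled (by positivity) (m := 1)).continuous.aestronglyMeasurable
  have hPe : L2Loc fun p : Heis n => periodizedBubble n r T p ^ (1 + 2 / (n : ℝ)) := by
    refine l2Loc_of_abs_le (C := (5 * (2 * (n : ℝ)) ^ n) ^ (1 + 2 / (n : ℝ))) (m := n + 2)
      ((Real.continuous_rpow_const (by positivity)).comp_aestronglyMeasurable hPm) fun p hp => ?_
    have hρ := homNorm_pos hp
    rw [abs_of_nonneg (Real.rpow_nonneg (hP0 p) _)]
    refine (Real.rpow_le_rpow (hP0 p) (hPle p hp) (by positivity)).trans (le_of_eq ?_)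
    rw [Real.mul_rpow (by positivity) (by positivity), Real.inv_rpow (by positivity),
      ← Real.rpow_natCast (homNorm p) n, ← Real.rpow_mul hρ.le,
      show (n : ℝ) * (1 + 2 / n) = ((n + 2 : ℕ) : ℝ) by push_cast; field_simp, Real.rpow_natCast]
  obtain ⟨ℓ, hℓ, hℓB⟩ := exists_clm_error hn h2 hr hC hK (herr T r h2 hr) (hinv T hT h₄) hΨg hPe
  obtain ⟨K', hK', hpoin'⟩ := hpoin T hT h₂
  have hder := hasFDerivAt_functional hn hS hK' (hsob T hT h₁) hpoin' hΨ hP0 hPA hPe ℓ hℓ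
  have := hcomplete T hT h₃
  have hlog : 0 < Real.log T := Real.log_pos hT
  obtain ⟨g, hg, hgB⟩ := exists_inner_eq_of_completeSpace ℓ (by positivity) hℓB
  refine ⟨g, ?_, hgB.trans_lt ?_⟩
  · rw [IsGradientAt, hg]
    exact hder
  · refine lt_of_eq_of_lt ?_ (hT₅ T h₅)
    rw [Real.sqrt_eq_rpow]
    ring
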